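/- **Model.** Let $d\ge 1$ and let $x_0\in[0,1]^d$. One observes $(X_i,Y_i)$, $i=1,\dots,n$, with $Y_i=f(X_i)+\xi_i$, where $X_1,\dots,X_n,\xi_1,\dots,\xi_n$ are independent, each $X_i$ is uniform on $[0,1]^d$, and $\xi_i$ has a Lebesgue density $g_i$ that is symmetric and nonincreasing on the positive half-line; $(g_i)_{i\ge1}$ is a fixed sequence. Write $\mathbb E_f$ for the expectation in this model. **Contrast, noise and kernel.** Let $\rho:\mathbb R\to[0,\infty)$ be a contrast function: $\rho$ is even, convex, differentiable, $\rho(0)=0$, $\rho'$ is $1$-Lipschitz and bounded, $\dot\rho_\infty=\sup|\rho'|$, and there are $L_\rho,\alpha>0$ with $\sup_i\int|\rho''(z+u)-\rho''(z+v)|\,g_i(z)\,dz\le L_\rho|u-v|^\alpha$ for all $u,v\in\mathbb R$. For $c>0$ let $\mathcal G_\rho^{(c)}$ be the set of sequences $(g_i)_i$ as above with $\inf_i\int\rho''(z)g_i(z)\,dz\ge c$. Let $K\ge0$ be a bounded measurable function on $\mathbb R^d$ vanishing outside $[-\frac12,\frac12]^d$, with $\int K=1$ and $K_\infty=\sup K$.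 Assume that $x_0$ is an interior point of $[0,1]^d$ or, more generally, that whenever $K(z)\ne0$ one has $z_j\ge0$ for each $j$ with $x_{0,j}=0$ and $z_j\le0$ for each $j$ with $x_{0,j}=1$. **Estimators.** Let $b\ge1$ be an integer and $M>0$. Let $\mathcal S_b=\{p\in\mathbb N^d:|p|\le b\}$, $N_b=\#\mathcal S_b$, $U(z)=(z^p)_{p\in\mathcal S_b}$, and let $\lambda$ be the smallest eigenvalue of $\int_{[-1/2,1/2]^d}U(x)U(x)^\top K(x)\,dx$. For $h\in(0,1]$ put $V_{x_0}(h)=\prod_j[x_{0,j}-\frac h2,x_{0,j}+\frac h2]\cap[0,1]^d$ and $f_t(x)=\sum_{p\in\mathcal S_b}t_p\big(\frac{x-x_0}h\big)^p\mathbb 1_{V_{x_0}(h)}(x)$. Let $\hat\theta(h)$ be any measurable choice of a minimiser, over $t\in\mathbb R^{N_b}$ with $\|t\|_1\le M$, of $$\frac1{nh^d}\sum_{i=1}^n\rho\big(Y_i-f_t(X_i)\big)K\Big(\frac{X_i-x_0}h\Big),$$ and let $\hat f^h(x_0)=\hat\theta_{0,\dots,0}(h)$ be the $\rho$-LPA estimator.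 **Bandwidth selection.** Let $h_{\min}=(\ln n)^{2/d}n^{-1/d}$, $h_{\max}=n^{-1/(2b+d)}$, $h_k=2^{-k}h_{\max}$, let $\mathbf k_n$ be the largest integer $k$ with $h_k\ge h_{\min}$ (it exists for all large $n$), and write $\hat f^{(k)}=\hat f^{h_k}$. For $r\ge1$ let $$C=\frac{4N_b}{c\lambda}\Big(1+2K_\infty(1\vee\dot\rho_\infty)\sqrt{rd}\Big),\qquad S_n(l)=\Big[\frac{1+l\ln2}{nh_l^d}\Big]^{1/2},$$ $$\hat k=\min\big\{0\le k\le\mathbf k_n:\ |\hat f^{(k)}(x_0)-\hat f^{(l)}(x_0)|\le C\,S_n(l)\ \text{ for all } k<l\le\mathbf k_n\big\},\qquad \hat f^*(x_0)=\hat f^{(\hat k)}(x_0).$$ **Risk.** For $\beta,L>0$ let $\lfloor\beta\rfloor$ be the largest integer strictly smaller than $\beta$, and let $\mathbb H_d(\beta,L,M)$ be the set of $f:[0,1]^d\to\mathbb R$ that have all partial derivatives of order up to $\lfloor\beta\rfloor$ on $[0,1]^d$, with $|\partial^pf(x)-\partial^pf(y)|\le L\|x-y\|_1^{\beta-\lfloor\beta\rfloor}$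 for all $x,y$ and all $|p|=\lfloor\beta\rfloor$, and $\sum_{|p|\le\lfloor\beta\rfloor}\sup_{[0,1]^d}|\partial^pf|\le M$. Let $R_{n,r}[\tilde f,\mathbb H]=\sup_{f\in\mathbb H}\mathbb E_f|\tilde f(x_0)-f(x_0)|^r$ and $$\phi_n(\beta)=\Big(\frac{\varrho_n(\beta)}n\Big)^{\frac\beta{2\beta+d}},\qquad \varrho_n(\beta)=1+\frac{2(b-\beta)}{(2\beta+d)(2b+d)}\ln n .$$ **Theorem.** For every $c>0$, every $(g_i)_i\in\mathcal G_\rho^{(c)}$ and every $r\ge1$, the estimator $\hat f^*$, whose construction involves neither $\beta$ nor $L$, satisfies for all $\beta\in(0,b]$ and all $L>0$ $$\limsup_{n\to\infty}\ \phi_n(\beta)^{-r}\,R_{n,r}\big[\hat f^*(x_0),\mathbb H_d(\beta,L,M)\big]<\infty .$$ That is, $\hat f^*$ is adaptive over $\beta\in(0,b]$, $L>0$ for the family of rates $\{\phi_n(\beta)\}$. -/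

import Mathlib

open MeasureTheory Filter
open scoped ENNReal

noncomputable section

namespace RhoLPA

/-- The unit cube `[0,1]^d`. -/
def cube (d : ℕ) : Set (Fin d → ℝ) := Set.Icc 0 1

/-- The multi-indices `p ∈ ℕ^d` with `|p| = p_1 + ... + p_d ≤ b`. -/
def multiIdx (d b : ℕ) : Finset (Fin d → ℕ) :=
  (Fintype.piFinset fun _ : Fin d => Finset.range (b + 1)).filter fun p => ∑ j, p j ≤ b

theorem mem_multiIdx {d b : ℕ} {p : Fin d → ℕ} : p ∈ multiIdx d b ↔ ∑ j, p j ≤ b := by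
  simp only [multiIdx, Finset.mem_filter, Fintype.mem_piFinset, Finset.mem_range,
    and_iff_right_iff_imp]
  intro h j
  exact Nat.lt_succ_of_le
    ((Finset.single_le_sum (f := p) (fun i _ => Nat.zero_le _) (Finset.mem_univ j)).trans h)

/-- The multi-index `(0,...,0)`. -/
def zeroIdx (d b : ℕ) : multiIdx d b := ⟨0, mem_multiIdx.2 (by simp)⟩

/-- The monomial `z^p`. -/
def monom {d : ℕ} (p : Fin d → ℕ) (z : Fin d → ℝ) : ℝ := ∏ j, z j ^ p j

/-! ### Hölder classes -/

/-- The largest integer strictly smaller than `β`, for `β > 0`. -/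
def strictFloor (β : ℝ) : ℕ := ⌈β⌉₊ - 1

/-- The isotropic Hölder class. A function on `[0,1]^d` is represented by a function on `ℝ^d` of
which only the values on the cube matter. The family `D` consists of the partial derivatives of
`f` on the cube (one-sided on the faces); it is determined by `f` there. -/
def holderClass (d : ℕ) (β L M : ℝ) : Set ((Fin d → ℝ) → ℝ) :=
  {f | ∃ D : (Fin d → ℕ) → (Fin d → ℝ) → ℝ,
    (∀ x ∈ cube d, D 0 x = f x) ∧
    (∀ p : Fin d → ℕ, ∑ j, p j < strictFloor β → ∀ j : Fin d, ∀ x ∈ cube d,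
      HasDerivWithinAt (fun s : ℝ => D p (Function.update x j s)) (D (p + Pi.single j 1) x)
        (Set.Icc 0 1) (x j)) ∧
    (∀ p : Fin d → ℕ, ∑ j, p j = strictFloor β → ∀ x ∈ cube d, ∀ y ∈ cube d,
      |D p x - D p y| ≤ L * (∑ j, |x j - y j|) ^ (β - (strictFloor β : ℝ))) ∧
    ∑ p ∈ multiIdx d (strictFloor β), ⨆ x ∈ cube d, ENNReal.ofReal |D p x|
      ≤ ENNReal.ofReal M}

/-! ### Contrast function, noise densities and kernel -/

/-- `g` is a symmetric probability density, nonincreasing on the positive half-line. -/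
structure IsNoiseDensity (g : ℝ → ℝ) : Prop where
  measurable : Measurable g
  nonneg : ∀ z, 0 ≤ g z
  integral_eq_one : ∫ z, g z = 1
  symm : ∀ z, g (-z) = g z
  anti : AntitoneOn g (Set.Ioi 0)

/-- `ρ` is a contrast function (for the noise densities `g`). -/
structure IsContrast (ρ : ℝ → ℝ) (g : ℕ → ℝ → ℝ) : Prop where
  nonneg : ∀ z, 0 ≤ ρ z
  symm : ∀ z, ρ (-z) = ρ z
  convex : ConvexOn ℝ Set.univ ρ
  zero : ρ 0 = 0
  differentiable : Differentiable ℝ ρ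
  lipschitz : LipschitzWith 1 (deriv ρ)
  bounded : BddAbove (Set.range fun z => |deriv ρ z|)
  ae_differentiable : ∀ᵐ z : ℝ, DifferentiableAt ℝ (deriv ρ) z
  holder : ∃ Lρ > 0, ∃ α > 0, ∀ i, ∀ u v : ℝ,
    ∫ z, |deriv (deriv ρ) (z + u) - deriv (deriv ρ) (z + v)| * g i z ≤ Lρ * |u - v| ^ (α : ℝ)

/-- The class of sequences of noise densities with `inf_i ∫ ρ'' g_i ≥ c`. -/
def noiseClass (ρ : ℝ → ℝ) (c : ℝ) : Set (ℕ → ℝ → ℝ) :=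
  {g | (∀ i, IsNoiseDensity (g i)) ∧ ∀ i, c ≤ ∫ z, deriv (deriv ρ) z * g i z}

/-- The box `[-1/2,1/2]^d`. -/
def kernelBox (d : ℕ) : Set (Fin d → ℝ) := Set.Icc (fun _ => -(1 / 2)) (fun _ => 1 / 2)

/-- `K` is a kernel function. -/
structure IsKernel {d : ℕ} (K : (Fin d → ℝ) → ℝ) : Prop where
  measurable : Measurable K
  nonneg : ∀ z, 0 ≤ K z
  support : ∀ z, K z ≠ 0 → z ∈ kernelBox d
  bounded : BddAbove (Set.range fun z => |K z|)
  integral_eq_one : ∫ z, K z = 1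

/-- The support of the kernel, scaled by small `h` and moved to `x₀`, lies in the unit cube.
No condition when `x₀` is an interior point of the cube. -/
def KernelInward {d : ℕ} (K : (Fin d → ℝ) → ℝ) (x₀ : Fin d → ℝ) : Prop :=
  ∀ z, K z ≠ 0 → ∀ j, (x₀ j = 0 → 0 ≤ z j) ∧ (x₀ j = 1 → z j ≤ 0)

/-- The sup-norm. -/
def supNorm {α : Type*} (f : α → ℝ) : ℝ := ⨆ x, |f x|

/-- The matrix `∫_{[-1/2,1/2]^d} U(x) U(x)ᵀ K(x) dx`. -/
def kernelMatrix {d : ℕ} (b : ℕ) (K : (Fin d → ℝ) → ℝ) :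
    Matrix (multiIdx d b) (multiIdx d b) ℝ :=
  Matrix.of fun p q => ∫ x in kernelBox d, monom p.1 x * monom q.1 x * K x

/-- The smallest eigenvalue `λ` of that matrix. -/
def minEigenvalue {d : ℕ} (b : ℕ) (K : (Fin d → ℝ) → ℝ) : ℝ :=
  sInf (spectrum ℝ (kernelMatrix b K))

/-! ### The local polynomial M-estimator -/

/-- A sample `(X_i, Y_i)`, `i = 1,...,n`. -/
abbrev Sample (d n : ℕ) : Type := Fin n → (Fin d → ℝ) × ℝ

/-- The neighbourhood `V_{x₀}(h)`. -/
def nbhd {d : ℕ} (x₀ : Fin d → ℝ) (h : ℝ) : Set (Fin d → ℝ) :=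
  Set.Icc (fun j => x₀ j - h / 2) (fun j => x₀ j + h / 2) ∩ cube d

/-- The local polynomial `f_t`. -/
def localPoly {d b : ℕ} (x₀ : Fin d → ℝ) (h : ℝ) (t : multiIdx d b → ℝ) : (Fin d → ℝ) → ℝ :=
  (nbhd x₀ h).indicator fun x => ∑ p : multiIdx d b, t p * monom p.1 (fun j => (x j - x₀ j) / h)

/-- The parameter set `Θ(M)`. -/
def paramSet (d b : ℕ) (M : ℝ) : Set (multiIdx d b → ℝ) := {t | ∑ p, |t p| ≤ M}

/-- The local `ρ`-criterion. -/
def criterion {d n b : ℕ} (ρ : ℝ → ℝ) (K : (Fin d → ℝ) → ℝ) (x₀ : Fin d → ℝ) (h : ℝ)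
    (Z : Sample d n) (t : multiIdx d b → ℝ) : ℝ :=
  1 / (n * h ^ d) * ∑ i, ρ ((Z i).2 - localPoly x₀ h t (Z i).1) *
    K (fun j => ((Z i).1 j - x₀ j) / h)

/-- `θ` is a (measurable) minimiser of the local `ρ`-criterion over `Θ(M)`. -/
def IsLPAMinimizer {d n b : ℕ} (ρ : ℝ → ℝ) (K : (Fin d → ℝ) → ℝ) (x₀ : Fin d → ℝ) (M h : ℝ)
    (θ : Sample d n → multiIdx d b → ℝ) : Prop :=
  Measurable θ ∧ ∀ Z, θ Z ∈ paramSet d b M ∧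
    ∀ t ∈ paramSet d b M, criterion ρ K x₀ h Z (θ Z) ≤ criterion ρ K x₀ h Z t

/-! ### The bandwidth selection rule -/

def hMin (d n : ℕ) : ℝ := Real.log n ^ (2 / d : ℝ) * (n : ℝ) ^ (-(1 / d) : ℝ)

def hMax (d b n : ℕ) : ℝ := (n : ℝ) ^ (-(1 / (2 * b + d)) : ℝ)

/-- The dyadic grid `h_k = 2^{-k} h_max`. -/
def bandwidth (d b n k : ℕ) : ℝ := hMax d b n / 2 ^ k

/-- The largest `k` with `h_k ≥ h_min` (it exists for all large `n`). -/
def kLast (d b n : ℕ) : ℕ := sSup {k : ℕ | hMin d n ≤ bandwidth d b n k}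

/-- `S_n(l)`. -/
def stdBound (d b n l : ℕ) : ℝ :=
  Real.sqrt ((1 + l * Real.log 2) / (n * bandwidth d b n l ^ d))

/-- The threshold constant `C`. -/
def thresholdConst {d : ℕ} (b : ℕ) (ρ : ℝ → ℝ) (K : (Fin d → ℝ) → ℝ) (c r : ℝ) : ℝ :=
  4 * (multiIdx d b).card / (c * minEigenvalue b K) *
    (1 + 2 * supNorm K * max 1 (supNorm (deriv ρ)) * Real.sqrt (r * d))

/-- The estimator `f̂^{(k)}(x₀)`, for a given family `θ n h` of minimisers. -/
def lpaEstimator {d b : ℕ} (θ : (n : ℕ) → ℝ → Sample d n → multiIdx d b → ℝ) (n k : ℕ)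
    (Z : Sample d n) : ℝ :=
  θ n (bandwidth d b n k) Z (zeroIdx d b)

/-- The selected index `k̂`. -/
def selectedIndex {d b : ℕ} (C : ℝ) (θ : (n : ℕ) → ℝ → Sample d n → multiIdx d b → ℝ) (n : ℕ)
    (Z : Sample d n) : ℕ :=
  sInf {k : ℕ | k ≤ kLast d b n ∧ ∀ l, k + 1 ≤ l → l ≤ kLast d b n →
    |lpaEstimator θ n k Z - lpaEstimator θ n l Z| ≤ C * stdBound d b n l}

/-- The estimator `f̂*(x₀)` selected by Lepski's rule. -/
def adaptiveEstimator {d b : ℕ} (C : ℝ) (θ : (n : ℕ) → ℝ → Sample d n → multiIdx d b → ℝ)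
    (n : ℕ) (Z : Sample d n) : ℝ :=
  lpaEstimator θ n (selectedIndex C θ n Z) Z

/-! ### The model and the risk -/

/-- The joint law of `(X_i, ξ_i)`, `i = 1,...,n`: everything independent, `X_i` uniform on the
cube and `ξ_i` with density `g_i`. -/
def modelLaw (d : ℕ) (g : ℕ → ℝ → ℝ) (n : ℕ) : Measure (Sample d n) :=
  Measure.pi fun i : Fin n => (volume.restrict (cube d)).prod
    (volume.withDensity fun z : ℝ => ENNReal.ofReal (g i z))

/-- The observations `(X_i, f(X_i) + ξ_i)`. -/
def observe {d n : ℕ} (f : (Fin d → ℝ) → ℝ) (ω : Sample d n) : Sample d n :=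
  fun i => ((ω i).1, f (ω i).1 + (ω i).2)

/-- The maximal risk over a class `F` of an estimator of `f x₀`. -/
def maxRisk {d n : ℕ} (g : ℕ → ℝ → ℝ) (r : ℝ) (x₀ : Fin d → ℝ) (est : Sample d n → ℝ)
    (F : Set ((Fin d → ℝ) → ℝ)) : ℝ≥0∞ :=
  ⨆ f ∈ F, ∫⁻ ω, ENNReal.ofReal (|est (observe f ω) - f x₀| ^ r) ∂(modelLaw d g n)

/-- `ϱ_n(β)`. -/
def adaptPrice (d b n : ℕ) (β : ℝ) : ℝ :=
  1 + 2 * (b - β) / ((2 * β + d) * (2 * b + d)) * Real.log n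

/-- The rate `φ_n(β)`. -/
def rate (d b n : ℕ) (β : ℝ) : ℝ := (adaptPrice d b n β / n) ^ (β / (2 * β + d))

end RhoLPA

end

/-!
Let `t` be the Taylor polynomial of `f` at `x₀` in the rescaled coordinates, so that its constant
coefficient is `f x₀`. The minimiser `θ̂` of the convex criterion is compared with `t` by bounding
the gradient at `t` from above and the curvature around `t` from below.

* *Gradient.* Since the noise is symmetric, the smoothed score `u ↦ ∫ ρ'(z + u) g_i(z) dz` vanishes
  at `0`, and it is `1`-Lipschitz. The mean of the gradient is therefore at most the approximation
  error, which for bandwidths below the oracle one is at most `S_n(l)`, and Bernstein's exponential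
  moment bound controls the fluctuations.
* *Curvature.* The smoothed score has slope at least `c` at `0` and an `α`-Hölder derivative. By a
  Chernoff bound over a finite net of the unit sphere, the criterion has curvature almost `c λ` in
  all directions at small fixed radii, except with probability `exp (-c₁ n h^d)`. As
  `n h^d ≥ (ln n)²` on the grid, this exceptional event is negligible, the estimators being bounded.

Off the exceptional event the error of `f̂^{(l)}` is at most `C S_n(l) / 2` unless the gradient at
level `l` exceeds a multiple of `S_n(l)`, which has probability of order `2 ^ (-2rdl)`. Lepski's
rule either selects an index at most the oracle one, and then loses only a constant factor, or it is
led astray by such an excess. Summed over the levels, the latter contribute a convergent series, so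
the risk is of the order of `S_n` at the oracle index. The bandwidth
`(ϱ_n(β) / n)^{1 / (2β + d)}` is within a constant factor of the grid, and there `S_n` is of the
order of `φ_n(β)`.
-/

noncomputable section

namespace RhoLPA

/-! ### Taylor expansion on the cube -/

section Taylor

variable {d : ℕ}

/-- The divided monomial `z^q / q!`, for which differentiation lowers the multi-index and produces
no factor. -/
def dividedMonom (q : Fin d → ℕ) (z : Fin d → ℝ) : ℝ := ∏ j, z j ^ q j / (q j).factorial

/-- The Taylor polynomial of order `k` at `x` of `D p`, where `D q` stands for the partial
derivative of order `q` of a function. -/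
def taylorPoly (D : (Fin d → ℕ) → (Fin d → ℝ) → ℝ) (k : ℕ) (p : Fin d → ℕ) (x y : Fin d → ℝ) : ℝ :=
  ∑ q ∈ multiIdx d k, D (p + q) x * dividedMonom q (y - x)

/-- `D` is a family of partial derivatives on the cube up to order `m`, those of order `m` being
Hölder continuous with exponent `γ`: the conditions on derivatives in `holderClass`. -/
structure IsHolderJet (m : ℕ) (γ L : ℝ) (D : (Fin d → ℕ) → (Fin d → ℝ) → ℝ) : Prop where
  hasDerivWithinAt : ∀ p : Fin d → ℕ, ∑ j, p j < m → ∀ j : Fin d, ∀ x ∈ cube d,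
    HasDerivWithinAt (fun s : ℝ => D p (Function.update x j s)) (D (p + Pi.single j 1) x)
      (Set.Icc 0 1) (x j)
  holder : ∀ p : Fin d → ℕ, ∑ j, p j = m → ∀ x ∈ cube d, ∀ y ∈ cube d,
    |D p x - D p y| ≤ L * (∑ j, |x j - y j|) ^ γ

theorem zero_mem_multiIdx (d b : ℕ) : (0 : Fin d → ℕ) ∈ multiIdx d b := mem_multiIdx.2 (by simp)

theorem multiIdx_zero (d : ℕ) : multiIdx d 0 = {0} := by
  ext q
  simp [mem_multiIdx, funext_iff]

theorem sum_add_single (q : Fin d → ℕ) (j : Fin d) :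
    ∑ i, (q + Pi.single j 1 : Fin d → ℕ) i = ∑ i, q i + 1 := by
  simp [Finset.sum_add_distrib]

theorem dividedMonom_eq_mul_prod_erase (q : Fin d → ℕ) (z : Fin d → ℝ) (j : Fin d) :
    dividedMonom q z = z j ^ q j / (q j).factorial *
      ∏ i ∈ Finset.univ.erase j, z i ^ q i / (q i).factorial :=
  (Finset.mul_prod_erase _ _ (Finset.mem_univ j)).symm

theorem dividedMonom_update_sub (q : Fin d → ℕ) (x y : Fin d → ℝ) (j : Fin d) (s : ℝ) :
    dividedMonom q (Function.update y j s - x) = (s - x j) ^ q j / (q j).factorial *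
      ∏ i ∈ Finset.univ.erase j, (y i - x i) ^ q i / (q i).factorial := by
  rw [dividedMonom_eq_mul_prod_erase q _ j, Pi.sub_apply, Function.update_self]
  congr 1
  refine Finset.prod_congr rfl fun i hi => ?_
  rw [Pi.sub_apply, Function.update_of_ne (Finset.ne_of_mem_erase hi)]

theorem dividedMonom_zero (z : Fin d → ℝ) : dividedMonom 0 z = 1 := by simp [dividedMonom]

theorem dividedMonom_apply_zero {q : Fin d → ℕ} (hq : q ≠ 0) : dividedMonom q 0 = 0 := by
  obtain ⟨j, hj⟩ := Function.ne_iff.1 hq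
  exact Finset.prod_eq_zero (Finset.mem_univ j) (by simp [show q j ≠ 0 from hj])

theorem hasDerivAt_dividedMonom_add_single (q : Fin d → ℕ) (x y : Fin d → ℝ) (j : Fin d) :
    HasDerivAt (fun s => dividedMonom (q + Pi.single j 1) (Function.update y j s - x))
      (dividedMonom q (y - x)) (y j) := by
  have hpow : HasDerivAt (fun s => (s - x j) ^ (q j + 1) / (q j + 1).factorial)
      ((y j - x j) ^ q j / (q j).factorial) (y j) := by
    refine ((((hasDerivAt_id (y j)).sub_const (x j)).fun_pow (q j + 1)).div_const
      ((q j + 1).factorial : ℝ)).congr_deriv ?_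
    rw [Nat.factorial_succ, Nat.cast_mul, id, mul_one, Nat.add_sub_cancel,
      mul_div_mul_left _ _ (by positivity)]
  have hrest : ∏ i ∈ Finset.univ.erase j, (y i - x i) ^ (q + Pi.single j 1 : Fin d → ℕ) i /
      (((q + Pi.single j 1 : Fin d → ℕ) i).factorial : ℝ) =
      ∏ i ∈ Finset.univ.erase j, (y i - x i) ^ q i / (q i).factorial :=
    Finset.prod_congr rfl fun i hi => by
      rw [Pi.add_apply, Pi.single_eq_of_ne (Finset.ne_of_mem_erase hi), add_zero]
  simp_rw [dividedMonom_update_sub, hrest, dividedMonom_eq_mul_prod_erase q (y - x) j,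
    Pi.add_apply, Pi.single_eq_same]
  exact hpow.mul_const _

theorem hasDerivAt_dividedMonom_of_eq_zero {q : Fin d → ℕ} {j : Fin d} (hq : q j = 0)
    (x y : Fin d → ℝ) :
    HasDerivAt (fun s => dividedMonom q (Function.update y j s - x)) 0 (y j) := by
  simp_rw [dividedMonom_update_sub, hq, pow_zero]
  exact hasDerivAt_const _ _

theorem multiIdx_succ_filter_ne_zero (k : ℕ) (j : Fin d) :
    (multiIdx d (k + 1)).filter (fun q => q j ≠ 0) =
      (multiIdx d k).map (addRightEmbedding (Pi.single j 1)) := by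
  ext q
  simp only [Finset.mem_filter, Finset.mem_map, addRightEmbedding_apply, mem_multiIdx]
  constructor
  · rintro ⟨hq, hj⟩
    have hle : Pi.single j 1 ≤ q := fun i => by
      rcases eq_or_ne i j with rfl | hi
      · simpa using Nat.one_le_iff_ne_zero.2 hj
      · simp [hi]
    have hadd : q - Pi.single j 1 + Pi.single j 1 = q := tsub_add_cancel_of_le hle
    refine ⟨q - Pi.single j 1, ?_, hadd⟩
    rw [← hadd, sum_add_single] at hq
    omega
  · rintro ⟨q', hq', rfl⟩
    rw [sum_add_single]
    exact ⟨by omega, by simp⟩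

theorem hasDerivAt_taylorPoly_update (D : (Fin d → ℕ) → (Fin d → ℝ) → ℝ) (k : ℕ)
    (p : Fin d → ℕ) (x y : Fin d → ℝ) (j : Fin d) :
    HasDerivAt (fun s => taylorPoly D (k + 1) p x (Function.update y j s))
      (taylorPoly D k (p + Pi.single j 1) x y) (y j) := by
  have hpos : HasDerivAt (fun s => ∑ q ∈ multiIdx d k, D (p + (q + Pi.single j 1)) x *
      dividedMonom (q + Pi.single j 1) (Function.update y j s - x))
      (taylorPoly D k (p + Pi.single j 1) x y) (y j) :=
    HasDerivAt.fun_sum fun q _ => by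
      rw [add_assoc, add_comm (Pi.single j 1) q]
      exact (hasDerivAt_dividedMonom_add_single q x y j).const_mul _
  have hzero : HasDerivAt (fun s => ∑ q ∈ (multiIdx d (k + 1)).filter (fun q => ¬ q j ≠ 0),
      D (p + q) x * dividedMonom q (Function.update y j s - x))
      (∑ q ∈ (multiIdx d (k + 1)).filter (fun q => ¬ q j ≠ 0), D (p + q) x * 0) (y j) :=
    HasDerivAt.fun_sum fun q hq => (hasDerivAt_dividedMonom_of_eq_zero
      (not_not.1 (Finset.mem_filter.1 hq).2) x y).const_mul _
  simpa only [taylorPoly, multiIdx_succ_filter_ne_zero, Finset.sum_map, addRightEmbedding_apply,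
    mul_zero, Finset.sum_const_zero, add_zero,
    ← Finset.sum_filter_add_sum_filter_not (multiIdx d (k + 1)) (fun q => q j ≠ 0)]
    using hpos.fun_add hzero

theorem taylorPoly_self (D : (Fin d → ℕ) → (Fin d → ℝ) → ℝ) (k : ℕ) (p : Fin d → ℕ)
    (x : Fin d → ℝ) : taylorPoly D k p x x = D p x := by
  rw [taylorPoly, Finset.sum_eq_single_of_mem 0 (zero_mem_multiIdx d k) fun q _ hq => by
    rw [sub_self, dividedMonom_apply_zero hq, mul_zero]]
  rw [dividedMonom_zero, mul_one, add_zero]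

theorem taylorPoly_order_zero (D : (Fin d → ℕ) → (Fin d → ℝ) → ℝ) (p : Fin d → ℕ)
    (x y : Fin d → ℝ) : taylorPoly D 0 p x y = D p x := by
  rw [taylorPoly, multiIdx_zero, Finset.sum_singleton, dividedMonom_zero, mul_one, add_zero]

theorem continuous_taylorPoly (D : (Fin d → ℕ) → (Fin d → ℝ) → ℝ) (k : ℕ) (p : Fin d → ℕ)
    (x : Fin d → ℝ) : Continuous (taylorPoly D k p x) := by
  unfold taylorPoly dividedMonom
  fun_prop

theorem piecewise_mem_cube {x y : Fin d → ℝ} (hx : x ∈ cube d) (hy : y ∈ cube d)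
    (S : Finset (Fin d)) : S.piecewise y x ∈ cube d :=
  ⟨Finset.le_piecewise_of_le_of_le _ hy.1 hx.1, Finset.piecewise_le_of_le_of_le _ hy.2 hx.2⟩

theorem update_mem_cube {z : Fin d → ℝ} (hz : z ∈ cube d) (j : Fin d) {s : ℝ}
    (hs : s ∈ Set.Icc (0 : ℝ) 1) : Function.update z j s ∈ cube d :=
  ⟨le_update_iff.2 ⟨hs.1, fun i _ => hz.1 i⟩, update_le_iff.2 ⟨hs.2, fun i _ => hz.2 i⟩⟩

-- The path from `x` to `y` moves one coordinate at a time, so every point `z` on it satisfies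
-- `|z i - x i| ≤ |y i - x i|`.
theorem abs_sub_le_of_partial_bound {R : (Fin d → ℝ) → ℝ} {R' : Fin d → (Fin d → ℝ) → ℝ}
    {x y : Fin d → ℝ} (hx : x ∈ cube d) (hy : y ∈ cube d)
    (hR : ∀ j, ∀ z ∈ cube d, HasDerivWithinAt (fun s => R (Function.update z j s)) (R' j z)
      (Set.Icc 0 1) (z j)) {B : ℝ}
    (hB : ∀ j, ∀ z ∈ cube d, (∀ i, |z i - x i| ≤ |y i - x i|) → |R' j z| ≤ B) :
    |R y - R x| ≤ B * ∑ j, |y j - x j| := by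
  suffices key : ∀ S : Finset (Fin d), |R (S.piecewise y x) - R x| ≤ B * ∑ j ∈ S, |y j - x j| by
    simpa using key Finset.univ
  intro S
  induction S using Finset.induction_on with
  | empty => simp
  | insert j S hj ih =>
    set z := S.piecewise y x with hz
    have hzj : z j = x j := by simp [hz, hj]
    have hsub : Set.uIcc (x j) (y j) ⊆ Set.Icc 0 1 :=
      Set.uIcc_subset_Icc ⟨hx.1 j, hx.2 j⟩ ⟨hy.1 j, hy.2 j⟩
    have hcube : ∀ s ∈ Set.uIcc (x j) (y j), Function.update z j s ∈ cube d := fun s hs =>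
      update_mem_cube (piecewise_mem_cube hx hy S) j (hsub hs)
    have hdist : ∀ s ∈ Set.uIcc (x j) (y j), ∀ i,
        |Function.update z j s i - x i| ≤ |y i - x i| := fun s hs i => by
      rcases eq_or_ne i j with rfl | hi
      · simpa using Set.abs_sub_left_of_mem_uIcc hs
      · by_cases hS : i ∈ S <;> simp [hi, hz, hS]
    have hstep : |R (Function.update z j (y j)) - R z| ≤ B * |y j - x j| := by
      have hmvt := Convex.norm_image_sub_le_of_norm_hasDerivWithin_le
        (f := fun s => R (Function.update z j s)) (f' := fun s => R' j (Function.update z j s))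
        (fun s hs => by simpa using (hR j _ (hcube s hs)).mono (by simpa using hsub))
        (fun s hs => hB j _ (hcube s hs) (hdist s hs)) (convex_uIcc _ _)
        Set.left_mem_uIcc Set.right_mem_uIcc
      simpa only [Real.norm_eq_abs, ← hzj, Function.update_eq_self] using hmvt
    rw [Finset.piecewise_insert, Finset.sum_insert hj]
    calc |R (Function.update z j (y j)) - R x|
        ≤ |R (Function.update z j (y j)) - R z| + |R z - R x| := abs_sub_le _ _ _
      _ ≤ B * |y j - x j| + B * ∑ i ∈ S, |y i - x i| := add_le_add hstep ih
      _ = B * (|y j - x j| + ∑ i ∈ S, |y i - x i|) := by ring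

theorem IsHolderJet.abs_sub_taylorPoly_le {m : ℕ} {γ L : ℝ} (hL : 0 ≤ L) (hγ : 0 ≤ γ)
    {D : (Fin d → ℕ) → (Fin d → ℝ) → ℝ} (hD : IsHolderJet m γ L D) {x : Fin d → ℝ}
    (hx : x ∈ cube d) (k : ℕ) (p : Fin d → ℕ) (hp : ∑ j, p j + k = m) {y : Fin d → ℝ}
    (hy : y ∈ cube d) :
    |D p y - taylorPoly D k p x y| ≤ L * (∑ j, |y j - x j|) ^ (γ + k) := by
  induction k generalizing p y with
  | zero =>
    rw [taylorPoly_order_zero]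
    simpa using hD.holder p (by simpa using hp) y hy x hx
  | succ k ih =>
    have hΔ : 0 ≤ ∑ j, |y j - x j| := Finset.sum_nonneg fun _ _ => abs_nonneg _
    have hmvt := abs_sub_le_of_partial_bound
      (R := fun y => D p y - taylorPoly D (k + 1) p x y)
      (R' := fun j z => D (p + Pi.single j 1) z - taylorPoly D k (p + Pi.single j 1) x z)
      hx hy (fun j z hz => (hD.hasDerivWithinAt p (by omega) j z hz).sub
        (hasDerivAt_taylorPoly_update D k p x z j).hasDerivWithinAt)
      (B := L * (∑ j, |y j - x j|) ^ (γ + k)) fun j z hz hzy =>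
        (ih _ (by rw [sum_add_single]; omega) hz).trans <| mul_le_mul_of_nonneg_left
          (Real.rpow_le_rpow (Finset.sum_nonneg fun _ _ => abs_nonneg _)
            (Finset.sum_le_sum fun i _ => hzy i) (by positivity)) hL
    simp only [taylorPoly_self, sub_self, sub_zero] at hmvt
    rwa [mul_assoc, ← Real.rpow_add_one' hΔ (by positivity), add_assoc, ← Nat.cast_succ] at hmvt

end Taylor

/-! ### Polynomial approximation in Hölder classes -/

section Holder

variable {d b : ℕ}

/-- The affine change of variables `(x - x₀) / h` that carries the bandwidth neighbourhood of `x₀`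
onto the kernel box. -/
def rescale (x₀ : Fin d → ℝ) (h : ℝ) (x : Fin d → ℝ) : Fin d → ℝ := fun j => (x j - x₀ j) / h

/-- The polynomial `wᵀ U(z) = ∑ w_p z^p`. -/
def polyVal (w : multiIdx d b → ℝ) (z : Fin d → ℝ) : ℝ := ∑ p, w p * monom p.1 z

/-- The coefficients, in the rescaled monomials `((x - x₀) / h)^p`, of the Taylor polynomial of
order `m` at `x₀` of the function with partial derivatives `D`. -/
def taylorCoeff (D : (Fin d → ℕ) → (Fin d → ℝ) → ℝ) (m b : ℕ) (x₀ : Fin d → ℝ) (h : ℝ) :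
    multiIdx d b → ℝ :=
  fun p => if p.1 ∈ multiIdx d m then D p.1 x₀ * ∏ j, h ^ p.1 j / (p.1 j).factorial else 0

theorem strictFloor_lt {β : ℝ} (hβ : 0 < β) : (strictFloor β : ℝ) < β := by
  rw [strictFloor, Nat.cast_sub (Nat.ceil_pos.2 hβ), Nat.cast_one]
  linarith [Nat.ceil_lt_add_one hβ.le]

theorem multiIdx_mono {m b : ℕ} (hmb : m ≤ b) : multiIdx d m ⊆ multiIdx d b := fun _ hp =>
  mem_multiIdx.2 ((mem_multiIdx.1 hp).trans hmb)

theorem sum_multiIdx_ite {m : ℕ} (hmb : m ≤ b) (F : (Fin d → ℕ) → ℝ) :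
    ∑ p : multiIdx d b, (if p.1 ∈ multiIdx d m then F p.1 else 0) = ∑ p ∈ multiIdx d m, F p := by
  rw [Finset.sum_coe_sort (multiIdx d b) (fun p => if p ∈ multiIdx d m then F p else 0),
    Finset.sum_ite_mem, Finset.inter_eq_right.2 (multiIdx_mono hmb)]

theorem polyVal_taylorCoeff_rescale (D : (Fin d → ℕ) → (Fin d → ℝ) → ℝ) {m : ℕ} (hmb : m ≤ b)
    (x₀ x : Fin d → ℝ) {h : ℝ} (hh : h ≠ 0) :
    polyVal (taylorCoeff D m b x₀ h) (rescale x₀ h x) = taylorPoly D m 0 x₀ x := by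
  simp only [polyVal, taylorCoeff, ite_mul, zero_mul, taylorPoly]
  rw [sum_multiIdx_ite hmb fun p => D p x₀ * (∏ j, h ^ p j / (p j).factorial) *
    monom p (rescale x₀ h x)]
  refine Finset.sum_congr rfl fun p _ => ?_
  rw [zero_add, mul_assoc, dividedMonom, monom, ← Finset.prod_mul_distrib]
  congr 1
  refine Finset.prod_congr rfl fun j _ => ?_
  rw [rescale, Pi.sub_apply, div_pow]
  field_simp

theorem taylorCoeff_zeroIdx (D : (Fin d → ℕ) → (Fin d → ℝ) → ℝ) (m b : ℕ) (x₀ : Fin d → ℝ)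
    (h : ℝ) : taylorCoeff D m b x₀ h (zeroIdx d b) = D 0 x₀ := by
  simp [taylorCoeff, zeroIdx, zero_mem_multiIdx]

theorem sum_abs_taylorCoeff_le (D : (Fin d → ℕ) → (Fin d → ℝ) → ℝ) {m : ℕ} (hmb : m ≤ b)
    (x₀ : Fin d → ℝ) {h : ℝ} (h0 : 0 ≤ h) (h1 : h ≤ 1) :
    ∑ p, |taylorCoeff D m b x₀ h p| ≤ ∑ p ∈ multiIdx d m, |D p x₀| := by
  simp only [taylorCoeff, apply_ite abs, abs_zero]
  rw [sum_multiIdx_ite hmb fun p => |D p x₀ * ∏ j, h ^ p j / (p j).factorial|]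
  refine Finset.sum_le_sum fun p _ => ?_
  have hprod : 0 ≤ ∏ j, h ^ p j / ((p j).factorial : ℝ) :=
    Finset.prod_nonneg fun j _ => by positivity
  rw [abs_mul, abs_of_nonneg hprod]
  refine mul_le_of_le_one_right (abs_nonneg _) (Finset.prod_le_one (fun j _ => by positivity) ?_)
  exact fun j _ => (div_le_self (by positivity)
    (by exact_mod_cast Nat.factorial_pos (p j))).trans (pow_le_one₀ h0 h1)

theorem exists_isHolderJet_of_mem_holderClass {β L M : ℝ} (hM : 0 ≤ M) {f : (Fin d → ℝ) → ℝ}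
    (hf : f ∈ holderClass d β L M) :
    ∃ D, (∀ x ∈ cube d, D 0 x = f x) ∧ IsHolderJet (strictFloor β) (β - strictFloor β) L D ∧
      ∀ x ∈ cube d, ∑ p ∈ multiIdx d (strictFloor β), |D p x| ≤ M := by
  obtain ⟨D, hD0, hderiv, hholder, hsum⟩ := hf
  refine ⟨D, hD0, ⟨hderiv, hholder⟩, fun x hx => ?_⟩
  rw [← ENNReal.ofReal_le_ofReal_iff hM, ENNReal.ofReal_sum_of_nonneg fun _ _ => abs_nonneg _]
  exact (Finset.sum_le_sum fun p _ =>
    le_iSup₂ (f := fun x (_ : x ∈ cube d) => ENNReal.ofReal |D p x|) x hx).trans hsum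

theorem IsHolderJet.abs_sub_taylorPoly_zero_le {β L : ℝ} (hβ : 0 < β) (hL : 0 ≤ L)
    {D : (Fin d → ℕ) → (Fin d → ℝ) → ℝ} (hD : IsHolderJet (strictFloor β) (β - strictFloor β) L D)
    {x y : Fin d → ℝ} (hx : x ∈ cube d) (hy : y ∈ cube d) :
    |D 0 y - taylorPoly D (strictFloor β) 0 x y| ≤ L * (∑ j, |y j - x j|) ^ β := by
  simpa using hD.abs_sub_taylorPoly_le hL (sub_nonneg.2 (strictFloor_lt hβ).le) hx
    (strictFloor β) 0 (by simp) hy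

theorem continuousOn_of_mem_holderClass {β L M : ℝ} (hβ : 0 < β) (hL : 0 ≤ L) (hM : 0 ≤ M)
    {f : (Fin d → ℝ) → ℝ} (hf : f ∈ holderClass d β L M) : ContinuousOn f (cube d) := by
  obtain ⟨D, hD0, hD, -⟩ := exists_isHolderJet_of_mem_holderClass hM hf
  intro x hx
  have hT : Tendsto (taylorPoly D (strictFloor β) 0 x) (nhdsWithin x (cube d)) (nhds (f x)) := by
    rw [← hD0 x hx, ← taylorPoly_self D (strictFloor β) 0 x]
    exact (continuous_taylorPoly D _ 0 x).continuousWithinAt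
  have hmodulus : Tendsto (fun y : Fin d → ℝ => L * (∑ j, |y j - x j|) ^ β)
      (nhdsWithin x (cube d)) (nhds 0) := by
    have hcont : Continuous fun y : Fin d → ℝ => L * (∑ j, |y j - x j|) ^ β :=
      continuous_const.mul (Continuous.rpow_const (by fun_prop) fun _ => Or.inr hβ.le)
    simpa [ContinuousWithinAt, Real.zero_rpow hβ.ne'] using hcont.continuousWithinAt (x := x)
  have hrem : Tendsto (fun y => f y - taylorPoly D (strictFloor β) 0 x y)
      (nhdsWithin x (cube d)) (nhds 0) := by
    refine squeeze_zero_norm' ?_ hmodulus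
    filter_upwards [self_mem_nhdsWithin] with y hy
    rw [← hD0 y hy]
    exact hD.abs_sub_taylorPoly_zero_le hβ hL hx hy
  have hsum := hrem.add hT
  simp only [sub_add_cancel, zero_add] at hsum
  exact hsum

theorem exists_paramSet_approx {β L M : ℝ} (hβ : 0 < β) (hβb : β ≤ b) (hL : 0 ≤ L) (hM : 0 ≤ M)
    {f : (Fin d → ℝ) → ℝ} (hf : f ∈ holderClass d β L M) {x₀ : Fin d → ℝ} (hx₀ : x₀ ∈ cube d)
    {h : ℝ} (h0 : 0 < h) (h1 : h ≤ 1) :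
    ∃ t ∈ paramSet d b M, t (zeroIdx d b) = f x₀ ∧ ∀ x ∈ cube d,
      |f x - polyVal t (rescale x₀ h x)| ≤ L * (∑ j, |x j - x₀ j|) ^ β := by
  obtain ⟨D, hD0, hD, hsum⟩ := exists_isHolderJet_of_mem_holderClass hM hf
  have hmb : strictFloor β ≤ b := by exact_mod_cast ((strictFloor_lt hβ).trans_le hβb).le
  refine ⟨taylorCoeff D (strictFloor β) b x₀ h,
    (sum_abs_taylorCoeff_le D hmb x₀ h0.le h1).trans (hsum x₀ hx₀), ?_, fun x hx => ?_⟩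
  · rw [taylorCoeff_zeroIdx, hD0 x₀ hx₀]
  · rw [polyVal_taylorCoeff_rescale D hmb x₀ x h0.ne', ← hD0 x hx]
    exact hD.abs_sub_taylorPoly_zero_le hβ hL hx₀ hx

end Holder

/-! ### Polynomials and the kernel matrix -/

section Polynomial

variable {d b : ℕ}

theorem finite_setOf_eval_cons_eq_zero {P : MvPolynomial (Fin (d + 1)) ℝ} {s : Fin d → ℝ} {i : ℕ}
    (hs : MvPolynomial.eval s ((MvPolynomial.finSuccEquiv ℝ d P).coeff i) ≠ 0) :
    {y : ℝ | MvPolynomial.eval (Fin.cons y s : Fin (d + 1) → ℝ) P = 0}.Finite := by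
  set Q := (MvPolynomial.finSuccEquiv ℝ d P).map (MvPolynomial.eval s)
  have hQ : Q ≠ 0 := fun h => hs (by simpa [Q] using congrArg (Polynomial.coeff · i) h)
  refine Q.roots.toFinset.finite_toSet.subset fun y hy => ?_
  have hroot : Q.eval y = 0 := by rw [← MvPolynomial.eval_eq_eval_mv_eval']; exact hy
  simpa [hQ] using hroot

theorem ae_eval_ne_zero {P : MvPolynomial (Fin d) ℝ} (hP : P ≠ 0) :
    ∀ᵐ x : Fin d → ℝ, MvPolynomial.eval x P ≠ 0 := by
  induction d with
  | zero =>
    rw [MvPolynomial.eq_C_of_isEmpty P] at hP ⊢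
    exact Eventually.of_forall fun x => by simpa using hP
  | succ d ih =>
    obtain ⟨i, hi⟩ : ∃ i, (MvPolynomial.finSuccEquiv ℝ d P).coeff i ≠ 0 := by
      by_contra! h
      exact hP ((map_eq_zero_iff _ (MvPolynomial.finSuccEquiv ℝ d).injective).1
        (Polynomial.ext fun i => by simp [h i]))
    have hmp := (volume_preserving_piFinSuccAbove (fun _ : Fin (d + 1) => ℝ) 0).symm
    have hcons : ∀ z : ℝ × (Fin d → ℝ), (MeasurableEquiv.piFinSuccAbove
        (fun _ : Fin (d + 1) => ℝ) 0).symm z = (Fin.cons z.1 z.2 : Fin (d + 1) → ℝ) := fun z => by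
      simp [MeasurableEquiv.piFinSuccAbove, Fin.insertNthEquiv]
    have hmeas : MeasurableSet {x : Fin (d + 1) → ℝ | MvPolynomial.eval x P ≠ 0} :=
      ((measurableSet_singleton 0).preimage (MvPolynomial.continuous_eval P).measurable).compl
    have hmeas' := hmp.measurable hmeas
    simp only [Set.preimage_ofPred_eq, hcons] at hmeas'
    rw [← hmp.map_eq, ae_map_iff hmp.measurable.aemeasurable hmeas]
    simp only [hcons]
    rw [Measure.volume_eq_prod, Measure.ae_prod_iff_ae_ae hmeas', Measure.ae_ae_comm hmeas']
    filter_upwards [ih hi] with s hs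
    exact compl_mem_ae_iff.2 ((finite_setOf_eval_cons_eq_zero hs).measure_zero _)

theorem continuous_monom (p : Fin d → ℕ) : Continuous (monom p) := by
  unfold monom
  fun_prop

theorem continuous_polyVal (w : multiIdx d b → ℝ) : Continuous (polyVal w) :=
  continuous_finsetSum _ fun p _ => continuous_const.mul (continuous_monom p.1)

theorem abs_monom_le_one (p : Fin d → ℕ) {z : Fin d → ℝ} (hz : z ∈ kernelBox d) :
    |monom p z| ≤ 1 := by
  rw [monom, Finset.abs_prod]
  refine Finset.prod_le_one (fun _ _ => abs_nonneg _) fun j _ => ?_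
  rw [abs_pow]
  exact pow_le_one₀ (abs_nonneg _) (abs_le.2 ⟨by linarith [hz.1 j], by linarith [hz.2 j]⟩)

theorem abs_polyVal_le (w : multiIdx d b → ℝ) {z : Fin d → ℝ} (hz : z ∈ kernelBox d) :
    |polyVal w z| ≤ ∑ p, |w p| := by
  refine (Finset.abs_sum_le_sum_abs _ _).trans (Finset.sum_le_sum fun p _ => ?_)
  rw [abs_mul]
  exact mul_le_of_le_one_right (abs_nonneg _) (abs_monom_le_one _ hz)

/-- The polynomial with coefficients `w`, as an `MvPolynomial`. -/
def toMvPolynomial (w : multiIdx d b → ℝ) : MvPolynomial (Fin d) ℝ :=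
  ∑ p, MvPolynomial.monomial (Finsupp.equivFunOnFinite.symm p.1) (w p)

theorem eval_toMvPolynomial (w : multiIdx d b → ℝ) (z : Fin d → ℝ) :
    MvPolynomial.eval z (toMvPolynomial w) = polyVal w z := by
  rw [toMvPolynomial, map_sum]
  refine Finset.sum_congr rfl fun p _ => ?_
  rw [MvPolynomial.eval_monomial, monom, Finsupp.prod_fintype _ _ (by simp)]
  rfl

theorem coeff_toMvPolynomial (w : multiIdx d b → ℝ) (p : multiIdx d b) :
    (toMvPolynomial w).coeff (Finsupp.equivFunOnFinite.symm p.1) = w p := by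
  simp [toMvPolynomial, MvPolynomial.coeff_sum, MvPolynomial.coeff_monomial]

theorem ae_polyVal_ne_zero {w : multiIdx d b → ℝ} (hw : w ≠ 0) :
    ∀ᵐ z : Fin d → ℝ, polyVal w z ≠ 0 := by
  have hP : toMvPolynomial w ≠ 0 := by
    obtain ⟨p, hp⟩ := Function.ne_iff.1 hw
    intro h
    exact hp (by rw [← coeff_toMvPolynomial w p, h, MvPolynomial.coeff_zero, Pi.zero_apply])
  simpa only [eval_toMvPolynomial] using ae_eval_ne_zero hP

theorem two_le_card_multiIdx (hd : 0 < d) (hb : 0 < b) : 2 ≤ (multiIdx d b).card := by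
  have hsub : ({0, Pi.single ⟨0, hd⟩ 1} : Finset (Fin d → ℕ)) ⊆ multiIdx d b := by
    simp [Finset.insert_subset_iff, mem_multiIdx, Nat.one_le_iff_ne_zero, hb.ne']
  rw [← Finset.card_pair (a := (0 : Fin d → ℕ)) (b := Pi.single ⟨0, hd⟩ 1)
    fun h => by simpa using congrFun h ⟨0, hd⟩]
  exact Finset.card_le_card hsub

end Polynomial

section Kernel

variable {d : ℕ} {K : (Fin d → ℝ) → ℝ}

theorem IsKernel.integrable (hK : IsKernel K) : Integrable K :=
  .of_integral_ne_zero (by rw [hK.integral_eq_one]; exact one_ne_zero)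

theorem IsKernel.eq_zero_of_notMem (hK : IsKernel K) {z : Fin d → ℝ} (hz : z ∉ kernelBox d) :
    K z = 0 := not_not.1 (mt (hK.support z) hz)

theorem IsKernel.le_supNorm (hK : IsKernel K) (z : Fin d → ℝ) : K z ≤ supNorm K :=
  (le_abs_self _).trans (le_ciSup hK.bounded z)

theorem IsKernel.integrable_mul (hK : IsKernel K) {F : (Fin d → ℝ) → ℝ} (hF : Measurable F)
    {A : ℝ} (hA : ∀ z, K z ≠ 0 → |F z| ≤ A) : Integrable fun z => F z * K z := by
  refine (hK.integrable.const_mul A).mono' (hF.mul hK.measurable).aestronglyMeasurable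
    (Eventually.of_forall fun z => ?_)
  by_cases h : K z = 0
  · simp [h]
  · rw [Real.norm_eq_abs, abs_mul, abs_of_nonneg (hK.nonneg z)]
    exact mul_le_mul_of_nonneg_right (hA z h) (hK.nonneg z)

theorem IsKernel.supNorm_nonneg (hK : IsKernel K) : 0 ≤ supNorm K :=
  (hK.nonneg 0).trans (hK.le_supNorm 0)

theorem volume_kernelBox (d : ℕ) : volume (kernelBox d) = 1 := by
  rw [kernelBox, Real.volume_Icc_pi]
  norm_num

theorem IsKernel.one_le_supNorm (hK : IsKernel K) : 1 ≤ supNorm K :=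
  calc (1 : ℝ) = ∫ z in kernelBox d, K z := by
        rw [setIntegral_eq_integral_of_forall_compl_eq_zero fun z => hK.eq_zero_of_notMem,
          hK.integral_eq_one]
    _ ≤ ∫ _ in kernelBox d, supNorm K := setIntegral_mono hK.integrable.integrableOn
        (integrableOn_const (by simp [volume_kernelBox])) hK.le_supNorm
    _ = supNorm K := by simp [Measure.real, volume_kernelBox]

theorem IsKernel.integrable_monom_mul_monom_mul (hK : IsKernel K) (p q : Fin d → ℕ) :
    Integrable fun z => monom p z * monom q z * K z :=
  hK.integrable_mul ((continuous_monom p).mul (continuous_monom q)).measurable (A := 1)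
    fun z hz => by
      rw [abs_mul]
      exact mul_le_one₀ (abs_monom_le_one _ (hK.support z hz)) (abs_nonneg _)
        (abs_monom_le_one _ (hK.support z hz))

theorem IsKernel.kernelMatrix_apply (hK : IsKernel K) (b : ℕ) (p q : multiIdx d b) :
    kernelMatrix b K p q = ∫ z, monom p.1 z * monom q.1 z * K z :=
  setIntegral_eq_integral_of_forall_compl_eq_zero fun z hz => by
    rw [hK.eq_zero_of_notMem hz, mul_zero]

theorem IsKernel.dotProduct_kernelMatrix_mulVec (hK : IsKernel K) (b : ℕ)
    (w : multiIdx d b → ℝ) :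
    w ⬝ᵥ (kernelMatrix b K).mulVec w = ∫ z, polyVal w z ^ 2 * K z := by
  have hexpand : ∀ z, polyVal w z ^ 2 * K z =
      ∑ p : multiIdx d b, ∑ q : multiIdx d b, w p * w q * (monom p.1 z * monom q.1 z * K z) := by
    intro z
    rw [sq, polyVal, Finset.sum_mul_sum]
    simp_rw [Finset.sum_mul]
    exact Finset.sum_congr rfl fun p _ => Finset.sum_congr rfl fun q _ => by ring
  have hint : ∀ p q : multiIdx d b,
      Integrable fun z => w p * w q * (monom p.1 z * monom q.1 z * K z) :=
    fun p q => (hK.integrable_monom_mul_monom_mul p.1 q.1).const_mul _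
  simp_rw [hexpand, dotProduct, Matrix.mulVec, dotProduct]
  rw [integral_finsetSum _ fun p _ => integrable_finsetSum _ fun q _ => hint p q]
  refine Finset.sum_congr rfl fun p _ => ?_
  rw [integral_finsetSum _ fun q _ => hint p q, Finset.mul_sum]
  refine Finset.sum_congr rfl fun q _ => ?_
  rw [integral_const_mul, hK.kernelMatrix_apply]
  ring

theorem kernelMatrix_isHermitian (b : ℕ) (K : (Fin d → ℝ) → ℝ) :
    (kernelMatrix b K).IsHermitian :=
  Matrix.IsHermitian.ext fun p q => by
    simp only [kernelMatrix, Matrix.of_apply, star_trivial, mul_comm (monom p.1 _)]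

theorem IsKernel.integrable_sq_polyVal_mul (hK : IsKernel K) {b : ℕ} (w : multiIdx d b → ℝ) :
    Integrable fun z => polyVal w z ^ 2 * K z :=
  hK.integrable_mul ((continuous_polyVal w).pow 2).measurable (A := (∑ p, |w p|) ^ 2)
    fun z hz => by
      rw [abs_pow]
      exact pow_le_pow_left₀ (abs_nonneg _) (abs_polyVal_le w (hK.support z hz)) 2

theorem IsKernel.kernelMatrix_posDef (hK : IsKernel K) (b : ℕ) : (kernelMatrix b K).PosDef := by
  rw [Matrix.posDef_iff_dotProduct_mulVec]
  refine ⟨kernelMatrix_isHermitian b K, fun w hw => ?_⟩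
  rw [star_trivial, hK.dotProduct_kernelMatrix_mulVec]
  have hnonneg : ∀ z, 0 ≤ polyVal w z ^ 2 * K z := fun z => mul_nonneg (sq_nonneg _) (hK.nonneg z)
  refine (integral_nonneg hnonneg).lt_of_ne fun h0 => ?_
  have hae := (integral_eq_zero_iff_of_nonneg hnonneg (hK.integrable_sq_polyVal_mul w)).1 h0.symm
  have hK0 : K =ᵐ[volume] 0 := by
    filter_upwards [hae, ae_polyVal_ne_zero hw] with z hz hwz
    simpa [hwz] using hz
  exact zero_ne_one (by rw [← hK.integral_eq_one, integral_congr_ae hK0]; simp)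

theorem IsKernel.minEigenvalue_pos (hK : IsKernel K) (b : ℕ) : 0 < minEigenvalue b K := by
  have hpos := hK.kernelMatrix_posDef b
  have : Nonempty (multiIdx d b) := ⟨zeroIdx d b⟩
  rw [minEigenvalue, hpos.isHermitian.spectrum_real_eq_range_eigenvalues]
  obtain ⟨i, hi⟩ := (Set.range_nonempty hpos.isHermitian.eigenvalues).csInf_mem
    (Set.finite_range _)
  rw [← hi]
  exact hpos.eigenvalues_pos i

theorem posSemidef_sub_sInf_spectrum {ι : Type*} [Fintype ι] [DecidableEq ι]
    {A : Matrix ι ι ℝ} (hA : A.IsHermitian) :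
    (A - algebraMap ℝ (Matrix ι ι ℝ) (sInf (spectrum ℝ A))).PosSemidef := by
  rw [Matrix.posSemidef_iff_isHermitian_and_spectrum_nonneg]
  refine ⟨hA.sub ?_, ?_⟩
  · rw [Matrix.algebraMap_eq_diagonal]
    exact Matrix.isHermitian_diagonal _
  · rw [← spectrum.sub_singleton_eq]
    rintro _ ⟨x, hx, y, rfl, rfl⟩
    refine sub_nonneg.2 (csInf_le ?_ hx)
    rw [hA.spectrum_real_eq_range_eigenvalues]
    exact (Set.finite_range _).bddBelow

theorem IsKernel.minEigenvalue_mul_le (hK : IsKernel K) (b : ℕ) (w : multiIdx d b → ℝ) :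
    minEigenvalue b K * ∑ p, w p ^ 2 ≤ ∫ z, polyVal w z ^ 2 * K z := by
  have h := (posSemidef_sub_sInf_spectrum (kernelMatrix_isHermitian b K)).dotProduct_mulVec_nonneg w
  rw [Matrix.sub_mulVec, dotProduct_sub, star_trivial, hK.dotProduct_kernelMatrix_mulVec,
    Algebra.algebraMap_eq_smul_one, Matrix.smul_mulVec, Matrix.one_mulVec, dotProduct_smul,
    sub_nonneg] at h
  simpa only [minEigenvalue, dotProduct, smul_eq_mul, sq] using h

end Kernel

/-! ### Sums of independent bounded variables -/

section Exponential

variable {n : ℕ} {E : Type*} [MeasurableSpace E]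

theorem integrable_exp_mul_sum {μ : Fin n → Measure E} [∀ i, IsProbabilityMeasure (μ i)]
    {Y : Fin n → E → ℝ} (hY : ∀ i, Measurable (Y i)) {s : ℝ} (hsY : ∀ i e, |s * Y i e| ≤ 1) :
    Integrable (fun ω : Fin n → E => Real.exp (s * ∑ i, Y i (ω i))) (Measure.pi μ) := by
  have hmeas : Measurable fun ω : Fin n → E => Real.exp (s * ∑ i, Y i (ω i)) := by fun_prop
  refine .of_bound hmeas.aestronglyMeasurable (Real.exp n) (Eventually.of_forall fun ω => ?_)
  rw [Real.norm_eq_abs, Real.abs_exp, Real.exp_le_exp, Finset.mul_sum]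
  calc ∑ i, s * Y i (ω i) ≤ ∑ _i : Fin n, (1 : ℝ) :=
        Finset.sum_le_sum fun i _ => (le_abs_self _).trans (hsY i _)
    _ = n := by simp

theorem integral_exp_mul_le {μ : Measure E} [IsProbabilityMeasure μ] {Y : E → ℝ}
    (hY : Measurable Y) {B m v s : ℝ} (hB : ∀ e, |Y e| ≤ B) (hm : ∫ e, Y e ∂μ ≤ m)
    (hv : ∫ e, Y e ^ 2 ∂μ ≤ v) (hs : 0 ≤ s) (hsY : ∀ e, |s * Y e| ≤ 1) :
    ∫ e, Real.exp (s * Y e) ∂μ ≤ Real.exp (s * m + s ^ 2 * v) := by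
  have hYint : Integrable Y μ := .of_bound hY.aestronglyMeasurable B (Eventually.of_forall hB)
  have hYint2 : Integrable (fun e => Y e ^ 2) μ :=
    .of_bound (hY.pow_const 2).aestronglyMeasurable (B ^ 2) (Eventually.of_forall fun e => by
      rw [Real.norm_eq_abs, abs_pow]
      exact pow_le_pow_left₀ (abs_nonneg _) (hB e) 2)
  have hlin : Integrable (fun e => 1 + s * Y e) μ := (integrable_const 1).add (hYint.const_mul s)
  calc ∫ e, Real.exp (s * Y e) ∂μ
      ≤ ∫ e, (1 + s * Y e + s ^ 2 * Y e ^ 2) ∂μ := by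
        refine integral_mono_of_nonneg (Eventually.of_forall fun _ => (Real.exp_pos _).le)
          (hlin.add (hYint2.const_mul (s ^ 2))) (Eventually.of_forall fun e => ?_)
        have h := (abs_le.1 (Real.abs_exp_sub_one_sub_id_le (hsY e))).2
        rw [mul_pow] at h
        simp only
        linarith
    _ = 1 + s * ∫ e, Y e ∂μ + s ^ 2 * ∫ e, Y e ^ 2 ∂μ := by
        rw [integral_add hlin (hYint2.const_mul _), integral_add (integrable_const 1)
          (hYint.const_mul s), integral_const_mul, integral_const_mul]
        simp
    _ ≤ s * m + s ^ 2 * v + 1 := by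
        linarith [mul_le_mul_of_nonneg_left hm hs, mul_le_mul_of_nonneg_left hv (sq_nonneg s)]
    _ ≤ _ := Real.add_one_le_exp _

theorem integral_exp_mul_sum_le {μ : Fin n → Measure E} [∀ i, IsProbabilityMeasure (μ i)]
    {Y : Fin n → E → ℝ} (hY : ∀ i, Measurable (Y i)) {B m v s : ℝ} (hB : ∀ i e, |Y i e| ≤ B)
    (hm : ∀ i, ∫ e, Y i e ∂(μ i) ≤ m) (hv : ∀ i, ∫ e, Y i e ^ 2 ∂(μ i) ≤ v) (hs : 0 ≤ s)
    (hsY : ∀ i e, |s * Y i e| ≤ 1) :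
    ∫ ω, Real.exp (s * ∑ i, Y i (ω i)) ∂(Measure.pi μ) ≤ Real.exp (n * (s * m + s ^ 2 * v)) := by
  simp_rw [Finset.mul_sum, Real.exp_sum]
  rw [integral_fintype_prod_eq_prod (fun i e => Real.exp (s * Y i e))]
  calc ∏ i, ∫ e, Real.exp (s * Y i e) ∂(μ i)
      ≤ ∏ _i : Fin n, Real.exp (s * m + s ^ 2 * v) :=
        Finset.prod_le_prod (fun i _ => integral_nonneg fun _ => (Real.exp_pos _).le)
          fun i _ => integral_exp_mul_le (hY i) (hB i) (hm i) (hv i) hs (hsY i)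
    _ = _ := by simp [← Real.exp_nat_mul]

theorem lintegral_exp_mul_sum_le {μ : Fin n → Measure E} [∀ i, IsProbabilityMeasure (μ i)]
    {Y : Fin n → E → ℝ} (hY : ∀ i, Measurable (Y i)) {B m v s : ℝ} (hB : ∀ i e, |Y i e| ≤ B)
    (hm : ∀ i, ∫ e, Y i e ∂(μ i) ≤ m) (hv : ∀ i, ∫ e, Y i e ^ 2 ∂(μ i) ≤ v) (hs : 0 ≤ s)
    (hsB : s * B ≤ 1) :
    ∫⁻ ω, ENNReal.ofReal (Real.exp (s * ∑ i, Y i (ω i))) ∂(Measure.pi μ)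
      ≤ ENNReal.ofReal (Real.exp (n * (s * m + s ^ 2 * v))) := by
  have hsY : ∀ i e, |s * Y i e| ≤ 1 := fun i e => by
    rw [abs_mul, abs_of_nonneg hs]
    exact (mul_le_mul_of_nonneg_left (hB i e) hs).trans hsB
  rw [← ofReal_integral_eq_lintegral_ofReal (integrable_exp_mul_sum hY hsY)
    (Eventually.of_forall fun _ => (Real.exp_pos _).le)]
  exact ENNReal.ofReal_le_ofReal (integral_exp_mul_sum_le hY hB hm hv hs hsY)

theorem measure_le_of_lintegral_exp_le {μ : Measure E} {W : E → ℝ} (hW : Measurable W) {B : ℝ}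
    (hB : ∫⁻ ω, ENNReal.ofReal (Real.exp (W ω)) ∂μ ≤ ENNReal.ofReal B) (x : ℝ) :
    μ {ω | x ≤ W ω} ≤ ENNReal.ofReal (B * Real.exp (-x)) := by
  have hx : 0 < Real.exp x := Real.exp_pos x
  calc μ {ω | x ≤ W ω}
      = μ {ω | ENNReal.ofReal (Real.exp x) ≤ ENNReal.ofReal (Real.exp (W ω))} := by
        simp only [ENNReal.ofReal_le_ofReal_iff (Real.exp_pos _).le, Real.exp_le_exp]
    _ ≤ (∫⁻ ω, ENNReal.ofReal (Real.exp (W ω)) ∂μ) / ENNReal.ofReal (Real.exp x) :=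
        meas_ge_le_lintegral_div hW.exp.ennreal_ofReal.aemeasurable
          (ENNReal.ofReal_pos.2 hx).ne' ENNReal.ofReal_ne_top
    _ ≤ ENNReal.ofReal B / ENNReal.ofReal (Real.exp x) := by gcongr
    _ = ENNReal.ofReal (B * Real.exp (-x)) := by
        rw [Real.exp_neg, ← div_eq_mul_inv, ENNReal.ofReal_div_of_pos hx]

end Exponential

/-! ### The smoothed score -/

section Score

variable {ρ γ : ℝ → ℝ} {g : ℕ → ℝ → ℝ}

/-- `γ` is a symmetric probability density on the line: a noise density without the monotonicity
condition of `IsNoiseDensity`. -/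
structure IsSymmDensity (γ : ℝ → ℝ) : Prop where
  measurable : Measurable γ
  nonneg : ∀ z, 0 ≤ γ z
  integral_eq_one : ∫ z, γ z = 1
  symm : ∀ z, γ (-z) = γ z

theorem IsNoiseDensity.isSymmDensity (hγ : IsNoiseDensity γ) : IsSymmDensity γ :=
  ⟨hγ.measurable, hγ.nonneg, hγ.integral_eq_one, hγ.symm⟩

theorem IsSymmDensity.integrable (hγ : IsSymmDensity γ) : Integrable γ :=
  .of_integral_ne_zero (by rw [hγ.integral_eq_one]; exact one_ne_zero)

theorem IsContrast.abs_deriv_le (hρ : IsContrast ρ g) (z : ℝ) : |deriv ρ z| ≤ supNorm (deriv ρ) :=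
  le_ciSup hρ.bounded z

theorem IsContrast.abs_deriv_sub_le (hρ : IsContrast ρ g) (y z : ℝ) :
    |deriv ρ y - deriv ρ z| ≤ |y - z| := by
  simpa [Real.dist_eq] using hρ.lipschitz.dist_le_mul y z

theorem IsContrast.deriv_neg (hρ : IsContrast ρ g) (z : ℝ) : deriv ρ (-z) = -deriv ρ z := by
  have h := deriv_comp_neg ρ z
  rwa [funext hρ.symm, eq_comm, neg_eq_iff_eq_neg] at h

theorem IsContrast.add_deriv_mul_le (hρ : IsContrast ρ g) (y z : ℝ) :
    ρ y + deriv ρ y * (z - y) ≤ ρ z := by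
  rcases lt_trichotomy y z with h | rfl | h
  · have hslope := hρ.convex.deriv_le_slope (Set.mem_univ y) (Set.mem_univ z) h
      (hρ.differentiable y)
    rw [slope_def_field, le_div_iff₀ (by linarith)] at hslope
    linarith
  · simp
  · have hslope := hρ.convex.slope_le_deriv (Set.mem_univ z) (Set.mem_univ y) h
      (hρ.differentiable y)
    rw [slope_def_field, div_le_iff₀ (by linarith)] at hslope
    linarith

theorem IsContrast.abs_deriv_deriv_le (hρ : IsContrast ρ g) (z : ℝ) : |deriv (deriv ρ) z| ≤ 1 := by
  simpa using norm_deriv_le_of_lipschitz hρ.lipschitz (x₀ := z)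

/-- The smoothed score `u ↦ ∫ ρ'(z + u) γ(z) dz`, the mean of `ρ'` of a noise with density `γ`
shifted by `u`. -/
def smoothScore (ρ γ : ℝ → ℝ) (u : ℝ) : ℝ := ∫ z, deriv ρ (z + u) * γ z

theorem IsContrast.integrable_score (hρ : IsContrast ρ g) (hγ : IsSymmDensity γ) (u : ℝ) :
    Integrable fun z => deriv ρ (z + u) * γ z :=
  hγ.integrable.bdd_mul
    ((measurable_deriv ρ).comp (measurable_id.add_const u)).aestronglyMeasurable
    (Eventually.of_forall fun z => hρ.abs_deriv_le (z + u))

theorem IsContrast.integrable_deriv_score (hρ : IsContrast ρ g) (hγ : IsSymmDensity γ) (u : ℝ) :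
    Integrable fun z => deriv (deriv ρ) (z + u) * γ z :=
  hγ.integrable.bdd_mul
    ((measurable_deriv (deriv ρ)).comp (measurable_id.add_const u)).aestronglyMeasurable
    (Eventually.of_forall fun z => hρ.abs_deriv_deriv_le (z + u))

theorem IsContrast.hasDerivAt_smoothScore (hρ : IsContrast ρ g) (hγ : IsSymmDensity γ) (u : ℝ) :
    HasDerivAt (smoothScore ρ γ) (∫ z, deriv (deriv ρ) (z + u) * γ z) u := by
  refine (hasDerivAt_integral_of_dominated_loc_of_lip (bound := γ) (s := Set.univ)
    (F := fun u z => deriv ρ (z + u) * γ z) univ_mem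
    (Eventually.of_forall fun v => (hρ.integrable_score hγ v).aestronglyMeasurable)
    (hρ.integrable_score hγ u) (hρ.integrable_deriv_score hγ u).aestronglyMeasurable
    (Eventually.of_forall fun z => ?_) hγ.integrable ?_).2
  · refine LipschitzOnWith.of_dist_le_mul fun v _ w _ => ?_
    rw [Real.dist_eq, Real.dist_eq, ← sub_mul, abs_mul, mul_comm, Real.coe_nnabs]
    refine mul_le_mul_of_nonneg_left ?_ (abs_nonneg _)
    simpa only [add_sub_add_left_eq_sub] using hρ.abs_deriv_sub_le (z + v) (z + w)
  · filter_upwards [(measurePreserving_add_right volume u).quasiMeasurePreserving.ae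
      hρ.ae_differentiable] with z hz
    simpa using (hz.hasDerivAt.comp u ((hasDerivAt_id u).const_add z)).mul_const (γ z)

theorem IsContrast.smoothScore_zero (hρ : IsContrast ρ g) (hγ : IsSymmDensity γ) :
    smoothScore ρ γ 0 = 0 := by
  refine self_eq_neg.1 ?_
  calc smoothScore ρ γ 0 = ∫ z, deriv ρ (-z + 0) * γ (-z) :=
        (integral_neg_eq_self (fun z => deriv ρ (z + 0) * γ z) volume).symm
    _ = -smoothScore ρ γ 0 := by
        simp_rw [smoothScore, ← integral_neg, add_zero, hρ.deriv_neg, hγ.symm, neg_mul]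

theorem IsContrast.abs_smoothScore_le (hρ : IsContrast ρ g) (hγ : IsSymmDensity γ) (u : ℝ) :
    |smoothScore ρ γ u| ≤ |u| := by
  have hlip := Convex.norm_image_sub_le_of_norm_hasDerivWithin_le (C := 1)
    (fun v _ => (hρ.hasDerivAt_smoothScore hγ v).hasDerivWithinAt)
    (fun v _ => ?_) convex_univ (Set.mem_univ 0) (Set.mem_univ u)
  · simpa [hρ.smoothScore_zero hγ] using hlip
  · rw [← hγ.integral_eq_one]
    refine norm_integral_le_of_norm_le hγ.integrable (Eventually.of_forall fun z => ?_)
    rw [Real.norm_eq_abs, abs_mul, abs_of_nonneg (hγ.nonneg z)]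
    exact mul_le_of_le_one_left (hγ.nonneg z) (hρ.abs_deriv_deriv_le _)

theorem IsContrast.integral_deriv_score_sub_le (hρ : IsContrast ρ g) (hγ : IsSymmDensity γ)
    (u v : ℝ) :
    (∫ z, deriv (deriv ρ) (z + u) * γ z) - ∫ z, deriv (deriv ρ) (z + v) * γ z ≤
      ∫ z, |deriv (deriv ρ) (z + u) - deriv (deriv ρ) (z + v)| * γ z := by
  rw [← integral_sub (hρ.integrable_deriv_score hγ u) (hρ.integrable_deriv_score hγ v)]
  refine (le_abs_self _).trans (abs_integral_le_integral_abs.trans_eq ?_)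
  refine integral_congr_ae (Eventually.of_forall fun z => ?_)
  simp only [← sub_mul, abs_mul, abs_of_nonneg (hγ.nonneg z)]

theorem IsContrast.exists_le_integral_deriv_score (hρ : IsContrast ρ g) {c : ℝ} (hc : 0 < c)
    (hg : ∀ i, IsSymmDensity (g i)) (hcurv : ∀ i, c ≤ ∫ z, deriv (deriv ρ) z * g i z) :
    ∃ η > 0, ∀ i, ∀ v ∈ Set.Icc (-η) η, 3 / 4 * c ≤ ∫ z, deriv (deriv ρ) (z + v) * g i z := by
  obtain ⟨Lρ, hL, α, hα, hholder⟩ := hρ.holder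
  refine ⟨(c / (4 * Lρ)) ^ (1 / α), by positivity, fun i v hv => ?_⟩
  have hv' : |0 - v| ^ α ≤ c / (4 * Lρ) := by
    rw [zero_sub, abs_neg, ← Real.le_rpow_inv_iff_of_pos (abs_nonneg _) (by positivity) hα,
      ← one_div]
    exact abs_le.2 hv
  have hsub := (hρ.integral_deriv_score_sub_le (hg i) 0 v).trans (hholder i 0 v)
  have hquarter : Lρ * (c / (4 * Lρ)) = c / 4 := by field_simp
  simp only [add_zero] at hsub
  linarith [hcurv i, mul_le_mul_of_nonneg_left hv' hL.le]

theorem IsContrast.exists_smoothScore_strongly_monotone (hρ : IsContrast ρ g) {c : ℝ} (hc : 0 < c)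
    (hg : ∀ i, IsSymmDensity (g i)) (hcurv : ∀ i, c ≤ ∫ z, deriv (deriv ρ) z * g i z) :
    ∃ η > 0, ∀ i, ∀ u y : ℝ, |u| ≤ η → |y| ≤ η →
      3 / 4 * c * y ^ 2 ≤ (smoothScore ρ (g i) u - smoothScore ρ (g i) (u - y)) * y := by
  obtain ⟨η, hη, hderiv⟩ := hρ.exists_le_integral_deriv_score hc hg hcurv
  have hslope : ∀ i, ∀ v ∈ Set.Icc (-η) η, ∀ w ∈ Set.Icc (-η) η, v ≤ w →
      3 / 4 * c * (w - v) ≤ smoothScore ρ (g i) w - smoothScore ρ (g i) v := fun i =>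
    Convex.mul_sub_le_image_sub_of_le_deriv (convex_Icc _ _)
      (fun u _ => (hρ.hasDerivAt_smoothScore (hg i) u).continuousAt.continuousWithinAt)
      (fun u _ => (hρ.hasDerivAt_smoothScore (hg i) u).differentiableAt.differentiableWithinAt)
      fun u hu => (hderiv i u (interior_subset hu)).trans_eq
        (hρ.hasDerivAt_smoothScore (hg i) u).deriv.symm
  refine ⟨η / 2, by positivity, fun i u y hu hy => ?_⟩
  obtain ⟨hu₁, hu₂⟩ := abs_le.1 hu
  obtain ⟨hy₁, hy₂⟩ := abs_le.1 hy
  have hmem : u ∈ Set.Icc (-η) η := ⟨by linarith, by linarith⟩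
  have hmem' : u - y ∈ Set.Icc (-η) η := ⟨by linarith, by linarith⟩
  rcases le_total y 0 with h | h
  · nlinarith [hslope i u hmem (u - y) hmem' (by linarith)]
  · nlinarith [hslope i (u - y) hmem' u hmem (by linarith)]

end Score

/-! ### One observation -/

section Kernel

variable {d : ℕ} {K : (Fin d → ℝ) → ℝ} {x₀ : Fin d → ℝ} {h : ℝ}

/-- The kernel scaled by `h` and moved to `x₀` is supported in the unit cube. -/
def KernelFits (K : (Fin d → ℝ) → ℝ) (x₀ : Fin d → ℝ) (h : ℝ) : Prop :=
  ∀ x, K (rescale x₀ h x) ≠ 0 → x ∈ cube d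

theorem eventually_add_mul_nonneg {a : ℝ} (ha : 0 ≤ a) :
    ∀ᶠ h in nhdsWithin (0 : ℝ) (Set.Ioi 0), ∀ z : ℝ, -(1 / 2) ≤ z → (a = 0 → 0 ≤ z) →
      0 ≤ a + h * z := by
  rcases ha.eq_or_lt' with rfl | ha
  · filter_upwards [self_mem_nhdsWithin] with h hh z _ hz
    rw [zero_add]
    exact mul_nonneg (le_of_lt hh) (hz rfl)
  · filter_upwards [self_mem_nhdsWithin, nhdsWithin_le_nhds (Iic_mem_nhds ha)] with h hh hle z hz _
    have hh' : 0 < h := hh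
    have hle' : h ≤ a := hle
    nlinarith

theorem eventually_kernelFits (hK : IsKernel K) (hx₀ : x₀ ∈ cube d) (hin : KernelInward K x₀) :
    ∀ᶠ h in nhdsWithin (0 : ℝ) (Set.Ioi 0), KernelFits K x₀ h := by
  have hlow := eventually_all.2 fun j => eventually_add_mul_nonneg (hx₀.1 j)
  have hup := eventually_all.2 fun j => eventually_add_mul_nonneg (sub_nonneg.2 (hx₀.2 j))
  filter_upwards [self_mem_nhdsWithin, hlow, hup] with h (hh : 0 < h) hlow hup x hx
  have hbox := hK.support _ hx
  have hxj : ∀ j, x j = x₀ j + h * rescale x₀ h x j := fun j => by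
    rw [rescale, mul_div_cancel₀ _ hh.ne', add_sub_cancel]
  refine ⟨fun j => ?_, fun j => ?_⟩
  · rw [hxj]
    exact hlow j _ (hbox.1 j) (hin _ hx j).1
  · have hle := hup j _ (neg_le_neg (hbox.2 j)) fun h1 =>
      neg_nonneg.2 ((hin _ hx j).2 (sub_eq_zero.1 h1).symm)
    simp only [Pi.one_apply] at hle ⊢
    rw [hxj]
    linarith

theorem exists_kernelFits (hK : IsKernel K) (hx₀ : x₀ ∈ cube d) (hin : KernelInward K x₀) :
    ∃ h₁ > 0, ∀ h, 0 < h → h ≤ h₁ → KernelFits K x₀ h := by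
  obtain ⟨h₁, hh₁, hsub⟩ := mem_nhdsGT_iff_exists_Ioc_subset.1 (eventually_kernelFits hK hx₀ hin)
  exact ⟨h₁, hh₁, fun h h0 hle => hsub ⟨h0, hle⟩⟩

theorem measurable_rescale (x₀ : Fin d → ℝ) (h : ℝ) : Measurable (rescale x₀ h) := by
  unfold rescale
  fun_prop

theorem volume_cube (d : ℕ) : volume (cube d) = 1 := by
  rw [cube, Real.volume_Icc_pi]
  simp

theorem setIntegral_rescale (hh : 0 < h) (hfit : KernelFits K x₀ h) {G : (Fin d → ℝ) → ℝ}
    (hG : ∀ z, K z = 0 → G z = 0) :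
    ∫ x in cube d, G (rescale x₀ h x) = h ^ d * ∫ z, G z := by
  have hscale : ∀ x, G (rescale x₀ h x) = G (h⁻¹ • (x - x₀)) := fun x =>
    congrArg G (funext fun j => by simp [rescale, div_eq_inv_mul])
  rw [setIntegral_eq_integral_of_forall_compl_eq_zero fun x hx =>
    hG _ (not_not.1 (mt (hfit x) hx))]
  simp_rw [hscale]
  rw [integral_sub_right_eq_self (fun y => G (h⁻¹ • y)) x₀, Measure.integral_comp_smul,
    Module.finrank_fin_fun, smul_eq_mul, inv_pow, inv_inv, abs_of_pos (pow_pos hh d)]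

theorem integrableOn_kernel_rescale (hK : IsKernel K) :
    IntegrableOn (fun x => K (rescale x₀ h x)) (cube d) :=
  Measure.integrableOn_of_bounded (M := supNorm K) (by simp [volume_cube])
    (hK.measurable.comp (measurable_rescale x₀ h)).aestronglyMeasurable
    (Eventually.of_forall fun x => by
      rw [Real.norm_eq_abs, abs_of_nonneg (hK.nonneg _)]
      exact hK.le_supNorm _)

theorem setIntegral_kernel_rescale (hK : IsKernel K) (hh : 0 < h) (hfit : KernelFits K x₀ h) :
    ∫ x in cube d, K (rescale x₀ h x) = h ^ d := by
  rw [setIntegral_rescale hh hfit fun _ h => h, hK.integral_eq_one, mul_one]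

end Kernel

section ObservationLaw

variable {d : ℕ} {γ : ℝ → ℝ}

/-- The law of one pair `(X, ξ)` whose noise has density `γ`. -/
def obsLaw (d : ℕ) (γ : ℝ → ℝ) : Measure ((Fin d → ℝ) × ℝ) :=
  (volume.restrict (cube d)).prod (volume.withDensity fun z : ℝ => ENNReal.ofReal (γ z))

theorem modelLaw_eq_pi (d : ℕ) (g : ℕ → ℝ → ℝ) (n : ℕ) :
    modelLaw d g n = Measure.pi fun i : Fin n => obsLaw d (g i) := rfl

theorem isProbabilityMeasure_noise (hγ : IsSymmDensity γ) :
    IsProbabilityMeasure (volume.withDensity fun z : ℝ => ENNReal.ofReal (γ z)) :=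
  ⟨by rw [withDensity_apply _ MeasurableSet.univ, Measure.restrict_univ,
    ← ofReal_integral_eq_lintegral_ofReal hγ.integrable (Eventually.of_forall hγ.nonneg),
    hγ.integral_eq_one, ENNReal.ofReal_one]⟩

theorem isProbabilityMeasure_obsLaw (d : ℕ) (hγ : IsSymmDensity γ) :
    IsProbabilityMeasure (obsLaw d γ) := by
  have := isProbabilityMeasure_noise hγ
  have : IsProbabilityMeasure (volume.restrict (cube d)) := ⟨by simp [volume_cube]⟩
  unfold obsLaw
  infer_instance

theorem integral_noise (hγ : IsSymmDensity γ) (F : ℝ → ℝ) :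
    ∫ z, F z ∂(volume.withDensity fun z : ℝ => ENNReal.ofReal (γ z)) = ∫ z, F z * γ z := by
  rw [integral_withDensity_eq_integral_toReal_smul hγ.measurable.ennreal_ofReal (by simp)]
  refine integral_congr_ae (Eventually.of_forall fun z => ?_)
  simp only [ENNReal.toReal_ofReal (hγ.nonneg z), smul_eq_mul, mul_comm]

theorem integrable_obsLaw (hγ : IsSymmDensity γ) {F : (Fin d → ℝ) × ℝ → ℝ} (hF : Measurable F)
    {B : ℝ} (hB : ∀ e, |F e| ≤ B) : Integrable F (obsLaw d γ) :=
  have := isProbabilityMeasure_obsLaw d hγ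
  .of_bound hF.aestronglyMeasurable B (Eventually.of_forall hB)

theorem integral_obsLaw (hγ : IsSymmDensity γ) {F : (Fin d → ℝ) × ℝ → ℝ} (hF : Measurable F)
    {B : ℝ} (hB : ∀ e, |F e| ≤ B) :
    ∫ e, F e ∂(obsLaw d γ) = ∫ x in cube d, ∫ z, F (x, z) * γ z := by
  have := isProbabilityMeasure_noise hγ
  rw [obsLaw, integral_prod _ (integrable_obsLaw hγ hF hB)]
  simp_rw [integral_noise hγ]

theorem integrableOn_integral_noise (hγ : IsSymmDensity γ) {F : (Fin d → ℝ) × ℝ → ℝ}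
    (hF : Measurable F) {B : ℝ} (hB : ∀ e, |F e| ≤ B) :
    IntegrableOn (fun x => ∫ z, F (x, z) * γ z) (cube d) := by
  have := isProbabilityMeasure_noise hγ
  have h := (integrable_obsLaw hγ hF hB).integral_prod_left
  simp only [integral_noise hγ] at h
  exact h

variable {K : (Fin d → ℝ) → ℝ} {x₀ : Fin d → ℝ} {h : ℝ}

theorem integrable_obsLaw_kernel (hK : IsKernel K) (hγ : IsSymmDensity γ) :
    Integrable (fun e => K (rescale x₀ h e.1)) (obsLaw d γ) :=
  integrable_obsLaw hγ (hK.measurable.comp ((measurable_rescale x₀ h).comp measurable_fst))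
    (B := supNorm K) fun _ => (abs_of_nonneg (hK.nonneg _)).trans_le (hK.le_supNorm _)

theorem integral_obsLaw_kernel (hK : IsKernel K) (hh : 0 < h) (hfit : KernelFits K x₀ h)
    (hγ : IsSymmDensity γ) : ∫ e, K (rescale x₀ h e.1) ∂(obsLaw d γ) = h ^ d := by
  have := isProbabilityMeasure_noise hγ
  rw [obsLaw, integral_prod _ (integrable_obsLaw_kernel hK hγ)]
  simpa using setIntegral_kernel_rescale hK hh hfit

theorem integral_obsLaw_le_of_le_kernel (hK : IsKernel K) (hh : 0 < h) (hfit : KernelFits K x₀ h)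
    (hγ : IsSymmDensity γ) {F : (Fin d → ℝ) × ℝ → ℝ} {A : ℝ} (hF0 : ∀ e, 0 ≤ F e)
    (hF : ∀ e, F e ≤ A * K (rescale x₀ h e.1)) :
    ∫ e, F e ∂(obsLaw d γ) ≤ A * h ^ d := by
  rw [← integral_obsLaw_kernel hK hh hfit hγ, ← integral_const_mul]
  exact integral_mono_of_nonneg (Eventually.of_forall hF0)
    ((integrable_obsLaw_kernel hK hγ).const_mul A) (Eventually.of_forall hF)

theorem integral_sq_le_of_abs_le_kernel (hK : IsKernel K) (hh : 0 < h) (hfit : KernelFits K x₀ h)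
    (hγ : IsSymmDensity γ) {F : (Fin d → ℝ) × ℝ → ℝ} {A : ℝ}
    (hF : ∀ e, |F e| ≤ A * K (rescale x₀ h e.1)) :
    ∫ e, F e ^ 2 ∂(obsLaw d γ) ≤ A ^ 2 * supNorm K * h ^ d := by
  refine integral_obsLaw_le_of_le_kernel hK hh hfit hγ (fun _ => sq_nonneg _) fun e => ?_
  calc F e ^ 2 = |F e| ^ 2 := (sq_abs _).symm
    _ ≤ (A * K (rescale x₀ h e.1)) ^ 2 := pow_le_pow_left₀ (abs_nonneg _) (hF e) 2
    _ = A ^ 2 * K (rescale x₀ h e.1) * K (rescale x₀ h e.1) := by ring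
    _ ≤ A ^ 2 * supNorm K * K (rescale x₀ h e.1) := by
        gcongr
        · exact hK.nonneg _
        · exact hK.le_supNorm _

end ObservationLaw

section ScoreTerm

variable {d : ℕ} {K : (Fin d → ℝ) → ℝ} {x₀ : Fin d → ℝ} {h : ℝ} {ρ γ : ℝ → ℝ} {g : ℕ → ℝ → ℝ}
  {u : (Fin d → ℝ) → ℝ}

/-- The contribution of one observation to the derivative of the criterion in direction `p` (up to
sign), when `f` differs from the local polynomial by `u`. -/
def scoreTerm (ρ : ℝ → ℝ) (K : (Fin d → ℝ) → ℝ) (x₀ : Fin d → ℝ) (h : ℝ)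
    (u : (Fin d → ℝ) → ℝ) (p : Fin d → ℕ) (e : (Fin d → ℝ) × ℝ) : ℝ :=
  deriv ρ (e.2 + u e.1) * monom p (rescale x₀ h e.1) * K (rescale x₀ h e.1)

theorem measurable_scoreTerm (hK : IsKernel K) (hu : Measurable u) (p : Fin d → ℕ) :
    Measurable (scoreTerm ρ K x₀ h u p) := by
  have hz : Measurable fun e : (Fin d → ℝ) × ℝ => rescale x₀ h e.1 :=
    (measurable_rescale x₀ h).comp measurable_fst
  exact (((measurable_deriv ρ).comp (measurable_snd.add (hu.comp measurable_fst))).mul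
    ((continuous_monom p).measurable.comp hz)).mul (hK.measurable.comp hz)

theorem abs_mul_monom_mul_kernel_le (hK : IsKernel K) {a A : ℝ} (p : Fin d → ℕ) {z : Fin d → ℝ}
    (ha : K z ≠ 0 → |a| ≤ A) : |a * monom p z * K z| ≤ A * K z := by
  by_cases hz : K z = 0
  · simp [hz]
  rw [abs_mul, abs_mul, abs_of_nonneg (hK.nonneg z)]
  exact mul_le_mul_of_nonneg_right ((mul_le_of_le_one_right (abs_nonneg _)
    (abs_monom_le_one p (hK.support z hz))).trans (ha hz)) (hK.nonneg z)

theorem abs_scoreTerm_le_kernel (hK : IsKernel K) (hρ : IsContrast ρ g) (p : Fin d → ℕ)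
    (e : (Fin d → ℝ) × ℝ) :
    |scoreTerm ρ K x₀ h u p e| ≤ supNorm (deriv ρ) * K (rescale x₀ h e.1) :=
  abs_mul_monom_mul_kernel_le hK p fun _ => hρ.abs_deriv_le _

theorem IsContrast.supNorm_deriv_nonneg (hρ : IsContrast ρ g) : 0 ≤ supNorm (deriv ρ) :=
  (abs_nonneg _).trans (hρ.abs_deriv_le 0)

theorem abs_scoreTerm_le (hK : IsKernel K) (hρ : IsContrast ρ g) (p : Fin d → ℕ)
    (e : (Fin d → ℝ) × ℝ) :
    |scoreTerm ρ K x₀ h u p e| ≤ supNorm (deriv ρ) * supNorm K :=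
  (abs_scoreTerm_le_kernel hK hρ p e).trans
    (mul_le_mul_of_nonneg_left (hK.le_supNorm _) hρ.supNorm_deriv_nonneg)

theorem integral_scoreTerm_sq_le (hK : IsKernel K) (hρ : IsContrast ρ g) (hh : 0 < h)
    (hfit : KernelFits K x₀ h) (hγ : IsSymmDensity γ) (p : Fin d → ℕ) :
    ∫ e, scoreTerm ρ K x₀ h u p e ^ 2 ∂(obsLaw d γ)
      ≤ supNorm (deriv ρ) ^ 2 * supNorm K * h ^ d :=
  integral_sq_le_of_abs_le_kernel hK hh hfit hγ (abs_scoreTerm_le_kernel hK hρ p)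

theorem integral_scoreTerm_mul (p : Fin d → ℕ) (x : Fin d → ℝ) :
    ∫ z, scoreTerm ρ K x₀ h u p (x, z) * γ z =
      smoothScore ρ γ (u x) * monom p (rescale x₀ h x) * K (rescale x₀ h x) := by
  rw [smoothScore, ← integral_mul_const, ← integral_mul_const]
  refine integral_congr_ae (Eventually.of_forall fun z => ?_)
  simp only [scoreTerm]
  ring

theorem abs_integral_scoreTerm_le (hK : IsKernel K) (hρ : IsContrast ρ g) (hh : 0 < h)
    (hfit : KernelFits K x₀ h) (hγ : IsSymmDensity γ) (hu : Measurable u) {ε : ℝ}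
    (hε : ∀ x, K (rescale x₀ h x) ≠ 0 → |u x| ≤ ε) (p : Fin d → ℕ) :
    |∫ e, scoreTerm ρ K x₀ h u p e ∂(obsLaw d γ)| ≤ ε * h ^ d := by
  rw [integral_obsLaw hγ (measurable_scoreTerm hK hu p) (abs_scoreTerm_le hK hρ p)]
  simp_rw [integral_scoreTerm_mul]
  rw [← setIntegral_kernel_rescale hK hh hfit, ← integral_const_mul, ← Real.norm_eq_abs]
  exact norm_integral_le_of_norm_le ((integrableOn_kernel_rescale hK).const_mul ε)
    (Eventually.of_forall fun x => abs_mul_monom_mul_kernel_le hK p fun hx =>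
      (hρ.abs_smoothScore_le hγ _).trans (hε x hx))

end ScoreTerm

section CurvTerm

variable {d b : ℕ} {K : (Fin d → ℝ) → ℝ} {x₀ : Fin d → ℝ} {h s : ℝ} {ρ γ : ℝ → ℝ}
  {g : ℕ → ℝ → ℝ} {u : (Fin d → ℝ) → ℝ}

/-- The difference quotient, with step `s`, of `ρ'` at `y` in direction `-a`. -/
def scoreQuotient (ρ : ℝ → ℝ) (s y a : ℝ) : ℝ := (deriv ρ y - deriv ρ (y - s * a)) / s

theorem IsContrast.abs_scoreQuotient_sub_le (hρ : IsContrast ρ g) (hs : 0 < s) (y a a' : ℝ) :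
    |scoreQuotient ρ s y a - scoreQuotient ρ s y a'| ≤ |a - a'| := by
  rw [scoreQuotient, scoreQuotient, ← sub_div, sub_sub_sub_cancel_left, abs_div, abs_of_pos hs,
    div_le_iff₀ hs]
  refine (hρ.abs_deriv_sub_le _ _).trans_eq ?_
  rw [sub_sub_sub_cancel_left, ← mul_sub, abs_mul, abs_of_pos hs, mul_comm]

theorem IsContrast.abs_scoreQuotient_le (hρ : IsContrast ρ g) (hs : 0 < s) (y a : ℝ) :
    |scoreQuotient ρ s y a| ≤ |a| := by
  simpa [scoreQuotient] using hρ.abs_scoreQuotient_sub_le hs y a 0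

/-- The contribution of one observation to the increment of the score along `s • w`, divided
by `s`. -/
def curvTerm (ρ : ℝ → ℝ) (K : (Fin d → ℝ) → ℝ) (x₀ : Fin d → ℝ) (h : ℝ)
    (u : (Fin d → ℝ) → ℝ) (s : ℝ) (w : multiIdx d b → ℝ) (e : (Fin d → ℝ) × ℝ) : ℝ :=
  scoreQuotient ρ s (e.2 + u e.1) (polyVal w (rescale x₀ h e.1)) *
    polyVal w (rescale x₀ h e.1) * K (rescale x₀ h e.1)

theorem measurable_curvTerm (hK : IsKernel K) (hu : Measurable u) (w : multiIdx d b → ℝ) :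
    Measurable (curvTerm ρ K x₀ h u s w) := by
  have hz : Measurable fun e : (Fin d → ℝ) × ℝ => rescale x₀ h e.1 :=
    (measurable_rescale x₀ h).comp measurable_fst
  have ha : Measurable fun e : (Fin d → ℝ) × ℝ => polyVal w (rescale x₀ h e.1) :=
    (continuous_polyVal w).measurable.comp hz
  have hy : Measurable fun e : (Fin d → ℝ) × ℝ => e.2 + u e.1 :=
    measurable_snd.add (hu.comp measurable_fst)
  exact (((((measurable_deriv ρ).comp hy).sub ((measurable_deriv ρ).comp
    (hy.sub (ha.const_mul s)))).div_const s).mul ha).mul (hK.measurable.comp hz)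

theorem abs_curvTerm_le_kernel (hK : IsKernel K) (hρ : IsContrast ρ g) (hs : 0 < s)
    {w : multiIdx d b → ℝ} {A : ℝ} (hw : ∑ p, |w p| ≤ A) (e : (Fin d → ℝ) × ℝ) :
    |curvTerm ρ K x₀ h u s w e| ≤ A ^ 2 * K (rescale x₀ h e.1) := by
  rw [curvTerm, abs_mul, abs_of_nonneg (hK.nonneg _), abs_mul, sq]
  by_cases hx : K (rescale x₀ h e.1) = 0
  · simp [hx]
  have ha := (abs_polyVal_le w (hK.support _ hx)).trans hw
  exact mul_le_mul_of_nonneg_right (mul_le_mul ((hρ.abs_scoreQuotient_le hs _ _).trans ha) ha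
    (abs_nonneg _) ((abs_nonneg _).trans ha)) (hK.nonneg _)

theorem abs_curvTerm_le (hK : IsKernel K) (hρ : IsContrast ρ g) (hs : 0 < s)
    {w : multiIdx d b → ℝ} {A : ℝ} (hw : ∑ p, |w p| ≤ A) (e : (Fin d → ℝ) × ℝ) :
    |curvTerm ρ K x₀ h u s w e| ≤ A ^ 2 * supNorm K :=
  (abs_curvTerm_le_kernel hK hρ hs hw e).trans
    (mul_le_mul_of_nonneg_left (hK.le_supNorm _) (sq_nonneg A))

theorem polyVal_sub (w w' : multiIdx d b → ℝ) (z : Fin d → ℝ) :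
    polyVal (w - w') z = polyVal w z - polyVal w' z := by
  simp only [polyVal, Pi.sub_apply, sub_mul, Finset.sum_sub_distrib]

theorem IsContrast.abs_scoreQuotient_mul_sub_le (hρ : IsContrast ρ g) (hs : 0 < s)
    (y : ℝ) {a a' A : ℝ} (ha : |a| ≤ A) (ha' : |a'| ≤ A) :
    |scoreQuotient ρ s y a * a - scoreQuotient ρ s y a' * a'| ≤ 2 * A * |a - a'| := by
  set v := scoreQuotient ρ s y a
  set v' := scoreQuotient ρ s y a'
  calc |v * a - v' * a'| = |v * (a - a') + (v - v') * a'| := by congr 1; ring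
    _ ≤ |v| * |a - a'| + |v - v'| * |a'| := by
        simpa only [abs_mul] using abs_add_le (v * (a - a')) ((v - v') * a')
    _ ≤ A * |a - a'| + |a - a'| * A := by
        exact add_le_add
          (mul_le_mul_of_nonneg_right ((hρ.abs_scoreQuotient_le hs y a).trans ha) (abs_nonneg _))
          (mul_le_mul (hρ.abs_scoreQuotient_sub_le hs y a a') ha' (abs_nonneg _) (abs_nonneg _))
    _ = 2 * A * |a - a'| := by ring

theorem abs_curvTerm_sub_le (hK : IsKernel K) (hρ : IsContrast ρ g) (hs : 0 < s)
    {w w' : multiIdx d b → ℝ} {A δ : ℝ} (hw : ∑ p, |w p| ≤ A) (hw' : ∑ p, |w' p| ≤ A)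
    (hδ : ∑ p, |w p - w' p| ≤ δ) (e : (Fin d → ℝ) × ℝ) :
    |curvTerm ρ K x₀ h u s w e - curvTerm ρ K x₀ h u s w' e|
      ≤ 2 * A * δ * K (rescale x₀ h e.1) := by
  rw [curvTerm, curvTerm, ← sub_mul, abs_mul, abs_of_nonneg (hK.nonneg _)]
  by_cases hx : K (rescale x₀ h e.1) = 0
  · simp [hx]
  have hbox := hK.support _ hx
  have hA : 0 ≤ A := (Finset.sum_nonneg fun p _ => abs_nonneg (w p)).trans hw
  refine mul_le_mul_of_nonneg_right ((hρ.abs_scoreQuotient_mul_sub_le hs _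
    ((abs_polyVal_le w hbox).trans hw) ((abs_polyVal_le w' hbox).trans hw')).trans ?_)
    (hK.nonneg _)
  rw [← polyVal_sub]
  gcongr
  exact (abs_polyVal_le _ hbox).trans hδ

theorem integral_curvTerm_sq_le (hK : IsKernel K) (hρ : IsContrast ρ g) (hh : 0 < h)
    (hfit : KernelFits K x₀ h) (hγ : IsSymmDensity γ) (hs : 0 < s)
    {w : multiIdx d b → ℝ} {A : ℝ} (hw : ∑ p, |w p| ≤ A) :
    ∫ e, curvTerm ρ K x₀ h u s w e ^ 2 ∂(obsLaw d γ) ≤ A ^ 4 * supNorm K * h ^ d :=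
  (integral_sq_le_of_abs_le_kernel hK hh hfit hγ
    (abs_curvTerm_le_kernel hK hρ hs hw)).trans_eq (by ring)

theorem IsContrast.integral_curvTerm_mul (hρ : IsContrast ρ g) (hγ : IsSymmDensity γ)
    (w : multiIdx d b → ℝ) (x : Fin d → ℝ) :
    ∫ z, curvTerm ρ K x₀ h u s w (x, z) * γ z =
      (smoothScore ρ γ (u x) - smoothScore ρ γ (u x - s * polyVal w (rescale x₀ h x))) / s *
        polyVal w (rescale x₀ h x) * K (rescale x₀ h x) := by
  set a := polyVal w (rescale x₀ h x)
  rw [smoothScore, smoothScore, ← integral_sub (hρ.integrable_score hγ _)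
    (hρ.integrable_score hγ _), ← integral_div, ← integral_mul_const, ← integral_mul_const]
  refine integral_congr_ae (Eventually.of_forall fun z => ?_)
  simp only [curvTerm, scoreQuotient, add_sub_assoc, a]
  ring

theorem mul_minEigenvalue_mul_le_setIntegral (hK : IsKernel K) (hh : 0 < h)
    (hfit : KernelFits K x₀ h) {c₀ : ℝ} (hc₀ : 0 ≤ c₀) {w : multiIdx d b → ℝ}
    (hw : ∑ p, w p ^ 2 = 1) :
    c₀ * minEigenvalue b K * h ^ d ≤
      ∫ x in cube d, c₀ * (polyVal w (rescale x₀ h x) ^ 2 * K (rescale x₀ h x)) := by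
  rw [integral_const_mul, setIntegral_rescale (G := fun z => polyVal w z ^ 2 * K z) hh hfit
    (fun z hz => by rw [hz, mul_zero]), mul_assoc, mul_comm (minEigenvalue b K)]
  have hmin := hK.minEigenvalue_mul_le b w
  rw [hw, mul_one] at hmin
  gcongr

theorem le_integral_curvTerm (hK : IsKernel K) (hρ : IsContrast ρ g) (hh : 0 < h)
    (hfit : KernelFits K x₀ h) (hγ : IsSymmDensity γ) (hu : Measurable u)
    {η c₀ : ℝ} (hc₀ : 0 ≤ c₀) (hη : ∀ u y : ℝ, |u| ≤ η → |y| ≤ η →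
      c₀ * y ^ 2 ≤ (smoothScore ρ γ u - smoothScore ρ γ (u - y)) * y)
    (hε : ∀ x, K (rescale x₀ h x) ≠ 0 → |u x| ≤ η) (hs : 0 < s)
    {w : multiIdx d b → ℝ} {A : ℝ} (hw : ∑ p, |w p| ≤ A) (hw2 : ∑ p, w p ^ 2 = 1)
    (hsA : s * A ≤ η) :
    c₀ * minEigenvalue b K * h ^ d ≤ ∫ e, curvTerm ρ K x₀ h u s w e ∂(obsLaw d γ) := by
  have hmeas := measurable_curvTerm (ρ := ρ) (x₀ := x₀) (h := h) (s := s) hK hu w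
  have hbound := abs_curvTerm_le (x₀ := x₀) (h := h) (u := u) hK hρ hs hw
  rw [integral_obsLaw hγ hmeas hbound]
  refine (mul_minEigenvalue_mul_le_setIntegral hK hh hfit hc₀ hw2).trans ?_
  refine integral_mono_of_nonneg (Eventually.of_forall fun x =>
    mul_nonneg hc₀ (mul_nonneg (sq_nonneg _) (hK.nonneg _)))
    (integrableOn_integral_noise hγ hmeas hbound) (Eventually.of_forall fun x => ?_)
  simp only [hρ.integral_curvTerm_mul hγ]
  by_cases hx : K (rescale x₀ h x) = 0
  · simp [hx]
  set a := polyVal w (rescale x₀ h x)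
  have ha : |s * a| ≤ η := by
    rw [abs_mul, abs_of_pos hs]
    exact (mul_le_mul_of_nonneg_left ((abs_polyVal_le w (hK.support _ hx)).trans hw) hs.le).trans
      hsA
  rw [← mul_assoc]
  refine mul_le_mul_of_nonneg_right ?_ (hK.nonneg _)
  rw [div_mul_eq_mul_div, le_div_iff₀ hs]
  refine le_of_mul_le_mul_left ?_ hs
  linarith [hη (u x) (s * a) (hε x hx) ha]

end CurvTerm

/-! ### Deviations of the score and of the curvature -/

section Deviation

theorem lintegral_exp_mul_sum_le_of_abs {n : ℕ} {E : Type*} [MeasurableSpace E]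
    {μ : Fin n → Measure E} [∀ i, IsProbabilityMeasure (μ i)] {Y : Fin n → E → ℝ}
    (hY : ∀ i, Measurable (Y i)) {B m v s : ℝ} (hB : ∀ i e, |Y i e| ≤ B)
    (hm : ∀ i, |∫ e, Y i e ∂(μ i)| ≤ m) (hv : ∀ i, ∫ e, Y i e ^ 2 ∂(μ i) ≤ v)
    (hsB : |s| * B ≤ 1) :
    ∫⁻ ω, ENNReal.ofReal (Real.exp (s * ∑ i, Y i (ω i))) ∂(Measure.pi μ)
      ≤ ENNReal.ofReal (Real.exp (n * (|s| * m + s ^ 2 * v))) := by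
  rcases le_total 0 s with hs | hs
  · rw [abs_of_nonneg hs] at hsB ⊢
    exact lintegral_exp_mul_sum_le hY hB (fun i => (le_abs_self _).trans (hm i)) hv hs hsB
  · rw [abs_of_nonpos hs] at hsB ⊢
    have hneg := lintegral_exp_mul_sum_le (μ := μ) (Y := fun i e => -Y i e) (m := m) (v := v)
      (fun i => (hY i).neg) (fun i e => (abs_neg _).trans_le (hB i e))
      (fun i => (integral_neg _).trans_le ((neg_le_abs _).trans (hm i)))
      (fun i => by simpa only [neg_sq] using hv i) (neg_nonneg.2 hs) hsB
    simpa only [Finset.sum_neg_distrib, neg_mul_neg, neg_sq] using hneg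

theorem exp_mul_pi_norm_le {ι : Type*} [Fintype ι] [Nonempty ι] {t : ℝ} (ht : 0 ≤ t) (v : ι → ℝ) :
    Real.exp (t * ‖v‖) ≤ ∑ p, (Real.exp (t * v p) + Real.exp (-t * v p)) := by
  obtain ⟨p, hp⟩ : ∃ p, ‖v‖ ≤ |v p| := by
    by_contra! hlt
    have hpos : 0 < ‖v‖ := (abs_nonneg _).trans_lt (hlt (Classical.arbitrary ι))
    exact lt_irrefl _ ((pi_norm_lt_iff hpos).2 hlt)
  calc Real.exp (t * ‖v‖) ≤ Real.exp |t * v p| := by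
        rw [abs_mul, abs_of_nonneg ht]
        gcongr
    _ ≤ Real.exp (t * v p) + Real.exp (-t * v p) := by
        simpa only [neg_mul] using Real.exp_abs_le (t * v p)
    _ ≤ _ := Finset.single_le_sum
        (f := fun p => Real.exp (t * v p) + Real.exp (-t * v p)) (fun q _ => by positivity)
        (Finset.mem_univ p)

theorem lintegral_exp_mul_pi_norm_le {Ω ι : Type*} [MeasurableSpace Ω] [Fintype ι] [Nonempty ι]
    {μ : Measure Ω} {F : Ω → ι → ℝ} (hF : Measurable F) {t E : ℝ} (ht : 0 ≤ t) (hE : 0 ≤ E)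
    (hpos : ∀ p, ∫⁻ ω, ENNReal.ofReal (Real.exp (t * F ω p)) ∂μ ≤ ENNReal.ofReal E)
    (hneg : ∀ p, ∫⁻ ω, ENNReal.ofReal (Real.exp (-t * F ω p)) ∂μ ≤ ENNReal.ofReal E) :
    ∫⁻ ω, ENNReal.ofReal (Real.exp (t * ‖F ω‖)) ∂μ
      ≤ ENNReal.ofReal (2 * Fintype.card ι * E) := by
  have hmeas : ∀ (s : ℝ) (p : ι), Measurable fun ω => ENNReal.ofReal (Real.exp (s * F ω p)) :=
    fun s p => (((measurable_pi_apply p).comp hF).const_mul s).exp.ennreal_ofReal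
  calc ∫⁻ ω, ENNReal.ofReal (Real.exp (t * ‖F ω‖)) ∂μ
      ≤ ∫⁻ ω, ∑ p, (ENNReal.ofReal (Real.exp (t * F ω p)) +
          ENNReal.ofReal (Real.exp (-t * F ω p))) ∂μ := by
        refine lintegral_mono fun ω => ?_
        simp only [← ENNReal.ofReal_add (Real.exp_pos _).le (Real.exp_pos _).le]
        rw [← ENNReal.ofReal_sum_of_nonneg fun p _ => by positivity]
        exact ENNReal.ofReal_le_ofReal (exp_mul_pi_norm_le ht _)
    _ = ∑ p, (∫⁻ ω, ENNReal.ofReal (Real.exp (t * F ω p)) ∂μ +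
          ∫⁻ ω, ENNReal.ofReal (Real.exp (-t * F ω p)) ∂μ) := by
        refine (lintegral_finsetSum _ fun p _ => (hmeas t p).add (hmeas (-t) p)).trans ?_
        exact Finset.sum_congr rfl fun p _ => lintegral_add_left (hmeas t p) _
    _ ≤ ∑ _p : ι, (ENNReal.ofReal E + ENNReal.ofReal E) :=
        Finset.sum_le_sum fun p _ => add_le_add (hpos p) (hneg p)
    _ = ENNReal.ofReal (2 * Fintype.card ι * E) := by
        rw [← ENNReal.ofReal_add hE hE, Finset.sum_const, Finset.card_univ,
          ← ENNReal.ofReal_nsmul, nsmul_eq_mul]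
        ring_nf

theorem sum_abs_le_sqrt_card {ι : Type*} [Fintype ι] {w : ι → ℝ} (hw : ∑ p, w p ^ 2 = 1) :
    ∑ p, |w p| ≤ √(Fintype.card ι) := by
  refine Real.le_sqrt_of_sq_le ?_
  have := sq_sum_le_card_mul_sum_sq (s := (Finset.univ : Finset ι)) (f := fun p => |w p|)
  simpa [sq_abs, hw] using this

theorem isCompact_setOf_sum_sq_eq_one (ι : Type*) [Fintype ι] :
    IsCompact {w : ι → ℝ | ∑ p, w p ^ 2 = 1} := by
  refine Metric.isCompact_of_isClosed_isBounded
    (isClosed_eq (by fun_prop) continuous_const) ?_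
  refine (Metric.isBounded_closedBall (x := (0 : ι → ℝ)) (r := 1)).subset fun w hw => ?_
  rw [mem_closedBall_zero_iff, pi_norm_le_iff_of_nonneg zero_le_one]
  intro p
  rw [Real.norm_eq_abs, ← sq_le_one_iff_abs_le_one]
  exact (Finset.single_le_sum (f := fun p => w p ^ 2) (fun _ _ => sq_nonneg _)
    (Finset.mem_univ p)).trans_eq hw

theorem exists_sphere_net (ι : Type*) [Fintype ι] {δ : ℝ} (hδ : 0 < δ) :
    ∃ T : Finset (ι → ℝ), (∀ w ∈ T, ∑ p, w p ^ 2 = 1) ∧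
      ∀ w : ι → ℝ, ∑ p, w p ^ 2 = 1 → ∃ w' ∈ T, ∑ p, |w p - w' p| ≤ δ := by
  have hr : 0 < δ / (Fintype.card ι + 1) := by positivity
  obtain ⟨T, hTs, hTf, hTc⟩ := finite_cover_balls_of_compact (isCompact_setOf_sum_sq_eq_one ι) hr
  refine ⟨hTf.toFinset, fun w hw => hTs (hTf.mem_toFinset.1 hw), fun w hw => ?_⟩
  obtain ⟨w', hw', hdist⟩ := Set.mem_iUnion₂.1 (hTc hw)
  refine ⟨w', hTf.mem_toFinset.2 hw', ?_⟩
  calc ∑ p, |w p - w' p| ≤ ∑ _p : ι, δ / (Fintype.card ι + 1) :=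
        Finset.sum_le_sum fun p _ => (dist_le_pi_dist w w' p).trans (Metric.mem_ball.1 hdist).le
    _ = Fintype.card ι * δ / (Fintype.card ι + 1) := by simp [mul_div_assoc]
    _ ≤ δ := by
        rw [div_le_iff₀ (by positivity)]
        nlinarith

variable {d b n : ℕ} {K : (Fin d → ℝ) → ℝ} {x₀ : Fin d → ℝ} {h s : ℝ} {ρ : ℝ → ℝ}
  {g : ℕ → ℝ → ℝ} {u : (Fin d → ℝ) → ℝ}

/-- The sup-norm of the score vector, the gradient of the criterion up to sign and without the
factor `1 / (n * h ^ d)`. -/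
def scoreNorm (b : ℕ) (ρ : ℝ → ℝ) (K : (Fin d → ℝ) → ℝ) (x₀ : Fin d → ℝ) (h : ℝ)
    (u : (Fin d → ℝ) → ℝ) (ω : Sample d n) : ℝ :=
  ‖fun p : multiIdx d b => ∑ i, scoreTerm ρ K x₀ h u p.1 (ω i)‖

theorem measurable_sum_scoreTerm (hK : IsKernel K) (hu : Measurable u) :
    Measurable fun (ω : Sample d n) (p : multiIdx d b) => ∑ i, scoreTerm ρ K x₀ h u p.1 (ω i) :=
  measurable_pi_lambda _ fun p => Finset.measurable_fun_sum _ fun i _ =>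
    (measurable_scoreTerm hK hu p.1).comp (measurable_pi_apply i)

theorem measurable_scoreNorm (hK : IsKernel K) (hu : Measurable u) :
    Measurable (scoreNorm (n := n) b ρ K x₀ h u) :=
  (measurable_sum_scoreTerm hK hu).norm

theorem lintegral_exp_mul_sum_scoreTerm_le (hK : IsKernel K) (hρ : IsContrast ρ g)
    (hg : ∀ i, IsSymmDensity (g i)) (hh : 0 < h) (hfit : KernelFits K x₀ h) (hu : Measurable u)
    {ε : ℝ} (hε : ∀ x, K (rescale x₀ h x) ≠ 0 → |u x| ≤ ε) {t : ℝ}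
    (ht : |t| * (supNorm (deriv ρ) * supNorm K) ≤ 1) (p : Fin d → ℕ) :
    ∫⁻ ω, ENNReal.ofReal (Real.exp (t * ∑ i, scoreTerm ρ K x₀ h u p (ω i))) ∂(modelLaw d g n)
      ≤ ENNReal.ofReal (Real.exp
        (n * h ^ d * (|t| * ε + t ^ 2 * (supNorm (deriv ρ) ^ 2 * supNorm K)))) := by
  have : ∀ i : Fin n, IsProbabilityMeasure (obsLaw d (g i)) := fun i =>
    isProbabilityMeasure_obsLaw d (hg i)
  rw [modelLaw_eq_pi]
  refine (lintegral_exp_mul_sum_le_of_abs (Y := fun _ => scoreTerm ρ K x₀ h u p)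
    (fun _ => measurable_scoreTerm hK hu p) (fun _ e => abs_scoreTerm_le hK hρ p e)
    (fun i => abs_integral_scoreTerm_le hK hρ hh hfit (hg i) hu hε p)
    (fun i => integral_scoreTerm_sq_le hK hρ hh hfit (hg i) p) ht).trans_eq ?_
  ring_nf

theorem lintegral_exp_scoreNorm_le (hK : IsKernel K) (hρ : IsContrast ρ g)
    (hg : ∀ i, IsSymmDensity (g i)) (hh : 0 < h) (hfit : KernelFits K x₀ h) (hu : Measurable u)
    {ε : ℝ} (hε : ∀ x, K (rescale x₀ h x) ≠ 0 → |u x| ≤ ε) {t : ℝ} (ht : 0 ≤ t)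
    (ht1 : t * (supNorm (deriv ρ) * supNorm K) ≤ 1) :
    ∫⁻ ω, ENNReal.ofReal (Real.exp (t * scoreNorm b ρ K x₀ h u ω)) ∂(modelLaw d g n)
      ≤ ENNReal.ofReal (2 * (multiIdx d b).card *
        Real.exp (n * h ^ d * (t * ε + t ^ 2 * (supNorm (deriv ρ) ^ 2 * supNorm K)))) := by
  have : Nonempty (multiIdx d b) := ⟨zeroIdx d b⟩
  rw [← Fintype.card_coe]
  refine lintegral_exp_mul_pi_norm_le (measurable_sum_scoreTerm hK hu) ht (Real.exp_pos _).le
    (fun p => ?_) fun p => ?_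
  · simpa only [abs_of_nonneg ht] using lintegral_exp_mul_sum_scoreTerm_le
      (n := n) (t := t) hK hρ hg hh hfit hu hε (by rwa [abs_of_nonneg ht]) p.1
  · simpa only [abs_neg, abs_of_nonneg ht, neg_sq] using lintegral_exp_mul_sum_scoreTerm_le
      (n := n) (t := -t) hK hρ hg hh hfit hu hε (by rwa [abs_neg, abs_of_nonneg ht]) p.1

/-- The samples for which the empirical curvature at radius `s` is too small. -/
def flatSet (b n : ℕ) (ρ : ℝ → ℝ) (K : (Fin d → ℝ) → ℝ) (x₀ : Fin d → ℝ) (c h : ℝ)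
    (u : (Fin d → ℝ) → ℝ) (s : ℝ) : Set (Sample d n) :=
  {ω | ∃ w : multiIdx d b → ℝ, ∑ p, w p ^ 2 = 1 ∧
    ∑ i, curvTerm ρ K x₀ h u s w (ω i) < c * minEigenvalue b K / 2 * (n * h ^ d)}

theorem measure_sum_curvTerm_le (hK : IsKernel K) (hρ : IsContrast ρ g)
    (hg : ∀ i, IsSymmDensity (g i)) (hh : 0 < h) (hfit : KernelFits K x₀ h) (hu : Measurable u)
    {η c : ℝ} (hc : 0 < c) (hmono : ∀ i, ∀ u y : ℝ, |u| ≤ η → |y| ≤ η →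
      3 / 4 * c * y ^ 2 ≤ (smoothScore ρ (g i) u - smoothScore ρ (g i) (u - y)) * y)
    (hε : ∀ x, K (rescale x₀ h x) ≠ 0 → |u x| ≤ η) (hs : 0 < s)
    {w : multiIdx d b → ℝ} {A : ℝ} (hw : ∑ p, |w p| ≤ A) (hw2 : ∑ p, w p ^ 2 = 1)
    (hsA : s * A ≤ η) {t : ℝ} (ht : 0 ≤ t) (htA : t * (A ^ 2 * supNorm K) ≤ 1)
    (htq : t * (A ^ 4 * supNorm K) ≤ c * minEigenvalue b K / 16) :
    modelLaw d g n {ω | ∑ i, curvTerm ρ K x₀ h u s w (ω i) ≤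
        5 / 8 * (c * minEigenvalue b K) * (n * h ^ d)}
      ≤ ENNReal.ofReal (Real.exp (-(c * minEigenvalue b K * t / 16 * (n * h ^ d)))) := by
  set q := c * minEigenvalue b K with hq
  set N : ℝ := n * h ^ d
  have hpr : ∀ i : Fin n, IsProbabilityMeasure (obsLaw d (g i)) := fun i =>
    isProbabilityMeasure_obsLaw d (hg i)
  have hmgf := lintegral_exp_mul_sum_le (μ := fun i : Fin n => obsLaw d (g i))
    (Y := fun _ e => -curvTerm ρ K x₀ h u s w e) (B := A ^ 2 * supNorm K)
    (m := -(3 / 4 * c * minEigenvalue b K * h ^ d)) (v := A ^ 4 * supNorm K * h ^ d)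
    (fun _ => (measurable_curvTerm hK hu w).neg)
    (fun _ e => (abs_neg _).trans_le (abs_curvTerm_le hK hρ hs hw e))
    (fun i => (integral_neg _).trans_le (neg_le_neg (le_integral_curvTerm hK hρ hh hfit (hg i) hu
      (by positivity) (hmono i) hε hs hw hw2 hsA)))
    (fun i => by simpa only [neg_sq] using integral_curvTerm_sq_le hK hρ hh hfit (hg i) hs hw)
    ht htA
  rw [← modelLaw_eq_pi] at hmgf
  have hmeas : Measurable fun ω : Sample d n => t * ∑ i, -curvTerm ρ K x₀ h u s w (ω i) :=
    (Finset.measurable_fun_sum _ fun i _ => (measurable_curvTerm hK hu w).neg.comp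
      (measurable_pi_apply i)).const_mul t
  refine (measure_mono fun ω hω => ?_).trans ((measure_le_of_lintegral_exp_le hmeas hmgf
    (-(t * (5 / 8 * q * N)))).trans (ENNReal.ofReal_le_ofReal ?_))
  · simp only [Set.mem_ofPred_eq, Finset.sum_neg_distrib, mul_neg, neg_le_neg_iff] at hω ⊢
    exact mul_le_mul_of_nonneg_left hω ht
  · rw [← Real.exp_add, Real.exp_le_exp]
    have hNt : 0 ≤ N * t := by positivity
    have := mul_le_mul_of_nonneg_left htq hNt
    linear_combination this + N * t * hq * (3 / 4 : ℝ)

theorem measure_le_sum_kernel_le (hK : IsKernel K) (hg : ∀ i, IsSymmDensity (g i)) (hh : 0 < h)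
    (hfit : KernelFits K x₀ h) :
    modelLaw d g n {ω | 2 * (n * h ^ d) ≤ ∑ i, K (rescale x₀ h (ω i).1)}
      ≤ ENNReal.ofReal (Real.exp (-(1 / (4 * supNorm K) * (n * h ^ d)))) := by
  have hk := hK.one_le_supNorm
  have hpr : ∀ i : Fin n, IsProbabilityMeasure (obsLaw d (g i)) := fun i =>
    isProbabilityMeasure_obsLaw d (hg i)
  have hmeas : Measurable fun e : (Fin d → ℝ) × ℝ => K (rescale x₀ h e.1) :=
    hK.measurable.comp ((measurable_rescale x₀ h).comp measurable_fst)
  have habs : ∀ e : (Fin d → ℝ) × ℝ, |K (rescale x₀ h e.1)| ≤ 1 * K (rescale x₀ h e.1) :=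
    fun e => by rw [abs_of_nonneg (hK.nonneg _), one_mul]
  have hmgf := lintegral_exp_mul_sum_le (μ := fun i : Fin n => obsLaw d (g i))
    (Y := fun _ e => K (rescale x₀ h e.1)) (s := 1 / (2 * supNorm K)) (fun _ => hmeas)
    (fun _ e => (habs e).trans (by simpa using hK.le_supNorm (rescale x₀ h e.1)))
    (fun i => (integral_obsLaw_kernel hK hh hfit (hg i)).le)
    (fun i => integral_sq_le_of_abs_le_kernel hK hh hfit (hg i) habs)
    (by positivity) (by field_simp; norm_num)
  rw [← modelLaw_eq_pi] at hmgf
  refine (measure_mono fun ω hω => ?_).trans ((measure_le_of_lintegral_exp_le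
    ((Finset.measurable_fun_sum _ fun i _ => hmeas.comp (measurable_pi_apply i)).const_mul _) hmgf
    (1 / (2 * supNorm K) * (2 * (n * h ^ d)))).trans_eq ?_)
  · exact mul_le_mul_of_nonneg_left (Set.mem_ofPred.1 hω) (by positivity)
  · rw [← Real.exp_add]
    congr 2
    field_simp
    ring

theorem flatSet_subset (hK : IsKernel K) (hρ : IsContrast ρ g) (hs : 0 < s) {c A δ : ℝ}
    (hc : 0 < c) (hA : ∀ w : multiIdx d b → ℝ, ∑ p, w p ^ 2 = 1 → ∑ p, |w p| ≤ A)
    (hδ : 2 * A * δ ≤ c * minEigenvalue b K / 16) {T : Finset (multiIdx d b → ℝ)}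
    (hT : ∀ w ∈ T, ∑ p, w p ^ 2 = 1)
    (hnet : ∀ w : multiIdx d b → ℝ, ∑ p, w p ^ 2 = 1 → ∃ w' ∈ T, ∑ p, |w p - w' p| ≤ δ) :
    flatSet b n ρ K x₀ c h u s ⊆
      (⋃ w ∈ T, {ω | ∑ i, curvTerm ρ K x₀ h u s w (ω i) ≤
        5 / 8 * (c * minEigenvalue b K) * (n * h ^ d)}) ∪
        {ω | 2 * (n * h ^ d) ≤ ∑ i, K (rescale x₀ h (ω i).1)} := by
  rintro ω ⟨w, hw, hflat⟩
  refine or_iff_not_imp_right.2 fun hk => ?_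
  obtain ⟨w', hw', hdist⟩ := hnet w hw
  refine Set.mem_iUnion₂.2 ⟨w', hw', ?_⟩
  have hq : 0 ≤ c * minEigenvalue b K / 16 := by
    have := hK.minEigenvalue_pos b
    positivity
  have hdiff : ∑ i, curvTerm ρ K x₀ h u s w' (ω i) - ∑ i, curvTerm ρ K x₀ h u s w (ω i)
      ≤ c * minEigenvalue b K / 16 * (2 * (n * h ^ d)) :=
    calc _ ≤ 2 * A * δ * ∑ i, K (rescale x₀ h (ω i).1) := by
          rw [← Finset.sum_sub_distrib, Finset.mul_sum]
          refine Finset.sum_le_sum fun i _ => (le_abs_self _).trans ?_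
          rw [abs_sub_comm]
          exact abs_curvTerm_sub_le hK hρ hs (hA w hw) (hA w' (hT w' hw')) hdist (ω i)
      _ ≤ c * minEigenvalue b K / 16 * (2 * (n * h ^ d)) :=
          mul_le_mul hδ (not_le.1 hk).le (Finset.sum_nonneg fun i _ => hK.nonneg _) hq
  simp only [Set.mem_ofPred_eq]
  linarith

/-- Chernoff bounds for the curvature at the points of a net of the sphere, together with the
Lipschitz continuity of the curvature, whose constant is an empirical mean of the kernel. -/
theorem exists_measure_flatSet_le (hK : IsKernel K) (b : ℕ) (hρ : IsContrast ρ g) {c : ℝ}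
    (hc : 0 < c) (hg : ∀ i, IsSymmDensity (g i))
    (hcurv : ∀ i, c ≤ ∫ z, deriv (deriv ρ) z * g i z) :
    ∃ η > 0, ∃ C₁ > 0, ∃ c₁ > 0, ∀ (n : ℕ) (x₀ : Fin d → ℝ) (h s : ℝ) (u : (Fin d → ℝ) → ℝ),
      0 < h → KernelFits K x₀ h → Measurable u →
      (∀ x, K (rescale x₀ h x) ≠ 0 → |u x| ≤ η) → 0 < s → s ≤ η →
      modelLaw d g n (flatSet b n ρ K x₀ c h u s)
        ≤ ENNReal.ofReal (C₁ * Real.exp (-(c₁ * (n * h ^ d)))) := by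
  obtain ⟨η₀, hη₀, hmono⟩ := hρ.exists_smoothScore_strongly_monotone hc hg hcurv
  set A : ℝ := √(multiIdx d b).card with hA
  have hA1 : 1 ≤ A := Real.one_le_sqrt.2
    (by exact_mod_cast Finset.card_pos.2 ⟨_, zero_mem_multiIdx d b⟩)
  have hAsum : ∀ w : multiIdx d b → ℝ, ∑ p, w p ^ 2 = 1 → ∑ p, |w p| ≤ A := fun w hw => by
    simpa only [Fintype.card_coe] using sum_abs_le_sqrt_card hw
  have hk := hK.one_le_supNorm
  set q := c * minEigenvalue b K with hq
  have hq0 : 0 < q := mul_pos hc (hK.minEigenvalue_pos b)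
  set t := min (1 / (A ^ 2 * supNorm K)) (q / 16 / (A ^ 4 * supNorm K))
  have ht0 : 0 < t := by positivity
  have htA : t * (A ^ 2 * supNorm K) ≤ 1 := (le_div_iff₀ (by positivity)).1 (min_le_left _ _)
  have htq : t * (A ^ 4 * supNorm K) ≤ q / 16 := (le_div_iff₀ (by positivity)).1 (min_le_right _ _)
  obtain ⟨T, hT, hnet⟩ := exists_sphere_net (multiIdx d b) (δ := q / (32 * A)) (by positivity)
  set c₁ := min (q * t / 16) (1 / (4 * supNorm K))
  refine ⟨η₀ / A, by positivity, T.card + 1, by positivity, c₁, by positivity, ?_⟩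
  intro n x₀ h s u hh hfit hu hε hs hsη
  have hexp : ∀ {a : ℝ}, c₁ ≤ a → ENNReal.ofReal (Real.exp (-(a * (n * h ^ d)))) ≤
      ENNReal.ofReal (Real.exp (-(c₁ * (n * h ^ d)))) := fun ha => by gcongr
  calc modelLaw d g n (flatSet b n ρ K x₀ c h u s)
      ≤ _ := measure_mono (flatSet_subset hK hρ hs hc hAsum (δ := q / (32 * A))
        (by rw [← hq]; field_simp; norm_num) hT hnet)
    _ ≤ _ := (measure_union_le _ _).trans (add_le_add_left (measure_biUnion_finset_le T _) _)
    _ ≤ ∑ _w ∈ T, ENNReal.ofReal (Real.exp (-(c₁ * (n * h ^ d)))) +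
          ENNReal.ofReal (Real.exp (-(c₁ * (n * h ^ d)))) :=
        add_le_add (Finset.sum_le_sum fun w hw => (measure_sum_curvTerm_le hK hρ hg hh hfit hu hc
            hmono (fun x hx => (hε x hx).trans (div_le_self hη₀.le hA1)) hs (hAsum w (hT w hw))
            (hT w hw) ((le_div_iff₀ (by positivity)).1 hsη) ht0.le htA htq).trans
            (hexp (min_le_left _ _)))
          ((measure_le_sum_kernel_le hK hg hh hfit).trans (hexp (min_le_right _ _)))
    _ = ENNReal.ofReal ((T.card + 1) * Real.exp (-(c₁ * (n * h ^ d)))) := by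
        rw [Finset.sum_const, ← ENNReal.ofReal_nsmul, ← ENNReal.ofReal_add (by positivity)
          (by positivity), nsmul_eq_mul, add_one_mul]

end Deviation

/-! ### The M-estimator on samples with good curvature -/

section Estimator

variable {d b n : ℕ} {K : (Fin d → ℝ) → ℝ} {x₀ : Fin d → ℝ} {h M : ℝ} {ρ : ℝ → ℝ}
  {g : ℕ → ℝ → ℝ}

/-- The error of the approximation of `f` by the local polynomial with coefficients `t`. -/
def approxError (f : (Fin d → ℝ) → ℝ) (x₀ : Fin d → ℝ) (h : ℝ)
    (t : multiIdx d b → ℝ) (x : Fin d → ℝ) : ℝ :=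
  (cube d).indicator f x - polyVal t (rescale x₀ h x)

theorem measurable_approxError {f : (Fin d → ℝ) → ℝ} (hf : ContinuousOn f (cube d))
    (t : multiIdx d b → ℝ) : Measurable (approxError f x₀ h t) := by
  classical
  have hpiece := hf.measurable_piecewise (g := 0) continuousOn_const measurableSet_Icc
  rw [Set.piecewise_eq_indicator] at hpiece
  exact hpiece.sub ((continuous_polyVal t).measurable.comp (measurable_rescale x₀ h))

theorem mem_nbhd_of_kernel_ne_zero (hK : IsKernel K) (hh : 0 < h) (hfit : KernelFits K x₀ h)
    {x : Fin d → ℝ} (hx : K (rescale x₀ h x) ≠ 0) : x ∈ nbhd x₀ h := by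
  have hbox := hK.support _ hx
  refine ⟨⟨fun j => ?_, fun j => ?_⟩, hfit x hx⟩
  · have hlow : -(1 / 2) ≤ (x j - x₀ j) / h := hbox.1 j
    rw [le_div_iff₀ hh] at hlow
    linarith
  · have hupp : (x j - x₀ j) / h ≤ 1 / 2 := hbox.2 j
    rw [div_le_iff₀ hh] at hupp
    linarith

theorem polyVal_add (t w : multiIdx d b → ℝ) (z : Fin d → ℝ) :
    polyVal (t + w) z = polyVal t z + polyVal w z := by
  simp only [polyVal, Pi.add_apply, add_mul, Finset.sum_add_distrib]

theorem polyVal_smul (s : ℝ) (w : multiIdx d b → ℝ) (z : Fin d → ℝ) :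
    polyVal (s • w) z = s * polyVal w z := by
  simp only [polyVal, Pi.smul_apply, smul_eq_mul, mul_assoc, Finset.mul_sum]

theorem criterion_observe (hK : IsKernel K) (hh : 0 < h) (hfit : KernelFits K x₀ h)
    (f : (Fin d → ℝ) → ℝ) (ω : Sample d n) (t w : multiIdx d b → ℝ) (s : ℝ) :
    criterion ρ K x₀ h (observe f ω) (t + s • w) = 1 / (n * h ^ d) *
      ∑ i, ρ ((ω i).2 + approxError f x₀ h t (ω i).1 - s * polyVal w (rescale x₀ h (ω i).1)) *
        K (rescale x₀ h (ω i).1) := by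
  unfold criterion
  congr 1
  refine Finset.sum_congr rfl fun i _ => ?_
  change ρ (f (ω i).1 + (ω i).2 - localPoly x₀ h _ (ω i).1) * K (rescale x₀ h (ω i).1) = _
  by_cases hx : K (rescale x₀ h (ω i).1) = 0
  · rw [hx, mul_zero, mul_zero]
  have hpoly : localPoly x₀ h (t + s • w) (ω i).1 = polyVal (t + s • w) (rescale x₀ h (ω i).1) :=
    Set.indicator_of_mem (mem_nbhd_of_kernel_ne_zero hK hh hfit hx) _
  rw [hpoly, polyVal_add, polyVal_smul, approxError, Set.indicator_of_mem (hfit _ hx)]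
  congr 2
  ring

theorem convex_paramSet (d b : ℕ) (M : ℝ) : Convex ℝ (paramSet d b M) := by
  intro t ht v hv a a' ha ha' haa'
  calc ∑ p, |a * t p + a' * v p| ≤ ∑ p, (a * |t p| + a' * |v p|) :=
        Finset.sum_le_sum fun p _ => (abs_add_le _ _).trans_eq (by
          rw [abs_mul, abs_mul, abs_of_nonneg ha, abs_of_nonneg ha'])
    _ = a * ∑ p, |t p| + a' * ∑ p, |v p| := by
        rw [Finset.sum_add_distrib, Finset.mul_sum, Finset.mul_sum]
    _ ≤ a * M + a' * M := by gcongr <;> assumption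
    _ = M := by rw [← add_mul, haa', one_mul]

theorem IsContrast.sum_deriv_nonneg (hρ : IsContrast ρ g) {ι : Type*} (I : Finset ι)
    {y a k : ι → ℝ} (hk : ∀ i, 0 ≤ k i) {s R : ℝ} (hsR : s < R)
    (hle : ∑ i ∈ I, ρ (y i - R * a i) * k i ≤ ∑ i ∈ I, ρ (y i - s * a i) * k i) :
    0 ≤ ∑ i ∈ I, deriv ρ (y i - s * a i) * a i * k i := by
  have hconv : ∑ i ∈ I, (ρ (y i - s * a i) * k i - (R - s) * (deriv ρ (y i - s * a i) * a i * k i))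
      ≤ ∑ i ∈ I, ρ (y i - R * a i) * k i := by
    refine Finset.sum_le_sum fun i _ => ?_
    have := mul_le_mul_of_nonneg_right
      (hρ.add_deriv_mul_le (y i - s * a i) (y i - R * a i)) (hk i)
    linarith
  rw [Finset.sum_sub_distrib, ← Finset.mul_sum] at hconv
  exact nonneg_of_mul_nonneg_right (by linarith) (sub_pos.2 hsR)

theorem sum_curvTerm_mul (u : (Fin d → ℝ) → ℝ) {s : ℝ} (hs : s ≠ 0) (w : multiIdx d b → ℝ)
    (ω : Sample d n) :
    (∑ i, curvTerm ρ K x₀ h u s w (ω i)) * s =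
      ∑ p, w p * ∑ i, scoreTerm ρ K x₀ h u p.1 (ω i) -
        ∑ i, deriv ρ ((ω i).2 + u (ω i).1 - s * polyVal w (rescale x₀ h (ω i).1)) *
          polyVal w (rescale x₀ h (ω i).1) * K (rescale x₀ h (ω i).1) := by
  have hscore : ∑ p, w p * ∑ i, scoreTerm ρ K x₀ h u p.1 (ω i) =
      ∑ i, deriv ρ ((ω i).2 + u (ω i).1) * polyVal w (rescale x₀ h (ω i).1) *
        K (rescale x₀ h (ω i).1) := by
    simp_rw [Finset.mul_sum]
    rw [Finset.sum_comm]
    refine Finset.sum_congr rfl fun i _ => ?_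
    simp only [polyVal, Finset.mul_sum, Finset.sum_mul, scoreTerm]
    exact Finset.sum_congr rfl fun p _ => by ring
  rw [hscore, ← Finset.sum_sub_distrib, Finset.sum_mul]
  refine Finset.sum_congr rfl fun i _ => ?_
  simp only [curvTerm, scoreQuotient]
  field_simp

theorem sum_mul_le_sqrt_card_mul_norm {ι : Type*} [Fintype ι] {w : ι → ℝ}
    (hw : ∑ p, w p ^ 2 = 1) (v : ι → ℝ) : ∑ p, w p * v p ≤ √(Fintype.card ι) * ‖v‖ :=
  calc ∑ p, w p * v p ≤ ∑ p, |w p| * ‖v‖ := Finset.sum_le_sum fun p _ =>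
        (le_abs_self _).trans ((abs_mul _ _).trans_le
          (mul_le_mul_of_nonneg_left (norm_le_pi_norm v p) (abs_nonneg _)))
    _ = (∑ p, |w p|) * ‖v‖ := by rw [Finset.sum_mul]
    _ ≤ √(Fintype.card ι) * ‖v‖ :=
        mul_le_mul_of_nonneg_right (sum_abs_le_sqrt_card hw) (norm_nonneg _)

theorem exists_eq_smul_of_sum_sq_pos {ι : Type*} [Fintype ι] {v : ι → ℝ}
    (hv : 0 < √(∑ p, v p ^ 2)) :
    ∃ w : ι → ℝ, ∑ p, w p ^ 2 = 1 ∧ v = √(∑ p, v p ^ 2) • w := by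
  refine ⟨(√(∑ p, v p ^ 2))⁻¹ • v, ?_, (smul_inv_smul₀ hv.ne' v).symm⟩
  simp only [Pi.smul_apply, smul_eq_mul, mul_pow, ← Finset.mul_sum, inv_pow]
  rw [Real.sq_sqrt (Real.sqrt_pos.1 hv).le, inv_mul_cancel₀ (Real.sqrt_pos.1 hv).ne']

/-- The sup-norm of the gradient of the criterion. -/
def gradNorm (b : ℕ) (ρ : ℝ → ℝ) (K : (Fin d → ℝ) → ℝ) (x₀ : Fin d → ℝ) (h : ℝ)
    (u : (Fin d → ℝ) → ℝ) (ω : Sample d n) : ℝ :=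
  scoreNorm b ρ K x₀ h u ω / (n * h ^ d)

theorem gradNorm_nonneg (hh : 0 < h) (u : (Fin d → ℝ) → ℝ) (ω : Sample d n) :
    0 ≤ gradNorm b ρ K x₀ h u ω :=
  div_nonneg (norm_nonneg _) (by positivity)

/-- By convexity the criterion does not increase from `t + s • w` to its minimiser `t + R • w`, so
between `t` and `t + s • w` its slope grows at most from the size of the gradient at `t` to `0`. -/
theorem curvature_mul_le_gradNorm (hK : IsKernel K) (hρ : IsContrast ρ g) (hn : 0 < n)
    (hh : 0 < h) (hfit : KernelFits K x₀ h) {c : ℝ} {θ : Sample d n → multiIdx d b → ℝ}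
    (hθ : IsLPAMinimizer ρ K x₀ M h θ) (f : (Fin d → ℝ) → ℝ) {t : multiIdx d b → ℝ}
    (ht : t ∈ paramSet d b M) {ω : Sample d n} {s : ℝ} (hs : 0 < s)
    (hsR : s < √(∑ p, (θ (observe f ω) - t) p ^ 2))
    (hω : ω ∉ flatSet b n ρ K x₀ c h (approxError f x₀ h t) s) :
    c * minEigenvalue b K / 2 * s ≤
      √(multiIdx d b).card * gradNorm b ρ K x₀ h (approxError f x₀ h t) ω := by
  set u := approxError f x₀ h t
  set R := √(∑ p, (θ (observe f ω) - t) p ^ 2)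
  have hR : 0 < R := hs.trans hsR
  have hN : (0 : ℝ) < n * h ^ d := by positivity
  obtain ⟨w, hw, hθw⟩ := exists_eq_smul_of_sum_sq_pos hR
  obtain ⟨hθmem, hθmin⟩ := hθ.2 (observe f ω)
  have hmem : t + s • w ∈ paramSet d b M := by
    have := (convex_paramSet d b M).add_smul_sub_mem ht hθmem
      ⟨(div_pos hs hR).le, (div_le_one hR).2 hsR.le⟩
    rwa [hθw, smul_smul, div_mul_cancel₀ _ hR.ne'] at this
  have hcrit := hθmin _ hmem
  rw [← add_sub_cancel t (θ (observe f ω)), hθw, criterion_observe hK hh hfit,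
    criterion_observe hK hh hfit] at hcrit
  have hslope := hρ.sum_deriv_nonneg _ (fun i => hK.nonneg _) hsR
    (le_of_mul_le_mul_left hcrit (by positivity))
  have hcurv : c * minEigenvalue b K / 2 * (n * h ^ d) ≤ ∑ i, curvTerm ρ K x₀ h u s w (ω i) :=
    not_lt.1 fun hlt => hω ⟨w, hw, hlt⟩
  have hscore := sum_mul_le_sqrt_card_mul_norm hw
    fun p : multiIdx d b => ∑ i, scoreTerm ρ K x₀ h u p.1 (ω i)
  rw [Fintype.card_coe] at hscore
  rw [gradNorm, mul_div_assoc', le_div_iff₀ hN, scoreNorm]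
  have := mul_le_mul_of_nonneg_right hcurv hs.le
  rw [sum_curvTerm_mul u hs.ne'] at this
  linarith

theorem abs_sub_zeroIdx_le (v t : multiIdx d b → ℝ) :
    |v (zeroIdx d b) - t (zeroIdx d b)| ≤ √(∑ p, (v - t) p ^ 2) :=
  Real.abs_le_sqrt (Finset.single_le_sum (f := fun p => (v - t) p ^ 2)
    (fun _ _ => sq_nonneg _) (Finset.mem_univ (zeroIdx d b)))

theorem sqrt_sum_sq_sub_le {v t : multiIdx d b → ℝ} (hv : v ∈ paramSet d b M)
    (ht : t ∈ paramSet d b M) : √(∑ p, (v - t) p ^ 2) ≤ 2 * M := by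
  have hsum : ∑ p, |(v - t) p| ≤ 2 * M :=
    calc ∑ p, |(v - t) p| ≤ ∑ p, (|v p| + |t p|) := Finset.sum_le_sum fun p _ => abs_sub _ _
      _ ≤ M + M := by
          rw [Finset.sum_add_distrib]
          exact add_le_add hv ht
      _ = 2 * M := by ring
  refine (Real.sqrt_le_iff.2 ⟨Finset.sum_nonneg fun _ _ => abs_nonneg _, ?_⟩).trans hsum
  simpa only [sq_abs] using
    Finset.sum_sq_le_sq_sum_of_nonneg fun p (_ : p ∈ Finset.univ) => abs_nonneg ((v - t) p)

theorem exists_two_pow_mul_lt {τ m : ℝ} (hτ : 0 < τ) (hm : τ < m) :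
    ∃ j : ℕ, 2 ^ j * τ < m ∧ m ≤ 2 * (2 ^ j * τ) := by
  have hx : 1 < m / τ := (one_lt_div hτ).2 hm
  obtain ⟨k, hlt, hle⟩ := exists_mem_Ioc_zpow (one_pos.trans hx) (one_lt_two (α := ℝ))
  have hk : 0 < k + 1 := (one_lt_zpow_iff_right₀ one_lt_two).1 (hx.trans_le hle)
  lift k to ℕ using by lia
  refine ⟨k, (lt_div_iff₀ hτ).1 (by exact_mod_cast hlt), ?_⟩
  rw [← mul_assoc, ← pow_succ']
  exact (div_le_iff₀ hτ).1 (by exact_mod_cast hle)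

variable {c τ η : ℝ} {θ : Sample d n → multiIdx d b → ℝ} {f : (Fin d → ℝ) → ℝ}
  {t : multiIdx d b → ℝ} {ω : Sample d n}

theorem mul_le_gradNorm_of_lt_abs_sub (hK : IsKernel K) (hρ : IsContrast ρ g) (hn : 0 < n)
    (hh : 0 < h) (hfit : KernelFits K x₀ h) (hθ : IsLPAMinimizer ρ K x₀ M h θ)
    (ht : t ∈ paramSet d b M) (hτ : 0 < τ)
    (hω : ω ∉ flatSet b n ρ K x₀ c h (approxError f x₀ h t) τ)
    (hlt : τ < |θ (observe f ω) (zeroIdx d b) - t (zeroIdx d b)|) :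
    c * minEigenvalue b K / 2 * τ ≤
      √(multiIdx d b).card * gradNorm b ρ K x₀ h (approxError f x₀ h t) ω :=
  curvature_mul_le_gradNorm hK hρ hn hh hfit hθ f ht hτ (hlt.trans_le (abs_sub_zeroIdx_le _ _)) hω

/-- The distance `R ≤ 2M` of the minimiser from `t` is compared with the largest dyadic radius
below `min R η`, hence the factor `1 + 2M/η`. -/
theorem abs_sub_le_add_gradNorm (hK : IsKernel K) (hρ : IsContrast ρ g) (hn : 0 < n)
    (hh : 0 < h) (hfit : KernelFits K x₀ h) (hc : 0 < c) (hM : 0 ≤ M)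
    (hθ : IsLPAMinimizer ρ K x₀ M h θ) (ht : t ∈ paramSet d b M) (hτ : 0 < τ) (hη : τ < η)
    (hω : ∀ j : ℕ, 2 ^ j * τ ≤ η →
      ω ∉ flatSet b n ρ K x₀ c h (approxError f x₀ h t) (2 ^ j * τ)) :
    |θ (observe f ω) (zeroIdx d b) - t (zeroIdx d b)| ≤ τ +
      4 * (1 + 2 * M / η) * √(multiIdx d b).card / (c * minEigenvalue b K) *
        gradNorm b ρ K x₀ h (approxError f x₀ h t) ω := by
  set W := gradNorm b ρ K x₀ h (approxError f x₀ h t) ω with hW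
  set R := √(∑ p, (θ (observe f ω) - t) p ^ 2) with hR
  have hη0 : 0 < η := hτ.trans hη
  have hW0 : 0 ≤ W := gradNorm_nonneg hh _ _
  have hq : 0 < c * minEigenvalue b K := mul_pos hc (hK.minEigenvalue_pos b)
  refine (abs_sub_zeroIdx_le _ t).trans ?_
  rcases le_or_gt R τ with hRτ | hRτ
  · exact hRτ.trans (le_add_of_nonneg_right (by positivity))
  obtain ⟨j, hj, hmj⟩ := exists_two_pow_mul_lt hτ (lt_min hRτ hη)
  have hgrad := curvature_mul_le_gradNorm hK hρ hn hh hfit hθ f ht (by positivity)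
    (hj.trans_le (min_le_left _ _)) (hω j (hj.trans_le (min_le_right _ _)).le)
  have hmin : min R η ≤ 4 * √(multiIdx d b).card * W / (c * minEigenvalue b K) := by
    rw [le_div_iff₀ hq]
    have := mul_le_mul_of_nonneg_right hmj hq.le
    linarith
  have hRmin : R ≤ min R η * (1 + 2 * M / η) := by
    rcases le_total R η with hle | hle
    · rw [min_eq_left hle]
      exact le_mul_of_one_le_right (Real.sqrt_nonneg _) (le_add_of_nonneg_right (by positivity))
    · rw [min_eq_right hle, mul_add, mul_div_cancel₀ _ hη0.ne']
      linarith [sqrt_sum_sq_sub_le (hθ.2 (observe f ω)).1 ht]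
  calc R ≤ 4 * √(multiIdx d b).card * W / (c * minEigenvalue b K) * (1 + 2 * M / η) :=
        hRmin.trans (mul_le_mul_of_nonneg_right hmin (by positivity))
    _ = 4 * (1 + 2 * M / η) * √(multiIdx d b).card / (c * minEigenvalue b K) * W := by ring
    _ ≤ _ := le_add_of_nonneg_left hτ.le

end Estimator

/-! ### Lepski's rule -/

section Lepski

theorem lepski_alternative {e S : ℕ → ℝ} {a C : ℝ} (hC : 0 ≤ C) {kL ks : ℕ} (hks : ks ≤ kL)
    (hS : Monotone S) (hS0 : 0 ≤ S ks) {k : ℕ}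
    (hk : k = sInf {k : ℕ | k ≤ kL ∧ ∀ l, k + 1 ≤ l → l ≤ kL → |e k - e l| ≤ C * S l}) :
    |e k - a| ≤ C * S ks + |e ks - a| ∨
      (ks < k ∧ k ≤ kL ∧ ∃ l, k ≤ l + 1 ∧ l ≤ kL ∧ ks ≤ l ∧ C / 2 * S l < |e l - a|) := by
  set admissible := {k : ℕ | k ≤ kL ∧ ∀ l, k + 1 ≤ l → l ≤ kL → |e k - e l| ≤ C * S l}
  have hmem : k ∈ admissible := hk ▸ Nat.sInf_mem ⟨kL, le_rfl, fun l hl hlL => by omega⟩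
  rcases le_or_gt k ks with hle | hlt
  · left
    rcases hle.eq_or_lt with rfl | hlt
    · linarith [mul_nonneg hC hS0]
    · linarith [hmem.2 ks hlt hks, abs_sub_le (e k) (e ks) a]
  · right
    have hkL : k ≤ kL := hmem.1
    have hpred : k - 1 ∉ admissible := Nat.notMem_of_lt_sInf (by omega)
    obtain ⟨l, hkl, hlL, hgap⟩ : ∃ l, k ≤ l ∧ l ≤ kL ∧ C * S l < |e (k - 1) - e l| := by
      by_contra! hcon
      exact hpred ⟨by omega, fun l hl hlL => hcon l (by omega) hlL⟩
    refine ⟨hlt, hkL, ?_⟩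
    by_cases hl : C / 2 * S l < |e l - a|
    · exact ⟨l, by omega, hlL, by omega, hl⟩
    · refine ⟨k - 1, by omega, by omega, by omega, ?_⟩
      have htri := abs_sub_le (e (k - 1)) a (e l)
      rw [abs_sub_comm a (e l)] at htri
      have hmono := mul_le_mul_of_nonneg_left (hS (show k - 1 ≤ l by omega))
        (show 0 ≤ C / 2 by positivity)
      linarith

theorem one_add_rpow_le_exp (q : ℝ) {y : ℝ} (hy : 0 ≤ y) :
    (1 + y) ^ q ≤ ⌈q⌉₊.factorial * Real.exp 1 * Real.exp y :=
  calc (1 + y) ^ q ≤ (1 + y) ^ (⌈q⌉₊ : ℝ) :=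
        Real.rpow_le_rpow_of_exponent_le (by linarith) (Nat.le_ceil q)
    _ = (1 + y) ^ ⌈q⌉₊ := Real.rpow_natCast _ _
    _ ≤ ⌈q⌉₊.factorial * Real.exp (1 + y) := by
        have := Real.pow_div_factorial_le_exp (1 + y) (by linarith) ⌈q⌉₊
        rw [div_le_iff₀ (by positivity)] at this
        linarith
    _ = ⌈q⌉₊.factorial * Real.exp 1 * Real.exp y := by rw [Real.exp_add]; ring

theorem le_mul_sq_add_inv {q : ℝ} (hq : 0 < q) {v : ℝ} (hv : 0 ≤ v) : v ≤ q * v ^ 2 + q⁻¹ := by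
  have hsq : q⁻¹ * (q * v - 1) ^ 2 = q * v ^ 2 - 2 * v + q⁻¹ := by field_simp; ring
  have : 0 ≤ q⁻¹ * (q * v - 1) ^ 2 := by positivity
  linarith

variable {Ω : Type*} [MeasurableSpace Ω] {μ : Measure Ω}

theorem lintegral_one_add_rpow_le (r : ℝ) {V : Ω → ℝ} (hV : Measurable V) (hV0 : ∀ ω, 0 ≤ V ω)
    {Q : ℝ} (hexp : ∫⁻ ω, ENNReal.ofReal (Real.exp (V ω)) ∂μ ≤ ENNReal.ofReal Q) :
    ∫⁻ ω, ENNReal.ofReal ((1 + V ω) ^ r) ∂μ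
      ≤ ENNReal.ofReal (⌈r⌉₊.factorial * Real.exp 1 * Q) := by
  set A : ℝ := ⌈r⌉₊.factorial * Real.exp 1
  have hA : 0 ≤ A := by positivity
  calc ∫⁻ ω, ENNReal.ofReal ((1 + V ω) ^ r) ∂μ
      ≤ ∫⁻ ω, ENNReal.ofReal A * ENNReal.ofReal (Real.exp (V ω)) ∂μ := by
        refine lintegral_mono fun ω => ?_
        rw [← ENNReal.ofReal_mul hA]
        exact ENNReal.ofReal_le_ofReal (one_add_rpow_le_exp r (hV0 ω))
    _ = ENNReal.ofReal A * ∫⁻ ω, ENNReal.ofReal (Real.exp (V ω)) ∂μ :=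
        lintegral_const_mul _ hV.exp.ennreal_ofReal
    _ ≤ ENNReal.ofReal A * ENNReal.ofReal Q := by gcongr
    _ = ENNReal.ofReal (A * Q) := (ENNReal.ofReal_mul hA).symm

/- Splitting `v = (1 + V) ^ r` as `v ≤ q v² + q⁻¹` replaces the Cauchy–Schwarz inequality, so that
the set `E` need not be measurable. -/
theorem setLIntegral_one_add_rpow_le (r : ℝ) {V : Ω → ℝ} (hV : Measurable V)
    (hV0 : ∀ ω, 0 ≤ V ω) {E : Set Ω} {q P Q : ℝ} (hq : 0 < q) (hP : 0 ≤ P) (hQ : 0 ≤ Q)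
    (hexp : ∫⁻ ω, ENNReal.ofReal (Real.exp (V ω)) ∂μ ≤ ENNReal.ofReal Q)
    (hE : μ E ≤ ENNReal.ofReal (P * q ^ 2)) :
    ∫⁻ ω in E, ENNReal.ofReal ((1 + V ω) ^ r) ∂μ
      ≤ ENNReal.ofReal ((⌈2 * r⌉₊.factorial * Real.exp 1 * Q + P) * q) := by
  have hpoint (ω : Ω) : ENNReal.ofReal ((1 + V ω) ^ r)
      ≤ ENNReal.ofReal q * ENNReal.ofReal ((1 + V ω) ^ (2 * r)) + ENNReal.ofReal q⁻¹ := by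
    have hv : 0 ≤ 1 + V ω := add_nonneg zero_le_one (hV0 ω)
    have hsq : (1 + V ω) ^ (2 * r) = ((1 + V ω) ^ r) ^ 2 := by
      rw [mul_comm, Real.rpow_mul hv, Real.rpow_two]
    rw [← ENNReal.ofReal_mul hq.le, ← ENNReal.ofReal_add (by positivity) (by positivity), hsq]
    exact ENNReal.ofReal_le_ofReal (le_mul_sq_add_inv hq (by positivity))
  have hmeas : Measurable fun ω => ENNReal.ofReal ((1 + V ω) ^ (2 * r)) :=
    ((measurable_const.add hV).pow_const _).ennreal_ofReal
  calc ∫⁻ ω in E, ENNReal.ofReal ((1 + V ω) ^ r) ∂μ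
      ≤ ∫⁻ ω in E, (ENNReal.ofReal q * ENNReal.ofReal ((1 + V ω) ^ (2 * r))
          + ENNReal.ofReal q⁻¹) ∂μ := lintegral_mono hpoint
    _ = ENNReal.ofReal q * ∫⁻ ω in E, ENNReal.ofReal ((1 + V ω) ^ (2 * r)) ∂μ
          + ENNReal.ofReal q⁻¹ * μ E := by
        rw [lintegral_add_right _ measurable_const, lintegral_const_mul _ hmeas, setLIntegral_const]
    _ ≤ ENNReal.ofReal q * ENNReal.ofReal (⌈2 * r⌉₊.factorial * Real.exp 1 * Q)
          + ENNReal.ofReal q⁻¹ * ENNReal.ofReal (P * q ^ 2) := by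
        gcongr
        exact (setLIntegral_le_lintegral _ _).trans
          (lintegral_one_add_rpow_le (2 * r) hV hV0 hexp)
    _ = ENNReal.ofReal ((⌈2 * r⌉₊.factorial * Real.exp 1 * Q + P) * q) := by
        rw [← ENNReal.ofReal_mul hq.le, ← ENNReal.ofReal_mul (by positivity),
          ← ENNReal.ofReal_add (by positivity) (by positivity)]
        congr 1
        field_simp

/-- The weight with which a failure of the `l`-th estimator enters the risk of Lepski's rule: there
are `l + 2` indices `k ≤ l + 1` to which it can lead, each estimator then has a standard deviation
inflated by at most `√((l + 2) 2^{(l + 1) d})`, and the failure has probability of order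
`2^{-2rdl}`. -/
def lepskiWeight (d : ℕ) (r : ℝ) (l : ℕ) : ℝ :=
  (l + 2) * (√((l + 2) * 2 ^ ((l + 1) * d)) ^ r * 2 ^ (-(r * d * l)))

theorem lepskiWeight_nonneg (d : ℕ) (r : ℝ) (l : ℕ) : 0 ≤ lepskiWeight d r l := by
  unfold lepskiWeight
  positivity

theorem summable_lepskiWeight {d : ℕ} (hd : 0 < d) {r : ℝ} (hr : 0 < r) :
    Summable (lepskiWeight d r) := by
  set m := ⌈r / 2⌉₊
  set z : ℝ := 2 ^ (-(r * d / 2))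
  have hz0 : 0 < z := by positivity
  have hz1 : z < 1 := Real.rpow_lt_one_of_one_lt_of_neg one_lt_two (by
    rw [neg_lt_zero]
    positivity)
  have hgeom : Summable fun l : ℕ => (l : ℝ) ^ (m + 1) * z ^ l :=
    summable_pow_mul_geometric_of_norm_lt_one (m + 1)
      (by rwa [Real.norm_eq_abs, abs_of_pos hz0])
  have hshift := ((summable_nat_add_iff 2).2 hgeom).mul_left ((2 : ℝ) ^ (r * d / 2) * z⁻¹ ^ 2)
  refine Summable.of_nonneg_of_le (lepskiWeight_nonneg d r) (fun l => ?_) hshift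
  have hsqrt : √((l + 2) * 2 ^ ((l + 1) * d)) ^ r
      = ((l : ℝ) + 2) ^ (r / 2) * 2 ^ ((l + 1) * d * (r / 2)) := by
    rw [← Real.rpow_div_two_eq_sqrt r (by positivity), Real.mul_rpow (by positivity)
      (by positivity), ← Real.rpow_natCast 2 ((l + 1) * d), ← Real.rpow_mul zero_le_two]
    push_cast
    rfl
  have hpow : (2 : ℝ) ^ ((l + 1) * d * (r / 2)) * 2 ^ (-(r * d * l))
      = 2 ^ (r * d / 2) * z ^ l := by
    rw [← Real.rpow_natCast z l, ← Real.rpow_mul zero_le_two, ← Real.rpow_add two_pos,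
      ← Real.rpow_add two_pos]
    ring_nf
  calc lepskiWeight d r l
      = (l + 2) * ((l + 2) ^ (r / 2) * (2 ^ (r * d / 2) * z ^ l)) := by
        rw [lepskiWeight, hsqrt, mul_assoc (_ ^ (r / 2)), hpow]
    _ ≤ (l + 2) * ((l + 2) ^ (m : ℝ) * (2 ^ (r * d / 2) * z ^ l)) := by
        gcongr
        · linarith [Nat.cast_nonneg (α := ℝ) l]
        · exact Nat.le_ceil _
    _ = 2 ^ (r * d / 2) * z⁻¹ ^ 2 * (((l + 2 : ℕ) : ℝ) ^ (m + 1) * z ^ (l + 2)) := by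
        rw [Real.rpow_natCast]
        push_cast
        field_simp
        ring

theorem setLIntegral_rpow_le_of_le_mul_one_add {r : ℝ} (hr : 0 ≤ r) {Z V : Ω → ℝ}
    (hZ : ∀ ω, 0 ≤ Z ω) (hV0 : ∀ ω, 0 ≤ V ω) (hV : Measurable V) {a : ℝ} (ha : 0 ≤ a) {T : Set Ω}
    (hT : ∀ ω ∈ T, Z ω ≤ a * (1 + V ω)) :
    ∫⁻ ω in T, ENNReal.ofReal (Z ω ^ r) ∂μ
      ≤ ENNReal.ofReal (a ^ r) * ∫⁻ ω in T, ENNReal.ofReal ((1 + V ω) ^ r) ∂μ := by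
  have hmeas : Measurable fun ω => ENNReal.ofReal ((1 + V ω) ^ r) :=
    ((measurable_const.add hV).pow_const _).ennreal_ofReal
  rw [← lintegral_const_mul _ hmeas]
  refine setLIntegral_mono (hmeas.const_mul _) fun ω hω => ?_
  rw [← ENNReal.ofReal_mul (by positivity),
    ← Real.mul_rpow ha (add_nonneg zero_le_one (hV0 ω))]
  exact ENNReal.ofReal_le_ofReal (Real.rpow_le_rpow (hZ ω) (hT ω hω) hr)

theorem setLIntegral_rpow_le_of_lintegral_exp_le {r : ℝ} (hr : 0 ≤ r) {Z V : Ω → ℝ}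
    (hZ : ∀ ω, 0 ≤ Z ω) (hV0 : ∀ ω, 0 ≤ V ω) (hV : Measurable V) {a Q : ℝ} (ha : 0 ≤ a)
    {T : Set Ω} (hT : ∀ ω ∈ T, Z ω ≤ a * (1 + V ω))
    (hexp : ∫⁻ ω, ENNReal.ofReal (Real.exp (V ω)) ∂μ ≤ ENNReal.ofReal Q) :
    ∫⁻ ω in T, ENNReal.ofReal (Z ω ^ r) ∂μ
      ≤ ENNReal.ofReal (a ^ r * (⌈r⌉₊.factorial * Real.exp 1 * Q)) :=
  calc ∫⁻ ω in T, ENNReal.ofReal (Z ω ^ r) ∂μ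
      ≤ ENNReal.ofReal (a ^ r) * ∫⁻ ω in T, ENNReal.ofReal ((1 + V ω) ^ r) ∂μ :=
        setLIntegral_rpow_le_of_le_mul_one_add hr hZ hV0 hV ha hT
    _ ≤ ENNReal.ofReal (a ^ r) * ENNReal.ofReal (⌈r⌉₊.factorial * Real.exp 1 * Q) := by
        gcongr
        exact (setLIntegral_le_lintegral _ _).trans (lintegral_one_add_rpow_le r hV hV0 hexp)
    _ = ENNReal.ofReal (a ^ r * (⌈r⌉₊.factorial * Real.exp 1 * Q)) :=
        (ENNReal.ofReal_mul (Real.rpow_nonneg ha r)).symm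

theorem setLIntegral_biUnion_finset_le {ι : Type*} (I : Finset ι) (T : ι → Set Ω)
    (F : Ω → ℝ≥0∞) : ∫⁻ ω in ⋃ i ∈ I, T i, F ω ∂μ ≤ ∑ i ∈ I, ∫⁻ ω in T i, F ω ∂μ := by
  classical
  induction I using Finset.induction_on with
  | empty => simp
  | insert i I hi ih =>
    rw [Finset.set_biUnion_insert, Finset.sum_insert hi]
    exact (lintegral_union_le _ _ _).trans (add_le_add_right ih _)

variable {d : ℕ} {r D P Q : ℝ} {kL ks : ℕ} {S : ℕ → ℝ} {V : ℕ → Ω → ℝ} {Z : Ω → ℝ}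
  {E : ℕ → Set Ω}

theorem setLIntegral_lepski_cell_le (hr : 0 ≤ r) (hD : 0 ≤ D) (hP : 0 ≤ P) (hQ : 0 ≤ Q)
    (hS : ∀ k, 0 ≤ S k) (hSk : ∀ k, S k ≤ S ks * √((1 + k) * 2 ^ (k * d)))
    (hV : ∀ k, Measurable (V k)) (hV0 : ∀ k ω, 0 ≤ V k ω) (hZ : ∀ ω, 0 ≤ Z ω) {k l : ℕ}
    (hkl : k ≤ l + 1)
    (hexp : ∫⁻ ω, ENNReal.ofReal (Real.exp (V k ω)) ∂μ ≤ ENNReal.ofReal Q)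
    (hE : μ (E l) ≤ ENNReal.ofReal (P * ((2 : ℝ) ^ (-(r * d * l))) ^ 2)) :
    ∫⁻ ω in {ω | ω ∈ E l ∧ Z ω ≤ D * S k * (1 + V k ω)}, ENNReal.ofReal (Z ω ^ r) ∂μ
      ≤ ENNReal.ofReal (D ^ r * (⌈2 * r⌉₊.factorial * Real.exp 1 * Q + P) * S ks ^ r *
          (√((l + 2) * 2 ^ ((l + 1) * d)) ^ r * 2 ^ (-(r * d * l)))) := by
  set q : ℝ := 2 ^ (-(r * d * l))
  set s : ℝ := √((l + 2) * 2 ^ ((l + 1) * d))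
  set B : ℝ := ⌈2 * r⌉₊.factorial * Real.exp 1 * Q + P
  have hDS : 0 ≤ D * S k := mul_nonneg hD (hS k)
  have hkl' : (k : ℝ) ≤ l + 1 := by exact_mod_cast hkl
  have hS_le : S k ≤ S ks * s := by
    refine (hSk k).trans (mul_le_mul_of_nonneg_left (Real.sqrt_le_sqrt ?_) (hS ks))
    gcongr ?_ * ?_
    · linarith
    · exact pow_le_pow_right₀ one_le_two (Nat.mul_le_mul_right d hkl)
  calc ∫⁻ ω in {ω | ω ∈ E l ∧ Z ω ≤ D * S k * (1 + V k ω)}, ENNReal.ofReal (Z ω ^ r) ∂μ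
      ≤ ENNReal.ofReal ((D * S k) ^ r) *
          ∫⁻ ω in {ω | ω ∈ E l ∧ Z ω ≤ D * S k * (1 + V k ω)},
            ENNReal.ofReal ((1 + V k ω) ^ r) ∂μ :=
        setLIntegral_rpow_le_of_le_mul_one_add hr hZ (hV0 k) (hV k) hDS fun ω hω => hω.2
    _ ≤ ENNReal.ofReal ((D * S k) ^ r) * ENNReal.ofReal (B * q) := by
        gcongr
        exact setLIntegral_one_add_rpow_le r (hV k) (hV0 k) (by positivity) hP hQ hexp
          ((measure_mono fun ω hω => hω.1).trans hE)
    _ = ENNReal.ofReal ((D * S k) ^ r * (B * q)) := (ENNReal.ofReal_mul (by positivity)).symm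
    _ ≤ ENNReal.ofReal (D ^ r * (S ks ^ r * s ^ r) * (B * q)) := by
        have hSks := hS ks
        rw [← Real.mul_rpow hSks (Real.sqrt_nonneg _), ← Real.mul_rpow hD (by positivity)]
        gcongr
    _ = ENNReal.ofReal (D ^ r * B * S ks ^ r * (s ^ r * q)) := by ring_nf

theorem sum_setLIntegral_lepski_cell_le (hr : 0 ≤ r) (hD : 0 ≤ D) (hP : 0 ≤ P) (hQ : 0 ≤ Q)
    (hS : ∀ k, 0 ≤ S k) (hSk : ∀ k, S k ≤ S ks * √((1 + k) * 2 ^ (k * d)))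
    (hV : ∀ k, Measurable (V k)) (hV0 : ∀ k ω, 0 ≤ V k ω) (hZ : ∀ ω, 0 ≤ Z ω) {l : ℕ}
    {I : Finset ℕ} (hI : I ⊆ Finset.range (l + 2))
    (hexp : ∀ k ∈ I, ∫⁻ ω, ENNReal.ofReal (Real.exp (V k ω)) ∂μ ≤ ENNReal.ofReal Q)
    (hE : μ (E l) ≤ ENNReal.ofReal (P * ((2 : ℝ) ^ (-(r * d * l))) ^ 2)) :
    ∑ k ∈ I, ∫⁻ ω in {ω | ω ∈ E l ∧ Z ω ≤ D * S k * (1 + V k ω)}, ENNReal.ofReal (Z ω ^ r) ∂μ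
      ≤ ENNReal.ofReal (D ^ r * (⌈2 * r⌉₊.factorial * Real.exp 1 * Q + P) * S ks ^ r *
          lepskiWeight d r l) := by
  set a : ℝ := D ^ r * (⌈2 * r⌉₊.factorial * Real.exp 1 * Q + P) * S ks ^ r
  set w : ℝ := √((l + 2) * 2 ^ ((l + 1) * d)) ^ r * 2 ^ (-(r * d * l))
  have haw : 0 ≤ a * w :=
    mul_nonneg (mul_nonneg (by positivity) (Real.rpow_nonneg (hS ks) r)) (by positivity)
  have hcard : (I.card : ℝ) ≤ l + 2 := by
    exact_mod_cast (Finset.card_le_card hI).trans_eq (Finset.card_range _)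
  calc ∑ k ∈ I, ∫⁻ ω in {ω | ω ∈ E l ∧ Z ω ≤ D * S k * (1 + V k ω)}, ENNReal.ofReal (Z ω ^ r) ∂μ
      ≤ ∑ _k ∈ I, ENNReal.ofReal (a * w) := Finset.sum_le_sum fun k hk =>
        setLIntegral_lepski_cell_le hr hD hP hQ hS hSk hV hV0 hZ
          (Nat.lt_succ_iff.1 (Finset.mem_range.1 (hI hk))) (hexp k hk) hE
    _ = ENNReal.ofReal (I.card * (a * w)) := by
        rw [Finset.sum_const, nsmul_eq_mul, ← ENNReal.ofReal_natCast,
          ← ENNReal.ofReal_mul (Nat.cast_nonneg _)]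
    _ ≤ ENNReal.ofReal ((l + 2) * (a * w)) := by gcongr
    _ = ENNReal.ofReal (a * lepskiWeight d r l) := by
        rw [lepskiWeight, mul_left_comm]

theorem setLIntegral_biUnion_lepski_cell_le (hd : 0 < d) (hr : 0 < r) (hD : 0 ≤ D) (hP : 0 ≤ P)
    (hQ : 0 ≤ Q) (hS : ∀ k, 0 ≤ S k) (hSk : ∀ k, S k ≤ S ks * √((1 + k) * 2 ^ (k * d)))
    (hV : ∀ k, Measurable (V k)) (hV0 : ∀ k ω, 0 ≤ V k ω) (hZ : ∀ ω, 0 ≤ Z ω) {J : Finset ℕ}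
    {I : ℕ → Finset ℕ} (hI : ∀ l ∈ J, I l ⊆ Finset.range (l + 2))
    (hexp : ∀ l ∈ J, ∀ k ∈ I l,
      ∫⁻ ω, ENNReal.ofReal (Real.exp (V k ω)) ∂μ ≤ ENNReal.ofReal Q)
    (hE : ∀ l ∈ J, μ (E l) ≤ ENNReal.ofReal (P * ((2 : ℝ) ^ (-(r * d * l))) ^ 2)) :
    ∫⁻ ω in ⋃ l ∈ J, ⋃ k ∈ I l, {ω | ω ∈ E l ∧ Z ω ≤ D * S k * (1 + V k ω)},
        ENNReal.ofReal (Z ω ^ r) ∂μ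
      ≤ ENNReal.ofReal (D ^ r * (⌈2 * r⌉₊.factorial * Real.exp 1 * Q + P) * S ks ^ r *
          ∑' l, lepskiWeight d r l) := by
  set a : ℝ := D ^ r * (⌈2 * r⌉₊.factorial * Real.exp 1 * Q + P) * S ks ^ r
  have ha : 0 ≤ a := mul_nonneg (by positivity) (Real.rpow_nonneg (hS ks) r)
  calc ∫⁻ ω in ⋃ l ∈ J, ⋃ k ∈ I l, {ω | ω ∈ E l ∧ Z ω ≤ D * S k * (1 + V k ω)},
        ENNReal.ofReal (Z ω ^ r) ∂μ
      ≤ ∑ l ∈ J, ∑ k ∈ I l, ∫⁻ ω in {ω | ω ∈ E l ∧ Z ω ≤ D * S k * (1 + V k ω)},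
          ENNReal.ofReal (Z ω ^ r) ∂μ :=
        (setLIntegral_biUnion_finset_le _ _ _).trans
          (Finset.sum_le_sum fun l _ => setLIntegral_biUnion_finset_le _ _ _)
    _ ≤ ∑ l ∈ J, ENNReal.ofReal (a * lepskiWeight d r l) := Finset.sum_le_sum fun l hl =>
        sum_setLIntegral_lepski_cell_le hr.le hD hP hQ hS hSk hV hV0 hZ (hI l hl) (hexp l hl)
          (hE l hl)
    _ = ENNReal.ofReal (∑ l ∈ J, a * lepskiWeight d r l) :=
        (ENNReal.ofReal_sum_of_nonneg fun l _ => mul_nonneg ha (lepskiWeight_nonneg d r l)).symm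
    _ ≤ ENNReal.ofReal (a * ∑' l, lepskiWeight d r l) := by
        rw [← Finset.mul_sum]
        gcongr
        exact (summable_lepskiWeight hd hr).sum_le_tsum _ fun l _ => lepskiWeight_nonneg d r l

theorem lintegral_rpow_le_of_lepski_alternative (hd : 0 < d) (hr : 0 < r) (hD : 0 ≤ D)
    (hP : 0 ≤ P) (hQ : 0 ≤ Q) (hks : ks ≤ kL) (hS : ∀ k, 0 ≤ S k)
    (hSk : ∀ k, S k ≤ S ks * √((1 + k) * 2 ^ (k * d)))
    (hV : ∀ k, Measurable (V k)) (hV0 : ∀ k ω, 0 ≤ V k ω)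
    {M : ℝ} (hZ : ∀ ω, 0 ≤ Z ω) (hZM : ∀ ω, Z ω ≤ M) {bad : Set Ω}
    (hexp : ∀ k, ks ≤ k → k ≤ kL →
      ∫⁻ ω, ENNReal.ofReal (Real.exp (V k ω)) ∂μ ≤ ENNReal.ofReal Q)
    (hE : ∀ l, ks ≤ l → l ≤ kL →
      μ (E l) ≤ ENNReal.ofReal (P * ((2 : ℝ) ^ (-(r * d * l))) ^ 2))
    (halt : ∀ ω ∉ bad, Z ω ≤ D * S ks * (1 + V ks ω) ∨ ∃ k l, ks < k ∧ k ≤ kL ∧ k ≤ l + 1 ∧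
      ks ≤ l ∧ l ≤ kL ∧ ω ∈ E l ∧ Z ω ≤ D * S k * (1 + V k ω)) :
    ∫⁻ ω, ENNReal.ofReal (Z ω ^ r) ∂μ
      ≤ ENNReal.ofReal (D ^ r * (⌈r⌉₊.factorial * Real.exp 1 * Q +
          (⌈2 * r⌉₊.factorial * Real.exp 1 * Q + P) * ∑' l, lepskiWeight d r l) * S ks ^ r)
        + ENNReal.ofReal (M ^ r) * μ bad := by
  set A : ℝ := ⌈r⌉₊.factorial * Real.exp 1
  set B : ℝ := ⌈2 * r⌉₊.factorial * Real.exp 1 * Q + P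
  set F : Ω → ℝ≥0∞ := fun ω => ENNReal.ofReal (Z ω ^ r)
  set oracle := {ω | Z ω ≤ D * S ks * (1 + V ks ω)}
  set I : ℕ → Finset ℕ := fun l => {k ∈ Finset.range (l + 2) | ks < k ∧ k ≤ kL}
  set failure := ⋃ l ∈ Finset.Icc ks kL, ⋃ k ∈ I l, {ω | ω ∈ E l ∧ Z ω ≤ D * S k * (1 + V k ω)}
  have hcover : Set.univ ⊆ (oracle ∪ failure) ∪ bad := by
    intro ω _
    by_cases hω : ω ∈ bad
    · exact Or.inr hω
    refine Or.inl ((halt ω hω).imp id ?_)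
    rintro ⟨k, l, hk, hkL, hkl, hl, hlL, hωE, hZ_le⟩
    refine Set.mem_biUnion (Finset.mem_Icc.2 ⟨hl, hlL⟩)
      (Set.mem_biUnion (x := k) ?_ ⟨hωE, hZ_le⟩)
    exact Finset.mem_filter.2 ⟨Finset.mem_range.2 (by omega), hk, hkL⟩
  have horacle : ∫⁻ ω in oracle, F ω ∂μ ≤ ENNReal.ofReal ((D * S ks) ^ r * (A * Q)) :=
    setLIntegral_rpow_le_of_lintegral_exp_le hr.le hZ (hV0 ks) (hV ks) (mul_nonneg hD (hS ks))
      (fun ω hω => hω) (hexp ks le_rfl hks)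
  have hfailure : ∫⁻ ω in failure, F ω ∂μ
      ≤ ENNReal.ofReal (D ^ r * B * S ks ^ r * ∑' l, lepskiWeight d r l) := by
    refine setLIntegral_biUnion_lepski_cell_le hd hr hD hP hQ hS hSk hV hV0 hZ
      (fun l _ => Finset.filter_subset _ _) (fun l _ k hk => ?_)
      fun l hl => hE l (Finset.mem_Icc.1 hl).1 (Finset.mem_Icc.1 hl).2
    obtain ⟨-, hk, hkL⟩ := Finset.mem_filter.1 hk
    exact hexp k hk.le hkL
  have hbad : ∫⁻ ω in bad, F ω ∂μ ≤ ENNReal.ofReal (M ^ r) * μ bad := by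
    rw [← setLIntegral_const]
    exact lintegral_mono fun ω => ENNReal.ofReal_le_ofReal
      (Real.rpow_le_rpow (hZ ω) (hZM ω) hr.le)
  calc ∫⁻ ω, F ω ∂μ ≤ ∫⁻ ω in (oracle ∪ failure) ∪ bad, F ω ∂μ := by
        rw [← setLIntegral_univ]
        exact lintegral_mono_set hcover
    _ ≤ ENNReal.ofReal ((D * S ks) ^ r * (A * Q))
          + ENNReal.ofReal (D ^ r * B * S ks ^ r * ∑' l, lepskiWeight d r l)
          + ENNReal.ofReal (M ^ r) * μ bad :=
        (lintegral_union_le _ _ _).trans (add_le_add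
          ((lintegral_union_le _ _ _).trans (add_le_add horacle hfailure)) hbad)
    _ = _ := by
        have hSr : 0 ≤ S ks ^ r := Real.rpow_nonneg (hS ks) r
        have hsum : 0 ≤ ∑' l, lepskiWeight d r l := tsum_nonneg (lepskiWeight_nonneg d r)
        rw [Real.mul_rpow hD (hS ks), ← ENNReal.ofReal_add (by positivity) (by positivity)]
        congr 2
        ring

end Lepski

/-! ### Bandwidths and rates -/

section Rates

variable {d b n : ℕ}

theorem hMax_pos (d b : ℕ) (hn : 0 < n) : 0 < hMax d b n :=
  Real.rpow_pos_of_pos (by exact_mod_cast hn) _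

theorem hMax_le_one (d b : ℕ) (hn : 0 < n) : hMax d b n ≤ 1 :=
  Real.rpow_le_one_of_one_le_of_nonpos (by exact_mod_cast hn) (by
    rw [neg_nonpos]; positivity)

theorem bandwidth_pos (d b : ℕ) (hn : 0 < n) (k : ℕ) : 0 < bandwidth d b n k :=
  div_pos (hMax_pos d b hn) (by positivity)

theorem bandwidth_anti (d b n : ℕ) : Antitone (bandwidth d b n) := by
  intro k l hkl
  unfold bandwidth
  have hmax : 0 ≤ hMax d b n := Real.rpow_nonneg (Nat.cast_nonneg n) _
  exact div_le_div_of_nonneg_left hmax (by positivity) (pow_le_pow_right₀ one_le_two hkl)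

theorem bandwidth_le_hMax (d b n k : ℕ) : bandwidth d b n k ≤ hMax d b n := by
  have := bandwidth_anti d b n (Nat.zero_le k)
  simpa [bandwidth] using this

theorem bandwidth_le_one (d b : ℕ) (hn : 0 < n) (k : ℕ) : bandwidth d b n k ≤ 1 :=
  (bandwidth_le_hMax d b n k).trans (hMax_le_one d b hn)

theorem one_le_one_add_mul_log (k : ℕ) : 1 ≤ 1 + (k : ℝ) * Real.log 2 := by
  have := mul_nonneg (Nat.cast_nonneg (α := ℝ) k) (Real.log_nonneg one_le_two)
  linarith

theorem stdBound_pos (d b : ℕ) (hn : 0 < n) (k : ℕ) : 0 < stdBound d b n k := by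
  have hbw := bandwidth_pos d b hn k
  have hlog := one_le_one_add_mul_log k
  exact Real.sqrt_pos.2 (div_pos (by linarith) (by positivity))

theorem stdBound_sq (d b : ℕ) (hn : 0 < n) (k : ℕ) :
    stdBound d b n k ^ 2 = (1 + k * Real.log 2) / (n * bandwidth d b n k ^ d) := by
  have hbw := bandwidth_pos d b hn k
  have hlog := one_le_one_add_mul_log k
  exact Real.sq_sqrt (div_nonneg (by linarith) (by positivity))

theorem stdBound_mono (d b : ℕ) (hn : 0 < n) : Monotone (stdBound d b n) := by
  intro k l hkl
  refine Real.sqrt_le_sqrt ?_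
  have hbw := bandwidth_pos d b hn l
  have hanti := bandwidth_anti d b n hkl
  gcongr

theorem stdBound_le_mul (d b : ℕ) (hn : 0 < n) (ks k : ℕ) :
    stdBound d b n k ≤ stdBound d b n ks * √((1 + k) * 2 ^ (k * d)) := by
  have hm := hMax_pos d b hn
  have hks : 1 / (n * hMax d b n ^ d) ≤ stdBound d b n ks ^ 2 := by
    rw [stdBound_sq d b hn]
    have hbw := bandwidth_pos d b hn ks
    have hle := bandwidth_le_hMax d b n ks
    have hnum := one_le_one_add_mul_log ks
    gcongr
  refine Real.sqrt_le_iff.2 ⟨mul_nonneg (stdBound_pos d b hn ks).le (Real.sqrt_nonneg _), ?_⟩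
  rw [mul_pow, Real.sq_sqrt (by positivity)]
  have hlog : Real.log 2 ≤ 1 := by linarith [Real.log_two_lt_d9]
  calc (1 + k * Real.log 2) / (n * bandwidth d b n k ^ d)
      = 1 / (n * hMax d b n ^ d) * ((1 + k * Real.log 2) * 2 ^ (k * d)) := by
        unfold bandwidth
        rw [div_pow, ← pow_mul]
        have : (0 : ℝ) < n := by exact_mod_cast hn
        field_simp
    _ ≤ stdBound d b n ks ^ 2 * ((1 + k) * 2 ^ (k * d)) := by
        have hle : 1 + (k : ℝ) * Real.log 2 ≤ 1 + k := by nlinarith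
        gcongr

theorem one_div_le_stdBound (d b : ℕ) (hn : 0 < n) (k : ℕ) : 1 / (n : ℝ) ≤ stdBound d b n k := by
  have hn1 : (1 : ℝ) ≤ n := by exact_mod_cast hn
  refine Real.le_sqrt_of_sq_le ?_
  have hbw := bandwidth_pos d b hn k
  have hpow := pow_le_one₀ hbw.le (bandwidth_le_one d b hn k) (n := d)
  have hnum := one_le_one_add_mul_log k
  have hden : (n : ℝ) * bandwidth d b n k ^ d ≤ n ^ 2 := by nlinarith
  rw [div_pow, one_pow]
  gcongr

theorem hMin_pow (hd : 0 < d) (hn : 1 ≤ n) : hMin d n ^ d = Real.log n ^ 2 / n := by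
  have hl : 0 ≤ Real.log n := Real.log_natCast_nonneg n
  have hn0 : (0 : ℝ) < n := by exact_mod_cast hn
  have hd0 : (d : ℝ) ≠ 0 := by positivity
  unfold hMin
  rw [mul_pow, ← Real.rpow_natCast, ← Real.rpow_natCast, ← Real.rpow_mul hl,
    ← Real.rpow_mul hn0.le, div_mul_cancel₀ _ hd0, neg_mul, one_div_mul_cancel hd0,
    Real.rpow_neg_one, Real.rpow_two, div_eq_mul_inv]

theorem one_div_le_hMin (hd : 0 < d) (hn : 1 ≤ n) (hlog : 1 ≤ Real.log n) :
    1 / (n : ℝ) ≤ hMin d n := by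
  have hn1 : (1 : ℝ) ≤ n := by exact_mod_cast hn
  have hd1 : (1 : ℝ) ≤ d := by exact_mod_cast hd
  have hlog_rpow : (1 : ℝ) ≤ Real.log n ^ (2 / d : ℝ) := Real.one_le_rpow hlog (by positivity)
  have hn_rpow : (n : ℝ) ^ (-1 : ℝ) ≤ (n : ℝ) ^ (-(1 / d) : ℝ) := by
    refine Real.rpow_le_rpow_of_exponent_le hn1 (neg_le_neg ?_)
    rw [div_le_one (by linarith)]
    exact hd1
  rw [Real.rpow_neg_one, ← one_div] at hn_rpow
  exact hn_rpow.trans (le_mul_of_one_le_left (by positivity) hlog_rpow)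

theorem two_pow_le_of_hMin_le_bandwidth (hd : 0 < d) (hn : 1 ≤ n) (hlog : 1 ≤ Real.log n) {k : ℕ}
    (hk : hMin d n ≤ bandwidth d b n k) : (2 : ℝ) ^ k ≤ n := by
  have hn0 : (0 : ℝ) < n := by exact_mod_cast hn
  have hle : 1 / (n : ℝ) ≤ 1 / 2 ^ k :=
    calc 1 / (n : ℝ) ≤ bandwidth d b n k := (one_div_le_hMin hd hn hlog).trans hk
      _ ≤ 1 / 2 ^ k := div_le_div_of_nonneg_right (hMax_le_one d b hn) (by positivity)
  exact (one_div_le_one_div hn0 (by positivity)).1 hle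

theorem bddAbove_setOf_hMin_le_bandwidth (hd : 0 < d) (hn : 1 ≤ n) (hlog : 1 ≤ Real.log n)
    (b : ℕ) : BddAbove {k : ℕ | hMin d n ≤ bandwidth d b n k} := by
  refine ⟨n, fun k hk => ?_⟩
  have hpow : 2 ^ k ≤ n := by exact_mod_cast two_pow_le_of_hMin_le_bandwidth hd hn hlog hk
  exact Nat.lt_two_pow_self.le.trans hpow

theorem le_kLast (hd : 0 < d) (hn : 1 ≤ n) (hlog : 1 ≤ Real.log n) {k : ℕ}
    (hk : hMin d n ≤ bandwidth d b n k) : k ≤ kLast d b n :=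
  le_csSup (bddAbove_setOf_hMin_le_bandwidth hd hn hlog b) hk

theorem hMin_le_bandwidth_of_le_kLast (hd : 0 < d) (hn : 1 ≤ n) (hlog : 1 ≤ Real.log n) {k l : ℕ}
    (hk : hMin d n ≤ bandwidth d b n k) (hl : l ≤ kLast d b n) :
    hMin d n ≤ bandwidth d b n l := by
  have hmem : hMin d n ≤ bandwidth d b n (kLast d b n) :=
    Nat.sSup_mem ⟨k, hk⟩ (bddAbove_setOf_hMin_le_bandwidth hd hn hlog b)
  exact hmem.trans (bandwidth_anti d b n hl)

theorem log_sq_le_mul_bandwidth_pow (hd : 0 < d) (hn : 1 ≤ n) {k : ℕ}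
    (hk : hMin d n ≤ bandwidth d b n k) : Real.log n ^ 2 ≤ n * bandwidth d b n k ^ d := by
  have hn0 : (0 : ℝ) < n := by exact_mod_cast hn
  have hmin : 0 ≤ hMin d n :=
    mul_nonneg (Real.rpow_nonneg (Real.log_natCast_nonneg n) _) (by positivity)
  have hpow := pow_le_pow_left₀ hmin hk d
  rwa [hMin_pow hd hn, div_le_iff₀' hn0] at hpow

theorem stdBound_sq_le (hd : 0 < d) (hn : 1 ≤ n) (hlog : 1 ≤ Real.log n) {k : ℕ}
    (hk : hMin d n ≤ bandwidth d b n k) : stdBound d b n k ^ 2 ≤ 2 / Real.log n := by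
  have hklog : k * Real.log 2 ≤ Real.log n := by
    rw [← Real.log_pow]
    exact Real.log_le_log (by positivity) (two_pow_le_of_hMin_le_bandwidth hd hn hlog hk)
  have : 0 < Real.log n := one_pos.trans_le hlog
  rw [stdBound_sq d b hn]
  calc (1 + k * Real.log 2) / (n * bandwidth d b n k ^ d)
      ≤ 2 * Real.log n / Real.log n ^ 2 := by
        gcongr
        · linarith
        · exact log_sq_le_mul_bandwidth_pow hd hn hk
    _ = 2 / Real.log n := by field_simp

/-- The bandwidth `(ϱ_n(β) / n)^{1 / (2β + d)}` at which bias and standard deviation balance. -/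
def oracleBandwidth (d b n : ℕ) (β : ℝ) : ℝ := (adaptPrice d b n β / n) ^ (1 / (2 * β + d))

theorem one_le_adaptPrice (d n : ℕ) {β : ℝ} (hβ : 0 ≤ β) (hβb : β ≤ b) :
    1 ≤ adaptPrice d b n β :=
  le_add_of_nonneg_right (mul_nonneg (div_nonneg (by linarith) (by positivity))
    (Real.log_natCast_nonneg n))

theorem adaptPrice_div_pos (d : ℕ) (hn : 0 < n) {β : ℝ} (hβ : 0 ≤ β) (hβb : β ≤ b) :
    0 < adaptPrice d b n β / n :=
  div_pos (one_pos.trans_le (one_le_adaptPrice d n hβ hβb)) (by exact_mod_cast hn)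

theorem oracleBandwidth_pos (d : ℕ) (hn : 0 < n) {β : ℝ} (hβ : 0 ≤ β) (hβb : β ≤ b) :
    0 < oracleBandwidth d b n β :=
  Real.rpow_pos_of_pos (adaptPrice_div_pos d hn hβ hβb) _

theorem oracleBandwidth_rpow (d : ℕ) (hn : 0 < n) {β : ℝ} (hβ : 0 < β) (hβb : β ≤ b) :
    oracleBandwidth d b n β ^ (2 * β + d) = adaptPrice d b n β / n := by
  rw [oracleBandwidth, ← Real.rpow_mul (adaptPrice_div_pos d hn hβ.le hβb).le,
    one_div_mul_cancel (by positivity), Real.rpow_one]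

theorem sq_rpow_mul_pow {h : ℝ} (hh : 0 < h) (β : ℝ) (d : ℕ) :
    (h ^ β) ^ 2 * h ^ d = h ^ (2 * β + d) := by
  rw [Real.rpow_add hh, Real.rpow_natCast, mul_comm 2 β, Real.rpow_mul hh.le, Real.rpow_two]

theorem rate_eq_oracleBandwidth_rpow (d : ℕ) (hn : 0 < n) {β : ℝ} (hβ : 0 ≤ β) (hβb : β ≤ b) :
    rate d b n β = oracleBandwidth d b n β ^ β := by
  rw [rate, oracleBandwidth, ← Real.rpow_mul (adaptPrice_div_pos d hn hβ hβb).le]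
  ring_nf

theorem rate_sq_mul (d : ℕ) (hn : 0 < n) {β : ℝ} (hβ : 0 < β) (hβb : β ≤ b) :
    rate d b n β ^ 2 * (n * oracleBandwidth d b n β ^ d) = adaptPrice d b n β := by
  have hn0 : (n : ℝ) ≠ 0 := by exact_mod_cast hn.ne'
  rw [rate_eq_oracleBandwidth_rpow d hn hβ.le hβb, mul_left_comm,
    sq_rpow_mul_pow (oracleBandwidth_pos d hn hβ.le hβb), oracleBandwidth_rpow d hn hβ hβb,
    mul_div_cancel₀ _ hn0]

theorem log_hMax_sub_log_oracleBandwidth (d : ℕ) (hn : 0 < n) {β : ℝ} (hβ : 0 < β)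
    (hβb : β ≤ b) : Real.log (hMax d b n) - Real.log (oracleBandwidth d b n β)
      = adaptPrice d b n β - 1 - Real.log (adaptPrice d b n β) / (2 * β + d) := by
  have hn0 : (0 : ℝ) < n := by exact_mod_cast hn
  have hb : (0 : ℝ) < b := hβ.trans_le hβb
  rw [oracleBandwidth, Real.log_rpow (adaptPrice_div_pos d hn hβ.le hβb),
    Real.log_div (one_pos.trans_le (one_le_adaptPrice d n hβ.le hβb)).ne' hn0.ne', hMax,
    Real.log_rpow hn0]
  nth_rewrite 2 [adaptPrice]
  field_simp
  ring

theorem log_hMax_sub_log_oracleBandwidth_le (d : ℕ) (hn : 0 < n) {β : ℝ} (hβ : 0 < β)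
    (hβb : β ≤ b) :
    Real.log (hMax d b n) - Real.log (oracleBandwidth d b n β) ≤ adaptPrice d b n β - 1 := by
  rw [log_hMax_sub_log_oracleBandwidth d hn hβ hβb, sub_le_self_iff]
  exact div_nonneg (Real.log_nonneg (one_le_adaptPrice d n hβ.le hβb)) (by positivity)

theorem le_log_hMax_sub_log_oracleBandwidth (d : ℕ) (hn : 0 < n) {β : ℝ} (hβ : 0 < β)
    (hβb : β ≤ b) : (1 - 1 / (2 * β + d)) * (adaptPrice d b n β - 1)
      ≤ Real.log (hMax d b n) - Real.log (oracleBandwidth d b n β) := by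
  have hlog : Real.log (adaptPrice d b n β) / (2 * β + d)
      ≤ (adaptPrice d b n β - 1) / (2 * β + d) := by
    gcongr
    exact Real.log_le_sub_one_of_pos (one_pos.trans_le (one_le_adaptPrice d n hβ.le hβb))
  have hsplit : (1 - 1 / (2 * β + d)) * (adaptPrice d b n β - 1)
      = adaptPrice d b n β - 1 - (adaptPrice d b n β - 1) / (2 * β + d) := by ring
  linarith [log_hMax_sub_log_oracleBandwidth d hn hβ hβb]

theorem one_div_two_mul_add_lt_one (hd : 0 < d) {β : ℝ} (hβ : 0 < β) :
    1 / (2 * β + d) < 1 := by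
  have hd1 : (1 : ℝ) ≤ d := by exact_mod_cast hd
  rw [div_lt_one (by positivity)]
  linarith

theorem oracleBandwidth_le_hMax (hd : 0 < d) (hn : 0 < n) {β : ℝ} (hβ : 0 < β) (hβb : β ≤ b) :
    oracleBandwidth d b n β ≤ hMax d b n := by
  rw [← Real.log_le_log_iff (oracleBandwidth_pos d hn hβ.le hβb) (hMax_pos d b hn), ← sub_nonneg]
  refine le_trans (mul_nonneg ?_ ?_) (le_log_hMax_sub_log_oracleBandwidth d hn hβ hβb)
  · linarith [one_div_two_mul_add_lt_one hd hβ]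
  · linarith [one_le_adaptPrice d n hβ.le hβb]

theorem exists_bandwidth_mem_Icc (d b : ℕ) {δ : ℝ} (hδ : 0 < δ) (hδmax : δ ≤ hMax d b n) :
    ∃ k, bandwidth d b n k ∈ Set.Icc (δ / 2) δ := by
  obtain ⟨k, hk_le, hk_lt⟩ := exists_nat_pow_near ((one_le_div hδ).2 hδmax) one_lt_two
  rw [le_div_iff₀ hδ] at hk_le
  rw [div_lt_iff₀ hδ, pow_succ] at hk_lt
  refine ⟨k + 1, ?_, ?_⟩
  · rw [bandwidth, le_div_iff₀ (by positivity), pow_succ]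
    linarith
  · rw [bandwidth, div_le_iff₀ (by positivity), pow_succ]
    linarith

theorem mul_log_two_eq (d b : ℕ) (hn : 0 < n) (k : ℕ) :
    k * Real.log 2 = Real.log (hMax d b n) - Real.log (bandwidth d b n k) := by
  rw [bandwidth, Real.log_div (hMax_pos d b hn).ne' (by positivity), Real.log_pow]
  ring

theorem mul_bandwidth_rpow_le_stdBound (hd : 0 < d) (hn : 0 < n) {β : ℝ} (hβ : 0 < β)
    (hβb : β ≤ b) {a B : ℝ} (ha0 : 0 < a) (ha1 : a ≤ 1)
    (ha : B ^ 2 * a ^ (2 * β + d) ≤ 1 - 1 / (2 * β + d)) {k : ℕ}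
    (hk : bandwidth d b n k ≤ a * oracleBandwidth d b n β) :
    B * bandwidth d b n k ^ β ≤ stdBound d b n k := by
  have hbw := bandwidth_pos d b hn k
  have hh := oracleBandwidth_pos d hn hβ.le hβb
  have hϱ := one_le_adaptPrice d n hβ.le hβb
  refine Real.le_sqrt_of_sq_le ?_
  rw [le_div_iff₀ (by positivity)]
  calc (B * bandwidth d b n k ^ β) ^ 2 * (n * bandwidth d b n k ^ d)
      = B ^ 2 * n * bandwidth d b n k ^ (2 * β + d) := by
        rw [← sq_rpow_mul_pow hbw]
        ring
    _ ≤ B ^ 2 * n * (a * oracleBandwidth d b n β) ^ (2 * β + d) := by gcongr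
    _ = B ^ 2 * a ^ (2 * β + d) * adaptPrice d b n β := by
        rw [Real.mul_rpow ha0.le hh.le, oracleBandwidth_rpow d hn hβ hβb]
        field_simp
    _ ≤ (1 - 1 / (2 * β + d)) * adaptPrice d b n β := by gcongr
    _ ≤ 1 + (1 - 1 / (2 * β + d)) * (adaptPrice d b n β - 1) := by
        have : (0 : ℝ) ≤ 1 / (2 * β + d) := by positivity
        linarith
    _ ≤ 1 + k * Real.log 2 := by
        have hlog : Real.log (bandwidth d b n k) ≤ Real.log (oracleBandwidth d b n β) :=
          Real.log_le_log hbw (hk.trans (mul_le_of_le_one_left hh.le ha1))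
        rw [mul_log_two_eq d b hn k]
        linarith [le_log_hMax_sub_log_oracleBandwidth d hn hβ hβb]

theorem stdBound_le_mul_rate (hn : 0 < n) {β : ℝ} (hβ : 0 < β) (hβb : β ≤ b) {κ : ℝ}
    (hκ : 1 ≤ κ) {k : ℕ} (hk : oracleBandwidth d b n β / κ ≤ bandwidth d b n k) :
    stdBound d b n k ≤ √((1 + Real.log κ) * κ ^ d) * rate d b n β := by
  have hh := oracleBandwidth_pos d hn hβ.le hβb
  have hϱ := one_le_adaptPrice d n hβ.le hβb
  have hbw := bandwidth_pos d b hn k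
  have hlogκ : 0 ≤ Real.log κ := Real.log_nonneg hκ
  have hrate : 0 ≤ rate d b n β := Real.rpow_nonneg (adaptPrice_div_pos d hn hβ.le hβb).le _
  have hklog : k * Real.log 2 ≤ adaptPrice d b n β - 1 + Real.log κ := by
    have hlog := Real.log_le_log (by positivity) hk
    rw [Real.log_div hh.ne' (by positivity)] at hlog
    linarith [mul_log_two_eq d b hn k, log_hMax_sub_log_oracleBandwidth_le d hn hβ hβb]
  refine Real.sqrt_le_iff.2 ⟨by positivity, ?_⟩
  rw [mul_pow, Real.sq_sqrt (by positivity), div_le_iff₀ (by positivity)]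
  calc 1 + k * Real.log 2 ≤ (1 + Real.log κ) * adaptPrice d b n β := by
        linarith [mul_nonneg hlogκ (sub_nonneg.2 hϱ)]
    _ = (1 + Real.log κ) * κ ^ d * rate d b n β ^ 2 *
          (n * (oracleBandwidth d b n β / κ) ^ d) := by
        rw [← rate_sq_mul d hn hβ hβb, div_pow]
        field_simp
    _ ≤ (1 + Real.log κ) * κ ^ d * rate d b n β ^ 2 * (n * bandwidth d b n k ^ d) := by gcongr

theorem eventually_hMin_le (hd : 0 < d) {e : ℝ} (he : (d : ℝ) < e) {a : ℝ} (ha : 0 < a) :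
    ∀ᶠ n : ℕ in atTop, hMin d n ≤ a * (n : ℝ) ^ (-(1 / e)) := by
  have hpos : (0 : ℝ) < 1 / d - 1 / e :=
    sub_pos.2 (one_div_lt_one_div_of_lt (by exact_mod_cast hd) he)
  have hlittle := (isLittleO_log_rpow_rpow_atTop (2 / d : ℝ) hpos).comp_tendsto
    tendsto_natCast_atTop_atTop
  filter_upwards [hlittle.bound ha, eventually_gt_atTop 0] with n hlog hn
  have hn0 : (0 : ℝ) < n := by exact_mod_cast hn
  simp only [Function.comp, Real.norm_eq_abs,
    abs_of_nonneg (Real.rpow_nonneg (Nat.cast_nonneg n) _)] at hlog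
  calc hMin d n ≤ a * (n : ℝ) ^ (1 / d - 1 / e : ℝ) * (n : ℝ) ^ (-(1 / d) : ℝ) :=
        mul_le_mul_of_nonneg_right ((le_abs_self _).trans hlog) (by positivity)
    _ = a * (n : ℝ) ^ (-(1 / e)) := by
        rw [mul_assoc, ← Real.rpow_add hn0]
        congr 2
        ring

theorem tendsto_log_natCast_atTop : Tendsto (fun n : ℕ => Real.log n) atTop atTop :=
  Real.tendsto_log_atTop.comp tendsto_natCast_atTop_atTop

theorem eventually_hMin_le_bandwidth (hd : 0 < d) (hb : 0 < b) :
    ∀ᶠ n : ℕ in atTop, ∀ l ≤ kLast d b n, hMin d n ≤ bandwidth d b n l := by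
  have hexp : (d : ℝ) < 2 * b + d := lt_add_of_pos_left _ (by positivity)
  filter_upwards [eventually_hMin_le hd hexp one_pos, eventually_gt_atTop 0,
    tendsto_log_natCast_atTop.eventually_ge_atTop 1] with n hmin hn hlog l hl
  refine hMin_le_bandwidth_of_le_kLast hd hn hlog (k := 0) ?_ hl
  rwa [bandwidth, pow_zero, div_one, hMax, ← one_mul ((n : ℝ) ^ _)]

theorem eventually_kLast_lt (hd : 0 < d) (hb : 0 < b) : ∀ᶠ n : ℕ in atTop, kLast d b n < n := by
  filter_upwards [eventually_hMin_le_bandwidth hd hb, eventually_gt_atTop 0,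
    tendsto_log_natCast_atTop.eventually_ge_atTop 1] with n hmin hn hlog
  have hpow : 2 ^ kLast d b n ≤ n := by
    exact_mod_cast two_pow_le_of_hMin_le_bandwidth hd hn hlog (hmin _ le_rfl)
  exact Nat.lt_two_pow_self.trans_le hpow

theorem eventually_log_sq_le (hd : 0 < d) (hb : 0 < b) :
    ∀ᶠ n : ℕ in atTop, ∀ l ≤ kLast d b n, Real.log n ^ 2 ≤ n * bandwidth d b n l ^ d := by
  filter_upwards [eventually_hMin_le_bandwidth hd hb, eventually_gt_atTop 0] with n hmin hn l hl
  exact log_sq_le_mul_bandwidth_pow hd hn (hmin l hl)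

theorem eventually_stdBound_le (hd : 0 < d) (hb : 0 < b) {s : ℝ} (hs : 0 < s) :
    ∀ᶠ n : ℕ in atTop, ∀ l ≤ kLast d b n, stdBound d b n l ≤ s := by
  filter_upwards [eventually_hMin_le_bandwidth hd hb, eventually_gt_atTop 0,
    tendsto_log_natCast_atTop.eventually_ge_atTop (max 1 (2 / s ^ 2))] with n hmin hn hlog l hl
  have hlog1 : 1 ≤ Real.log n := (le_max_left _ _).trans hlog
  refine le_of_sq_le_sq ((stdBound_sq_le hd hn hlog1 (hmin l hl)).trans ?_) hs.le
  exact (div_le_comm₀ (by positivity) (one_pos.trans_le hlog1)).1 ((le_max_right _ _).trans hlog)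

theorem rpow_neg_le_oracleBandwidth (d : ℕ) (hn : 0 < n) {β : ℝ} (hβ : 0 ≤ β) (hβb : β ≤ b) :
    (n : ℝ) ^ (-(1 / (2 * β + d))) ≤ oracleBandwidth d b n β := by
  rw [oracleBandwidth, Real.rpow_neg (Nat.cast_nonneg n), ← Real.inv_rpow (Nat.cast_nonneg n),
    inv_eq_one_div]
  gcongr
  exact one_le_adaptPrice d n hβ hβb

theorem exists_mul_rpow_le (B : ℝ) {e δ : ℝ} (he : 0 < e) (hδ : 0 < δ) :
    ∃ a, 0 < a ∧ a ≤ 1 ∧ B ^ 2 * a ^ e ≤ δ := by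
  refine ⟨min 1 ((δ / (B ^ 2 + 1)) ^ (1 / e)), by positivity, min_le_left _ _, ?_⟩
  calc B ^ 2 * min 1 ((δ / (B ^ 2 + 1)) ^ (1 / e)) ^ e
      ≤ (B ^ 2 + 1) * ((δ / (B ^ 2 + 1)) ^ (1 / e)) ^ e := by
        gcongr
        · linarith
        · exact min_le_right _ _
    _ = δ := by
        rw [← Real.rpow_mul (by positivity), one_div_mul_cancel he.ne', Real.rpow_one]
        field_simp

theorem exists_oracle_index (hd : 0 < d) {β : ℝ} (hβ : 0 < β) (hβb : β ≤ b) {B : ℝ}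
    (hB : 0 ≤ B) : ∃ A, 0 ≤ A ∧ ∀ᶠ n : ℕ in atTop, ∃ ks, hMin d n ≤ bandwidth d b n ks ∧
      (∀ l, ks ≤ l → B * bandwidth d b n l ^ β ≤ stdBound d b n l) ∧
      stdBound d b n ks ≤ A * rate d b n β := by
  obtain ⟨a, ha0, ha1, ha⟩ := exists_mul_rpow_le B (show 0 < 2 * β + d by positivity)
    (sub_pos.2 (one_div_two_mul_add_lt_one hd hβ))
  refine ⟨√((1 + Real.log (2 / a)) * (2 / a) ^ d), Real.sqrt_nonneg _, ?_⟩
  filter_upwards [eventually_hMin_le hd (show (d : ℝ) < 2 * β + d by linarith) (half_pos ha0),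
    eventually_gt_atTop 0] with n hmin hn
  have hh := oracleBandwidth_pos d hn hβ.le hβb
  obtain ⟨ks, hlow, hupp⟩ := exists_bandwidth_mem_Icc d b (mul_pos ha0 hh)
    ((mul_le_of_le_one_left hh.le ha1).trans (oracleBandwidth_le_hMax hd hn hβ hβb))
  refine ⟨ks, ?_, fun l hl => ?_, ?_⟩
  · calc hMin d n ≤ a / 2 * (n : ℝ) ^ (-(1 / (2 * β + d))) := hmin
      _ ≤ a / 2 * oracleBandwidth d b n β := by
          gcongr
          exact rpow_neg_le_oracleBandwidth d hn hβ.le hβb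
      _ = a * oracleBandwidth d b n β / 2 := by ring
      _ ≤ bandwidth d b n ks := hlow
  · have hbl := bandwidth_pos d b hn l
    calc B * bandwidth d b n l ^ β ≤ B * bandwidth d b n ks ^ β := by
          gcongr
          exact bandwidth_anti d b n hl
      _ ≤ stdBound d b n ks := mul_bandwidth_rpow_le_stdBound hd hn hβ hβb ha0 ha1 ha hupp
      _ ≤ stdBound d b n l := stdBound_mono d b hn hl
  · refine stdBound_le_mul_rate hn hβ hβb ?_ (le_trans (le_of_eq ?_) hlow)
    · rw [le_div_iff₀ ha0]
      linarith
    · field_simp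

theorem rate_pos (d : ℕ) (hn : 0 < n) {β : ℝ} (hβ : 0 ≤ β) (hβb : β ≤ b) : 0 < rate d b n β :=
  Real.rpow_pos_of_pos (adaptPrice_div_pos d hn hβ hβb) _

theorem one_div_le_rate (d : ℕ) {β : ℝ} (hβ : 0 < β) (hβb : β ≤ b) (hn : 1 ≤ n) :
    1 / (n : ℝ) ≤ rate d b n β := by
  have hn1 : (1 : ℝ) ≤ n := by exact_mod_cast hn
  calc 1 / (n : ℝ) = (1 / (n : ℝ)) ^ (1 : ℝ) := (Real.rpow_one _).symm
    _ ≤ (1 / (n : ℝ)) ^ (β / (2 * β + d)) := by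
        refine Real.rpow_le_rpow_of_exponent_ge (by positivity)
          ((div_le_one (by positivity)).2 hn1) ((div_le_one (by positivity)).2 ?_)
        linarith [Nat.cast_nonneg (α := ℝ) d]
    _ ≤ rate d b n β := by
        unfold rate
        gcongr
        exact one_le_adaptPrice d n hβ.le hβb

theorem eventually_exp_log_sq_le {c₁ : ℝ} (hc₁ : 0 < c₁) (A q : ℝ) (hA : 0 ≤ A) :
    ∀ᶠ n : ℕ in atTop, A * Real.exp (-(c₁ * Real.log n ^ 2)) ≤ (1 / (n : ℝ)) ^ q := by
  filter_upwards [tendsto_log_natCast_atTop.eventually_ge_atTop 1,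
    tendsto_log_natCast_atTop.eventually_ge_atTop ((A + |q|) / c₁), eventually_gt_atTop 0]
    with n hlog1 hlog hn
  have hn0 : (0 : ℝ) < n := by exact_mod_cast hn
  rw [div_le_iff₀' hc₁] at hlog
  have hexponent : A + q * Real.log n ≤ c₁ * Real.log n ^ 2 :=
    calc A + q * Real.log n ≤ A * Real.log n + |q| * Real.log n := by
          gcongr
          · exact le_mul_of_one_le_right hA hlog1
          · exact le_abs_self q
      _ = (A + |q|) * Real.log n := by ring
      _ ≤ c₁ * Real.log n * Real.log n := by gcongr
      _ = c₁ * Real.log n ^ 2 := by ring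
  calc A * Real.exp (-(c₁ * Real.log n ^ 2))
      ≤ Real.exp A * Real.exp (-(c₁ * Real.log n ^ 2)) := by
        gcongr
        linarith [Real.add_one_le_exp A]
    _ = Real.exp (A + -(c₁ * Real.log n ^ 2)) := (Real.exp_add _ _).symm
    _ ≤ Real.exp (Real.log (1 / n) * q) := by
        refine Real.exp_le_exp.2 ?_
        rw [one_div, Real.log_inv]
        linarith
    _ = (1 / (n : ℝ)) ^ q := (Real.rpow_def_of_pos (by positivity) q).symm

end Rates

/-! ### Deviations of the gradient -/

section Tail

theorem chernoff_exponent_le {N S w σ R D κ : ℝ} (hN : 0 ≤ N) (hS : 0 ≤ S) (hw : 1 ≤ w)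
    (hσ : 0 ≤ σ) (hR : 0 < R) (hD : 0 ≤ D) (hDR : D ≤ R) (hκ : 0 ≤ κ) :
    N * (w * σ * S / R * S + (w * σ * S / R) ^ 2 * (D ^ 2 * κ)) -
        w * σ * S / R * (N * (w * (1 + 2 * κ * R * σ) * S))
      ≤ -(w ^ 2 * σ ^ 2 * κ * (N * S ^ 2)) := by
  have hsq : (D / R) ^ 2 ≤ 1 := pow_le_one₀ (by positivity) ((div_le_one hR).2 hDR)
  have hlin : 0 ≤ w * σ * S / R * ((w - 1) * S) :=
    mul_nonneg (by positivity) (mul_nonneg (sub_nonneg.2 hw) hS)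
  calc N * (w * σ * S / R * S + (w * σ * S / R) ^ 2 * (D ^ 2 * κ)) -
        w * σ * S / R * (N * (w * (1 + 2 * κ * R * σ) * S))
      = N * ((w * σ * S) ^ 2 * κ * (D / R) ^ 2 - w * σ * S / R * ((w - 1) * S) -
          2 * ((w * σ * S) ^ 2 * κ)) := by
        field_simp
        ring
    _ ≤ N * ((w * σ * S) ^ 2 * κ * 1 - 0 - 2 * ((w * σ * S) ^ 2 * κ)) := by gcongr
    _ = -(w ^ 2 * σ ^ 2 * κ * (N * S ^ 2)) := by ring

theorem two_rpow_neg_sq (a : ℝ) : ((2 : ℝ) ^ (-a)) ^ 2 = Real.exp (-(2 * a * Real.log 2)) := by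
  rw [Real.rpow_def_of_pos two_pos, ← Real.exp_nat_mul]
  congr 1
  push_cast
  ring

/-- The factor `1 + 2 K_∞ (1 ∨ ρ̇_∞) √(r d)` of the threshold constant, which decides how far above
its standard deviation the gradient of the criterion may lie. -/
def deviationFactor (d : ℕ) (ρ : ℝ → ℝ) (K : (Fin d → ℝ) → ℝ) (r : ℝ) : ℝ :=
  1 + 2 * supNorm K * max 1 (supNorm (deriv ρ)) * √(r * d)

variable {d b n : ℕ} {K : (Fin d → ℝ) → ℝ} {x₀ : Fin d → ℝ} {h S r : ℝ} {ρ : ℝ → ℝ}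
  {g : ℕ → ℝ → ℝ} {u : (Fin d → ℝ) → ℝ}

theorem measurable_gradNorm (hK : IsKernel K) (hu : Measurable u) :
    Measurable (gradNorm (n := n) b ρ K x₀ h u) :=
  (measurable_scoreNorm hK hu).div_const _

theorem measure_le_gradNorm_le (hd : 0 < d) (hb : 0 < b) (hK : IsKernel K) (hρ : IsContrast ρ g)
    (hg : ∀ i, IsSymmDensity (g i)) (hn : 0 < n) (hh : 0 < h) (hfit : KernelFits K x₀ h)
    (hu : Measurable u) (hr : 0 ≤ r) (hS : 0 ≤ S)
    (huS : ∀ x, K (rescale x₀ h x) ≠ 0 → |u x| ≤ S)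
    (hsmall : √(multiIdx d b).card * √(r * d) * supNorm K * S ≤ 1) {l : ℕ}
    (hNS : n * h ^ d * S ^ 2 = 1 + l * Real.log 2) :
    modelLaw d g n {ω | √(multiIdx d b).card * deviationFactor d ρ K r * S ≤
        gradNorm b ρ K x₀ h u ω}
      ≤ ENNReal.ofReal (2 * (multiIdx d b).card * ((2 : ℝ) ^ (-(r * d * l))) ^ 2) := by
  have hcard : (2 : ℝ) ≤ (multiIdx d b).card := by exact_mod_cast two_le_card_multiIdx hd hb
  have hw2 : √(multiIdx d b).card ^ 2 = ((multiIdx d b).card : ℝ) := Real.sq_sqrt (by positivity)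
  have hw1 : 1 ≤ √((multiIdx d b).card : ℝ) := Real.one_le_sqrt.2 (by linarith)
  have hσ2 : √(r * d) ^ 2 = r * d := Real.sq_sqrt (by positivity)
  have hK1 := hK.one_le_supNorm
  have hρ0 := hρ.supNorm_deriv_nonneg
  have hN : 0 < n * h ^ d := by positivity
  set R := max 1 (supNorm (deriv ρ))
  set w := √((multiIdx d b).card : ℝ)
  set t := w * √(r * d) * S / R with ht
  have hR : 0 < R := one_pos.trans_le (le_max_left _ _)
  have ht0 : 0 ≤ t := by positivity
  have ht1 : t * (supNorm (deriv ρ) * supNorm K) ≤ 1 :=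
    calc t * (supNorm (deriv ρ) * supNorm K) ≤ t * (R * supNorm K) := by
          gcongr
          exact le_max_right _ _
      _ = w * √(r * d) * supNorm K * S := by
          rw [ht]
          field_simp
      _ ≤ 1 := hsmall
  have hl : 2 * (r * d * l) * Real.log 2 ≤ w ^ 2 * √(r * d) ^ 2 * supNorm K *
      (n * h ^ d * S ^ 2) :=
    calc 2 * (r * d * l) * Real.log 2 = 2 * (r * d) * 1 * (l * Real.log 2) := by ring
      _ ≤ (multiIdx d b).card * (r * d) * supNorm K * (1 + l * Real.log 2) := by
          have := Real.log_nonneg (one_le_two (α := ℝ))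
          gcongr
          linarith
      _ = w ^ 2 * √(r * d) ^ 2 * supNorm K * (n * h ^ d * S ^ 2) := by rw [hw2, hσ2, hNS]
  refine (measure_mono fun ω hω => ?_).trans ((measure_le_of_lintegral_exp_le
    ((measurable_scoreNorm (n := n) (b := b) hK hu).const_mul t)
    (lintegral_exp_scoreNorm_le hK hρ hg hh hfit hu huS ht0 ht1)
    (t * (n * h ^ d * (w * deviationFactor d ρ K r * S)))).trans (ENNReal.ofReal_le_ofReal ?_))
  · exact mul_le_mul_of_nonneg_left ((le_div_iff₀' hN).1 hω) ht0
  · rw [mul_assoc, ← Real.exp_add, two_rpow_neg_sq]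
    gcongr
    exact (chernoff_exponent_le hN.le hS hw1 (Real.sqrt_nonneg _) hR hρ0 (le_max_right _ _)
      hK.supNorm_nonneg).trans (neg_le_neg hl)

theorem lintegral_exp_gradNorm_div_le (hK : IsKernel K) (hρ : IsContrast ρ g)
    (hg : ∀ i, IsSymmDensity (g i)) (hn : 0 < n) (hh : 0 < h) (hfit : KernelFits K x₀ h)
    (hu : Measurable u) (hS : 0 < S)
    (huS : ∀ x, K (rescale x₀ h x) ≠ 0 → |u x| ≤ S) (hNS : 1 ≤ n * h ^ d * S ^ 2)
    (hlarge : (supNorm (deriv ρ) * supNorm K) ^ 2 ≤ n * h ^ d) :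
    ∫⁻ ω, ENNReal.ofReal (Real.exp (gradNorm b ρ K x₀ h u ω / S)) ∂(modelLaw d g n)
      ≤ ENNReal.ofReal (2 * (multiIdx d b).card *
        Real.exp (1 + supNorm (deriv ρ) ^ 2 * supNorm K)) := by
  set N : ℝ := n * h ^ d with hN
  have hN0 : 0 < N := by positivity
  have hK0 := hK.supNorm_nonneg
  set t := 1 / (N * S) with ht
  have hNsq : N ≤ (N * S) ^ 2 :=
    calc N = N * 1 := (mul_one N).symm
      _ ≤ N * (N * S ^ 2) := by gcongr
      _ = (N * S) ^ 2 := by ring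
  have ht1 : t * (supNorm (deriv ρ) * supNorm K) ≤ 1 := by
    rw [ht, one_div_mul_eq_div, div_le_one (by positivity)]
    exact le_of_sq_le_sq (hlarge.trans hNsq) (by positivity)
  have hNt : N * (t * S) = 1 := by
    rw [ht]
    field_simp
  have hNt2 : N * t ^ 2 ≤ 1 := by
    rwa [ht, div_pow, one_pow, mul_one_div, div_le_one (by positivity)]
  have hgrad : ∀ ω : Sample d n, gradNorm b ρ K x₀ h u ω / S = t * scoreNorm b ρ K x₀ h u ω :=
    fun ω => by rw [gradNorm, div_div, ← hN, ht, one_div_mul_eq_div]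
  simp_rw [hgrad]
  refine (lintegral_exp_scoreNorm_le hK hρ hg hh hfit hu huS (by positivity) ht1).trans ?_
  gcongr
  calc N * (t * S + t ^ 2 * (supNorm (deriv ρ) ^ 2 * supNorm K))
      = N * (t * S) + N * t ^ 2 * (supNorm (deriv ρ) ^ 2 * supNorm K) := by ring
    _ ≤ 1 + 1 * (supNorm (deriv ρ) ^ 2 * supNorm K) := by
        rw [hNt]
        gcongr
    _ = 1 + supNorm (deriv ρ) ^ 2 * supNorm K := by rw [one_mul]

end Tail

/-! ### Lepski's rule on a large sample -/

section Oracle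

variable {d b n : ℕ} {K : (Fin d → ℝ) → ℝ} {x₀ : Fin d → ℝ} {ρ : ℝ → ℝ} {g : ℕ → ℝ → ℝ}
  {M c r η β L : ℝ} {f : (Fin d → ℝ) → ℝ} {ks : ℕ} {t : ℕ → multiIdx d b → ℝ}
  {θ : (n : ℕ) → ℝ → Sample d n → multiIdx d b → ℝ}

/-- The radius `C S_n(l) / 2`: if Lepski's rule does not select an index, then some later estimator
`f̂^{(l)}(x₀)` is farther than this from its target. -/
def lepskiRadius (b n : ℕ) (ρ : ℝ → ℝ) (K : (Fin d → ℝ) → ℝ) (c r : ℝ) (l : ℕ) : ℝ :=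
  thresholdConst b ρ K c r / 2 * stdBound d b n l

/-- The approximation error of `f` at the `k`-th bandwidth by the local polynomial `t k`. -/
abbrev gridError (n : ℕ) (f : (Fin d → ℝ) → ℝ) (x₀ : Fin d → ℝ) (t : ℕ → multiIdx d b → ℝ)
    (k : ℕ) : (Fin d → ℝ) → ℝ :=
  approxError f x₀ (bandwidth d b n k) (t k)

/-- The norm of the gradient of the criterion at `t k`, for the `k`-th bandwidth. -/
abbrev gridGradNorm (n : ℕ) (ρ : ℝ → ℝ) (K : (Fin d → ℝ) → ℝ) (f : (Fin d → ℝ) → ℝ)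
    (x₀ : Fin d → ℝ) (t : ℕ → multiIdx d b → ℝ) (k : ℕ) : Sample d n → ℝ :=
  gradNorm b ρ K x₀ (bandwidth d b n k) (gridError n f x₀ t k)

/-- The event that the criterion has too little curvature at some bandwidth `h_l`, `ks ≤ l ≤ k_n`,
and some dyadic multiple of `lepskiRadius` up to `η`. -/
def flatEvent (n : ℕ) (ρ : ℝ → ℝ) (K : (Fin d → ℝ) → ℝ) (f : (Fin d → ℝ) → ℝ) (x₀ : Fin d → ℝ)
    (c r η : ℝ) (ks : ℕ) (t : ℕ → multiIdx d b → ℝ) : Set (Sample d n) :=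
  {ω | ∃ l j : ℕ, (ks ≤ l ∧ l ≤ kLast d b n ∧ 2 ^ j * lepskiRadius b n ρ K c r l ≤ η) ∧
    ω ∈ flatSet b n ρ K x₀ c (bandwidth d b n l) (gridError n f x₀ t l)
      (2 ^ j * lepskiRadius b n ρ K c r l)}

/-- What the risk bound asks of the sample size: on the grid of bandwidths the kernel stays inside
the cube, the effective sample size `n h_l^d` is at least `(ln n)^2` and `S_n(l)` is small. -/
structure IsLargeSample (b n : ℕ) (ρ : ℝ → ℝ) (K : (Fin d → ℝ) → ℝ) (x₀ : Fin d → ℝ)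
    (c r η : ℝ) : Prop where
  pos : 0 < n
  kernelFits : ∀ l, KernelFits K x₀ (bandwidth d b n l)
  kLast_lt : kLast d b n < n
  lt_two_pow_mul : ∀ l, η < 2 ^ n * lepskiRadius b n ρ K c r l
  le_log : supNorm (deriv ρ) * supNorm K ≤ Real.log n
  log_sq_le : ∀ l ≤ kLast d b n, Real.log n ^ 2 ≤ n * bandwidth d b n l ^ d
  stdBound_le : ∀ l ≤ kLast d b n, stdBound d b n l ≤ η
  lepskiRadius_lt : ∀ l ≤ kLast d b n, lepskiRadius b n ρ K c r l < η
  mul_stdBound_le : ∀ l ≤ kLast d b n,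
    √(multiIdx d b).card * √(r * d) * supNorm K * stdBound d b n l ≤ 1

/-- The polynomials `t k` take the value `f x₀` at `x₀` and, from the oracle index `ks` on,
approximate `f` within `S_n(k)` on the window of the `k`-th bandwidth. -/
structure IsOracleApprox (n : ℕ) (K : (Fin d → ℝ) → ℝ) (f : (Fin d → ℝ) → ℝ) (x₀ : Fin d → ℝ)
    (M : ℝ) (ks : ℕ) (t : ℕ → multiIdx d b → ℝ) : Prop where
  mem_paramSet : ∀ k, t k ∈ paramSet d b M
  apply_zeroIdx : ∀ k, t k (zeroIdx d b) = f x₀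
  measurable_gridError : ∀ k, Measurable (gridError n f x₀ t k)
  abs_gridError_le : ∀ k, ks ≤ k → ∀ x, K (rescale x₀ (bandwidth d b n k) x) ≠ 0 →
    |gridError n f x₀ t k x| ≤ stdBound d b n k

theorem exists_paramSet_abs_approxError_le (hK : IsKernel K) (hβ : 0 < β) (hβb : β ≤ b)
    (hL : 0 ≤ L) (hM : 0 ≤ M) (hf : f ∈ holderClass d β L M) (hx₀ : x₀ ∈ cube d) {h : ℝ}
    (hh : 0 < h) (hh1 : h ≤ 1) (hfit : KernelFits K x₀ h) :
    ∃ t ∈ paramSet d b M, t (zeroIdx d b) = f x₀ ∧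
      ∀ x, K (rescale x₀ h x) ≠ 0 → |approxError f x₀ h t x| ≤ L * d ^ β * h ^ β := by
  obtain ⟨t, htM, ht0, htf⟩ := exists_paramSet_approx hβ hβb hL hM hf hx₀ hh hh1
  refine ⟨t, htM, ht0, fun x hx => ?_⟩
  have hcoord : ∀ j, |x j - x₀ j| ≤ h := fun j => by
    have hbox := hK.support _ hx
    have hle : |(x j - x₀ j) / h| ≤ 1 :=
      (abs_le.2 ⟨hbox.1 j, hbox.2 j⟩).trans one_half_lt_one.le
    rwa [abs_div, abs_of_pos hh, div_le_one hh] at hle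
  have hsum : ∑ j, |x j - x₀ j| ≤ d * h :=
    calc ∑ j, |x j - x₀ j| ≤ ∑ _j : Fin d, h := Finset.sum_le_sum fun j _ => hcoord j
      _ = d * h := by simp
  rw [approxError, Set.indicator_of_mem (hfit x hx), mul_assoc,
    ← Real.mul_rpow (Nat.cast_nonneg d) hh.le]
  exact (htf x (hfit x hx)).trans (by gcongr)

theorem exists_isOracleApprox (hK : IsKernel K) (hβ : 0 < β) (hβb : β ≤ b) (hL : 0 ≤ L)
    (hM : 0 ≤ M) (hf : f ∈ holderClass d β L M) (hx₀ : x₀ ∈ cube d) (hn : 0 < n)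
    (hfit : ∀ k, KernelFits K x₀ (bandwidth d b n k))
    (hbias : ∀ k, ks ≤ k → L * d ^ β * bandwidth d b n k ^ β ≤ stdBound d b n k) :
    ∃ t : ℕ → multiIdx d b → ℝ, IsOracleApprox n K f x₀ M ks t := by
  choose t htM ht0 htf using fun k => exists_paramSet_abs_approxError_le hK hβ hβb hL hM hf hx₀
    (bandwidth_pos d b hn k) (bandwidth_le_one d b hn k) (hfit k)
  exact ⟨t, htM, ht0,
    fun k => measurable_approxError (continuousOn_of_mem_holderClass hβ hL hM hf) (t k),
    fun k hk x hx => (htf k x hx).trans (hbias k hk)⟩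

theorem thresholdConst_pos (hK : IsKernel K) (b : ℕ) (ρ : ℝ → ℝ) (hc : 0 < c) (r : ℝ) :
    0 < thresholdConst b ρ K c r := by
  have hq := hK.minEigenvalue_pos b
  have hcard : 0 < (multiIdx d b).card := Finset.card_pos.2 ⟨_, zero_mem_multiIdx d b⟩
  have hK0 := hK.supNorm_nonneg
  unfold thresholdConst
  positivity

theorem lepskiRadius_pos (hK : IsKernel K) (ρ : ℝ → ℝ) (hc : 0 < c) (r : ℝ) (hn : 0 < n) (l : ℕ) :
    0 < lepskiRadius b n ρ K c r l :=
  mul_pos (half_pos (thresholdConst_pos hK b ρ hc r)) (stdBound_pos d b hn l)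

theorem curvature_mul_lepskiRadius (hK : IsKernel K) (hc : 0 < c) (l : ℕ) :
    c * minEigenvalue b K / 2 * lepskiRadius b n ρ K c r l
      = (multiIdx d b).card * deviationFactor d ρ K r * stdBound d b n l := by
  have hq := hK.minEigenvalue_pos b
  simp only [lepskiRadius, thresholdConst, deviationFactor]
  field_simp
  norm_num

theorem mul_bandwidth_mul_stdBound_sq (hn : 0 < n) (l : ℕ) :
    n * bandwidth d b n l ^ d * stdBound d b n l ^ 2 = 1 + l * Real.log 2 := by
  have hh := bandwidth_pos d b hn l
  rw [stdBound_sq d b hn, mul_div_cancel₀ _ (by positivity)]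

theorem abs_adaptiveEstimator_sub_le (hn : 0 < n)
    (hθ : ∀ (n : ℕ) (h : ℝ), 0 < h → h ≤ 1 → IsLPAMinimizer ρ K x₀ M h (θ n h))
    (ht : IsOracleApprox n K f x₀ M ks t) (C : ℝ) (Z : Sample d n) :
    |adaptiveEstimator C θ n Z - f x₀| ≤ 2 * M := by
  have hmin := hθ n _ (bandwidth_pos d b hn (selectedIndex C θ n Z)) (bandwidth_le_one d b hn _)
  rw [← ht.apply_zeroIdx 0]
  exact (abs_sub_zeroIdx_le _ _).trans (sqrt_sum_sq_sub_le (hmin.2 Z).1 (ht.mem_paramSet 0))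

theorem deviation_le_gradNorm (hK : IsKernel K) (hρ : IsContrast ρ g) (hc : 0 < c)
    (hθ : ∀ (n : ℕ) (h : ℝ), 0 < h → h ≤ 1 → IsLPAMinimizer ρ K x₀ M h (θ n h))
    (hlarge : IsLargeSample b n ρ K x₀ c r η)
    (ht : IsOracleApprox n K f x₀ M ks t) {ω : Sample d n}
    (hω : ω ∉ flatEvent n ρ K f x₀ c r η ks t) {l : ℕ} (hl : ks ≤ l) (hlL : l ≤ kLast d b n)
    (hlt : lepskiRadius b n ρ K c r l < |lpaEstimator θ n l (observe f ω) - f x₀|) :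
    √(multiIdx d b).card * deviationFactor d ρ K r * stdBound d b n l ≤
      gridGradNorm n ρ K f x₀ t l ω := by
  have hh := bandwidth_pos d b hlarge.pos l
  have hcurved : ω ∉ flatSet b n ρ K x₀ c (bandwidth d b n l) (gridError n f x₀ t l)
      (lepskiRadius b n ρ K c r l) := fun hmem =>
    hω ⟨l, 0, ⟨hl, hlL, by simpa using (hlarge.lepskiRadius_lt l hlL).le⟩, by simpa using hmem⟩
  have hgrad := mul_le_gradNorm_of_lt_abs_sub hK hρ hlarge.pos hh (hlarge.kernelFits l)
    (hθ n _ hh (bandwidth_le_one d b hlarge.pos l)) (ht.mem_paramSet l)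
    (lepskiRadius_pos hK ρ hc r hlarge.pos l) hcurved (by rwa [ht.apply_zeroIdx l])
  have hw : 0 < √((multiIdx d b).card : ℝ) :=
    Real.sqrt_pos.2 (by exact_mod_cast Finset.card_pos.2 ⟨_, zero_mem_multiIdx d b⟩)
  refine le_of_mul_le_mul_left ?_ hw
  calc √(multiIdx d b).card * (√(multiIdx d b).card * deviationFactor d ρ K r * stdBound d b n l)
      = (multiIdx d b).card * deviationFactor d ρ K r * stdBound d b n l := by
        rw [← mul_assoc, ← mul_assoc, Real.mul_self_sqrt (Nat.cast_nonneg _)]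
    _ ≤ _ := (curvature_mul_lepskiRadius hK hc l).symm.trans_le hgrad

/-- The constant `C'` in the bound `C S_n(l) / 2 + C' ‖gradient‖` on the error of `f̂^{(l)}(x₀)`. -/
def errorFactor (b : ℕ) (K : (Fin d → ℝ) → ℝ) (c M η : ℝ) : ℝ :=
  4 * (1 + 2 * M / η) * √(multiIdx d b).card / (c * minEigenvalue b K)

theorem errorFactor_nonneg (hK : IsKernel K) (b : ℕ) (hc : 0 < c) (hM : 0 ≤ M) (hη : 0 < η) :
    0 ≤ errorFactor b K c M η := by
  have hq := hK.minEigenvalue_pos b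
  unfold errorFactor
  positivity

theorem abs_lpaEstimator_sub_le (hK : IsKernel K) (hρ : IsContrast ρ g) (hc : 0 < c) (hM : 0 ≤ M)
    (hθ : ∀ (n : ℕ) (h : ℝ), 0 < h → h ≤ 1 → IsLPAMinimizer ρ K x₀ M h (θ n h))
    (hlarge : IsLargeSample b n ρ K x₀ c r η) (ht : IsOracleApprox n K f x₀ M ks t)
    {ω : Sample d n} (hω : ω ∉ flatEvent n ρ K f x₀ c r η ks t) {l : ℕ} (hl : ks ≤ l)
    (hlL : l ≤ kLast d b n) :
    |lpaEstimator θ n l (observe f ω) - f x₀| ≤ lepskiRadius b n ρ K c r l +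
      errorFactor b K c M η * gridGradNorm n ρ K f x₀ t l ω := by
  have hh := bandwidth_pos d b hlarge.pos l
  rw [← ht.apply_zeroIdx l]
  exact abs_sub_le_add_gradNorm hK hρ hlarge.pos hh (hlarge.kernelFits l) hc hM
    (hθ n _ hh (bandwidth_le_one d b hlarge.pos l)) (ht.mem_paramSet l)
    (lepskiRadius_pos hK ρ hc r hlarge.pos l) (hlarge.lepskiRadius_lt l hlL)
    fun j hj hmem => hω ⟨l, j, ⟨hl, hlL, hj⟩, hmem⟩

/-- The constant `2 C + C'` by which `S_n(k) (1 + ‖gradient‖ / S_n(k))` dominates the error of the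
adaptive estimator. -/
def lossFactor (b : ℕ) (ρ : ℝ → ℝ) (K : (Fin d → ℝ) → ℝ) (c r M η : ℝ) : ℝ :=
  2 * thresholdConst b ρ K c r + errorFactor b K c M η

theorem le_mul_one_add_div {C C' S w a : ℝ} (hC : 0 ≤ C) (hC' : 0 ≤ C') (hS : 0 < S) (hw : 0 ≤ w)
    (ha : a ≤ C * S + (C / 2 * S + C' * w)) : a ≤ (2 * C + C') * S * (1 + w / S) := by
  have hexpand : (2 * C + C') * S * (1 + w / S) = (2 * C + C') * (S + w) := by field_simp
  rw [hexpand]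
  linarith [mul_nonneg hC hS.le, mul_nonneg hC hw, mul_nonneg hC' hS.le]

theorem adaptiveEstimator_alternative (hK : IsKernel K) (hρ : IsContrast ρ g) (hc : 0 < c)
    (hM : 0 ≤ M) (hη : 0 < η)
    (hθ : ∀ (n : ℕ) (h : ℝ), 0 < h → h ≤ 1 → IsLPAMinimizer ρ K x₀ M h (θ n h))
    (hlarge : IsLargeSample b n ρ K x₀ c r η) (hks : ks ≤ kLast d b n)
    (ht : IsOracleApprox n K f x₀ M ks t) {ω : Sample d n}
    (hω : ω ∉ flatEvent n ρ K f x₀ c r η ks t) :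
    |adaptiveEstimator (thresholdConst b ρ K c r) θ n (observe f ω) - f x₀| ≤
        lossFactor b ρ K c r M η * stdBound d b n ks *
          (1 + gridGradNorm n ρ K f x₀ t ks ω / stdBound d b n ks) ∨
      ∃ k l, ks < k ∧ k ≤ kLast d b n ∧ k ≤ l + 1 ∧ ks ≤ l ∧ l ≤ kLast d b n ∧
        √(multiIdx d b).card * deviationFactor d ρ K r * stdBound d b n l ≤
          gridGradNorm n ρ K f x₀ t l ω ∧
        |adaptiveEstimator (thresholdConst b ρ K c r) θ n (observe f ω) - f x₀| ≤
          lossFactor b ρ K c r M η * stdBound d b n k *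
            (1 + gridGradNorm n ρ K f x₀ t k ω / stdBound d b n k) := by
  have hC := (thresholdConst_pos hK b ρ hc r).le
  have hC' := errorFactor_nonneg hK b hc hM hη
  have hW : ∀ k, 0 ≤ gridGradNorm n ρ K f x₀ t k ω := fun k =>
    gradNorm_nonneg (bandwidth_pos d b hlarge.pos k) _ _
  have hS := stdBound_pos d b hlarge.pos
  have herr := fun k => abs_lpaEstimator_sub_le (l := k) hK hρ hc hM hθ hlarge ht hω
  rcases lepski_alternative (e := fun k => lpaEstimator θ n k (observe f ω)) (a := f x₀) hC hks
    (stdBound_mono d b hlarge.pos) (hS ks).le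
    (k := selectedIndex (thresholdConst b ρ K c r) θ n (observe f ω)) rfl
    with hgood | ⟨hk, hkL, l, hkl, hlL, hl, hfar⟩
  · exact .inl (le_mul_one_add_div hC hC' (hS ks) (hW ks)
      (hgood.trans (add_le_add_right (herr ks le_rfl hks) _)))
  · refine .inr ⟨_, l, hk, hkL, hkl, hl, hlL, ?_, ?_⟩
    · exact deviation_le_gradNorm hK hρ hc hθ hlarge ht hω hl hlL hfar
    · exact le_mul_one_add_div hC hC' (hS _) (hW _) ((herr _ hk.le hkL).trans
        (le_add_of_nonneg_left (mul_nonneg hC (hS _).le)))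

end Oracle

/-! ### The risk -/

section Risk

theorem measure_dyadic_union_le {Ω : Type*} [MeasurableSpace Ω] {μ : Measure Ω}
    {F : ℕ → ℕ → Set Ω} {p : ℕ → ℕ → Prop} {n : ℕ} {ε : ℝ} (hε : 0 ≤ ε)
    (hp : ∀ l j, p l j → l < n ∧ j < n) (hF : ∀ l j, p l j → μ (F l j) ≤ ENNReal.ofReal ε) :
    μ {ω | ∃ l j, p l j ∧ ω ∈ F l j} ≤ ENNReal.ofReal (n ^ 2 * ε) := by
  classical
  set I := ((Finset.range n) ×ˢ (Finset.range n)).filter fun lj : ℕ × ℕ => p lj.1 lj.2 with hI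
  have hsub : {ω | ∃ l j, p l j ∧ ω ∈ F l j} ⊆ ⋃ lj ∈ I, F lj.1 lj.2 := by
    rintro ω ⟨l, j, hlj, hω⟩
    refine Set.mem_iUnion₂.2 ⟨(l, j), ?_, hω⟩
    simp only [hI, Finset.mem_filter, Finset.mem_product, Finset.mem_range]
    exact ⟨hp l j hlj, hlj⟩
  have hcard : (I.card : ℝ) ≤ n ^ 2 := by
    have : I.card ≤ n * n := (Finset.card_filter_le _ _).trans (by simp)
    rw [sq]
    exact_mod_cast this
  calc μ {ω | ∃ l j, p l j ∧ ω ∈ F l j} ≤ ∑ lj ∈ I, μ (F lj.1 lj.2) :=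
        (measure_mono hsub).trans (measure_biUnion_finset_le _ _)
    _ ≤ ∑ _lj ∈ I, ENNReal.ofReal ε :=
        Finset.sum_le_sum fun lj hlj => hF _ _ (Finset.mem_filter.1 hlj).2
    _ = ENNReal.ofReal (I.card * ε) := by
        rw [Finset.sum_const, nsmul_eq_mul, ENNReal.ofReal_mul (Nat.cast_nonneg _),
          ENNReal.ofReal_natCast]
    _ ≤ ENNReal.ofReal (n ^ 2 * ε) := ENNReal.ofReal_le_ofReal (by gcongr)

variable {d b n : ℕ} {K : (Fin d → ℝ) → ℝ} {x₀ : Fin d → ℝ} {ρ : ℝ → ℝ} {g : ℕ → ℝ → ℝ}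
  {M c r η β L C₁ c₁ : ℝ} {f : (Fin d → ℝ) → ℝ} {ks : ℕ} {t : ℕ → multiIdx d b → ℝ}
  {θ : (n : ℕ) → ℝ → Sample d n → multiIdx d b → ℝ}

theorem measure_flatEvent_le (hK : IsKernel K) (hc : 0 < c) (hC₁ : 0 ≤ C₁) (hc₁ : 0 ≤ c₁)
    (hflat : ∀ (h s : ℝ) (u : (Fin d → ℝ) → ℝ), 0 < h → KernelFits K x₀ h → Measurable u →
      (∀ x, K (rescale x₀ h x) ≠ 0 → |u x| ≤ η) → 0 < s → s ≤ η →
      modelLaw d g n (flatSet b n ρ K x₀ c h u s)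
        ≤ ENNReal.ofReal (C₁ * Real.exp (-(c₁ * (n * h ^ d)))))
    (hlarge : IsLargeSample b n ρ K x₀ c r η) (ht : IsOracleApprox n K f x₀ M ks t) :
    modelLaw d g n (flatEvent n ρ K f x₀ c r η ks t)
      ≤ ENNReal.ofReal (n ^ 2 * (C₁ * Real.exp (-(c₁ * Real.log n ^ 2)))) := by
  have hτ := lepskiRadius_pos (b := b) hK ρ hc r hlarge.pos
  refine measure_dyadic_union_le (by positivity) ?_ ?_
  · rintro l j ⟨-, hlL, hj⟩
    refine ⟨hlL.trans_lt hlarge.kLast_lt, ?_⟩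
    have hpow : (2 : ℝ) ^ j < 2 ^ n :=
      lt_of_mul_lt_mul_right (hj.trans_lt (hlarge.lt_two_pow_mul l)) (hτ l).le
    exact (pow_lt_pow_iff_right₀ one_lt_two).1 hpow
  · rintro l j ⟨hl, hlL, hj⟩
    refine (hflat _ _ _ (bandwidth_pos d b hlarge.pos l) (hlarge.kernelFits l)
      (ht.measurable_gridError l)
      (fun x hx => (ht.abs_gridError_le l hl x hx).trans (hlarge.stdBound_le l hlL))
      (mul_pos (by positivity) (hτ l)) hj).trans (ENNReal.ofReal_le_ofReal ?_)
    have := hlarge.log_sq_le l hlL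
    gcongr

/-- The constant in front of `S_n(ks) ^ r` in the risk bound, as delivered by
`lintegral_rpow_le_of_lepski_alternative`. -/
def riskFactor (b : ℕ) (ρ : ℝ → ℝ) (K : (Fin d → ℝ) → ℝ) (c r M η : ℝ) : ℝ :=
  lossFactor b ρ K c r M η ^ r *
    (⌈r⌉₊.factorial * Real.exp 1 *
        (2 * (multiIdx d b).card * Real.exp (1 + supNorm (deriv ρ) ^ 2 * supNorm K)) +
      (⌈2 * r⌉₊.factorial * Real.exp 1 *
        (2 * (multiIdx d b).card * Real.exp (1 + supNorm (deriv ρ) ^ 2 * supNorm K)) +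
        2 * (multiIdx d b).card) * ∑' l, lepskiWeight d r l)

theorem lossFactor_nonneg (hK : IsKernel K) (b : ℕ) (ρ : ℝ → ℝ) (hc : 0 < c) (r : ℝ) (hM : 0 ≤ M)
    (hη : 0 < η) : 0 ≤ lossFactor b ρ K c r M η :=
  add_nonneg (mul_nonneg zero_le_two (thresholdConst_pos hK b ρ hc r).le)
    (errorFactor_nonneg hK b hc hM hη)

theorem riskFactor_nonneg (hK : IsKernel K) (b : ℕ) (ρ : ℝ → ℝ) (hc : 0 < c) (r : ℝ) (hM : 0 ≤ M)
    (hη : 0 < η) : 0 ≤ riskFactor b ρ K c r M η := by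
  have hloss := lossFactor_nonneg hK b ρ hc r hM hη
  have hsum : 0 ≤ ∑' l, lepskiWeight d r l := tsum_nonneg (lepskiWeight_nonneg d r)
  unfold riskFactor
  positivity

theorem lintegral_adaptiveEstimator_le (hd : 0 < d) (hb : 0 < b) (hK : IsKernel K)
    (hρ : IsContrast ρ g) (hg : ∀ i, IsSymmDensity (g i)) (hc : 0 < c) (hM : 0 ≤ M) (hη : 0 < η)
    (hr : 0 < r) (hθ : ∀ (n : ℕ) (h : ℝ), 0 < h → h ≤ 1 → IsLPAMinimizer ρ K x₀ M h (θ n h))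
    (hlarge : IsLargeSample b n ρ K x₀ c r η) (hks : ks ≤ kLast d b n)
    (ht : IsOracleApprox n K f x₀ M ks t) :
    ∫⁻ ω, ENNReal.ofReal
        (|adaptiveEstimator (thresholdConst b ρ K c r) θ n (observe f ω) - f x₀| ^ r)
        ∂(modelLaw d g n)
      ≤ ENNReal.ofReal (riskFactor b ρ K c r M η * stdBound d b n ks ^ r) +
        ENNReal.ofReal ((2 * M) ^ r) * modelLaw d g n (flatEvent n ρ K f x₀ c r η ks t) := by
  have hn := hlarge.pos
  have hh := bandwidth_pos d b hn
  have hS := stdBound_pos d b hn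
  have hlog : 0 ≤ supNorm (deriv ρ) * supNorm K :=
    mul_nonneg hρ.supNorm_deriv_nonneg hK.supNorm_nonneg
  refine lintegral_rpow_le_of_lepski_alternative hd hr (lossFactor_nonneg hK b ρ hc r hM hη)
    (by positivity) (by positivity) hks (fun k => (hS k).le) (fun k => stdBound_le_mul d b hn ks k)
    (V := fun k ω => gridGradNorm n ρ K f x₀ t k ω / stdBound d b n k)
    (E := fun l => {ω | √(multiIdx d b).card * deviationFactor d ρ K r * stdBound d b n l ≤
      gridGradNorm n ρ K f x₀ t l ω})
    (fun k => (measurable_gradNorm hK (ht.measurable_gridError k)).div_const _)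
    (fun k ω => div_nonneg (gradNorm_nonneg (hh k) _ _) (hS k).le) (fun ω => abs_nonneg _)
    (fun ω => abs_adaptiveEstimator_sub_le hn hθ ht _ _) (fun l hl hlL => ?_) (fun l hl hlL => ?_)
    fun ω hω => adaptiveEstimator_alternative hK hρ hc hM hη hθ hlarge hks ht hω
  · exact lintegral_exp_gradNorm_div_le hK hρ hg hn (hh l) (hlarge.kernelFits l)
      (ht.measurable_gridError l) (hS l) (ht.abs_gridError_le l hl)
      ((mul_bandwidth_mul_stdBound_sq hn l).symm ▸ one_le_one_add_mul_log l)
      ((pow_le_pow_left₀ hlog hlarge.le_log 2).trans (hlarge.log_sq_le l hlL))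
  · exact measure_le_gradNorm_le hd hb hK hρ hg hn (hh l) (hlarge.kernelFits l)
      (ht.measurable_gridError l) hr.le (hS l).le (ht.abs_gridError_le l hl)
      (hlarge.mul_stdBound_le l hlL) (mul_bandwidth_mul_stdBound_sq hn l)

theorem eventually_kernelFits_bandwidth (d : ℕ) {K : (Fin d → ℝ) → ℝ} {x₀ : Fin d → ℝ}
    (hb : 0 < b) (hK : IsKernel K) (hx₀ : x₀ ∈ cube d) (hin : KernelInward K x₀) :
    ∀ᶠ n : ℕ in atTop, ∀ l, KernelFits K x₀ (bandwidth d b n l) := by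
  obtain ⟨h₁, hh₁, hfit⟩ := exists_kernelFits hK hx₀ hin
  have hmax : Tendsto (fun n : ℕ => hMax d b n) atTop (nhds 0) :=
    (tendsto_rpow_neg_atTop (by positivity)).comp tendsto_natCast_atTop_atTop
  filter_upwards [hmax.eventually_lt_const hh₁, eventually_gt_atTop 0] with n hmaxn hn l
  exact hfit _ (bandwidth_pos d b hn l) ((bandwidth_le_hMax d b n l).trans hmaxn.le)

theorem eventually_lt_two_pow_mul_lepskiRadius (hK : IsKernel K) (b : ℕ) (ρ : ℝ → ℝ) (hc : 0 < c)
    (r : ℝ) (η : ℝ) : ∀ᶠ n : ℕ in atTop, ∀ l, η < 2 ^ n * lepskiRadius b n ρ K c r l := by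
  have hC := thresholdConst_pos hK b ρ hc r
  have hpow : Tendsto (fun n : ℕ => (n : ℝ) ^ 1 / (2 : ℝ) ^ n) atTop (nhds 0) :=
    tendsto_pow_const_div_const_pow_of_one_lt 1 one_lt_two
  have hsmall : Tendsto (fun n : ℕ => η * ((n : ℝ) ^ 1 / (2 : ℝ) ^ n)) atTop (nhds 0) := by
    simpa only [mul_zero] using hpow.const_mul η
  filter_upwards [hsmall.eventually_lt_const (half_pos hC), eventually_gt_atTop 0] with n hηn hn l
  calc η = 2 ^ n * (η * ((n : ℝ) ^ 1 / 2 ^ n) * (1 / n)) := by field_simp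
    _ < 2 ^ n * (thresholdConst b ρ K c r / 2 * (1 / n)) := by gcongr
    _ ≤ 2 ^ n * lepskiRadius b n ρ K c r l := by
        unfold lepskiRadius
        gcongr
        exact one_div_le_stdBound d b hn l

theorem eventually_isLargeSample (hd : 0 < d) (hb : 0 < b) (hK : IsKernel K) (hx₀ : x₀ ∈ cube d)
    (hin : KernelInward K x₀) (ρ : ℝ → ℝ) (hc : 0 < c) (r : ℝ) (hη : 0 < η) :
    ∀ᶠ n : ℕ in atTop, IsLargeSample b n ρ K x₀ c r η := by
  have hC := thresholdConst_pos hK b ρ hc r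
  have hK0 := hK.supNorm_nonneg
  set κ := √((multiIdx d b).card : ℝ) * √(r * d) * supNorm K
  have hκ : 0 ≤ κ := by positivity
  filter_upwards [eventually_gt_atTop 0, eventually_kernelFits_bandwidth d hb hK hx₀ hin,
    eventually_kLast_lt hd hb, eventually_lt_two_pow_mul_lepskiRadius hK b ρ hc r η,
    tendsto_log_natCast_atTop.eventually_ge_atTop (supNorm (deriv ρ) * supNorm K),
    eventually_log_sq_le hd hb, eventually_stdBound_le hd hb hη,
    eventually_stdBound_le hd hb (div_pos hη hC),
    eventually_stdBound_le hd hb (one_div_pos.2 (add_pos_of_nonneg_of_pos hκ one_pos))]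
    with n hn hfit hlast hpow hlog hsq hSη hSC hSκ
  refine ⟨hn, hfit, hlast, hpow, hlog, hsq, hSη, fun l hl => ?_, fun l hl => ?_⟩
  · calc lepskiRadius b n ρ K c r l
        ≤ thresholdConst b ρ K c r / 2 * (η / thresholdConst b ρ K c r) :=
          mul_le_mul_of_nonneg_left (hSC l hl) (half_pos hC).le
      _ = η / 2 := by field_simp
      _ < η := half_lt_self hη
  · calc κ * stdBound d b n l ≤ κ * (1 / (κ + 1)) := by
          gcongr
          exact hSκ l hl
      _ ≤ 1 := by
          rw [mul_one_div, div_le_one (by positivity)]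
          exact (lt_add_one κ).le

theorem exists_maxRisk_le (hd : 0 < d) (hM : 0 ≤ M) (hc : 0 < c) (hx₀ : x₀ ∈ cube d)
    (hK : IsKernel K) (hin : KernelInward K x₀) (hρ : IsContrast ρ g)
    (hg : ∀ i, IsSymmDensity (g i)) (hcurv : ∀ i, c ≤ ∫ z, deriv (deriv ρ) z * g i z)
    (hθ : ∀ (n : ℕ) (h : ℝ), 0 < h → h ≤ 1 → IsLPAMinimizer ρ K x₀ M h (θ n h))
    (hr : 0 < r) (hβ : 0 < β) (hβb : β ≤ b) (hL : 0 ≤ L) :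
    ∃ A ≥ 0, ∀ᶠ n : ℕ in atTop, maxRisk g r x₀
      (adaptiveEstimator (n := n) (thresholdConst b ρ K c r) θ) (holderClass d β L M)
        ≤ ENNReal.ofReal (A * rate d b n β ^ r) := by
  have hb : 0 < b := by exact_mod_cast hβ.trans_le hβb
  obtain ⟨η, hη, C₁, hC₁, c₁, hc₁, hflat⟩ := exists_measure_flatSet_le hK b hρ hc hg hcurv
  obtain ⟨A₀, hA₀, horacle⟩ := exists_oracle_index (B := L * d ^ β) hd hβ hβb (by positivity)
  have hB := riskFactor_nonneg hK b ρ hc r hM hη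
  refine ⟨riskFactor b ρ K c r M η * A₀ ^ r + 1, by positivity, ?_⟩
  filter_upwards [eventually_isLargeSample hd hb hK hx₀ hin ρ hc r hη, horacle,
    tendsto_log_natCast_atTop.eventually_ge_atTop 1,
    eventually_exp_log_sq_le hc₁ ((2 * M) ^ r * C₁) (r + 2) (by positivity)]
    with n hlarge ⟨ks, hks, hbias, hSks⟩ hlog hexp
  have hn := hlarge.pos
  have hrate : 1 / (n : ℝ) ≤ rate d b n β := one_div_le_rate d hβ hβb hn
  have hrate0 : 0 ≤ rate d b n β := (rate_pos d hn hβ.le hβb).le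
  have hstochastic : riskFactor b ρ K c r M η * stdBound d b n ks ^ r
      ≤ riskFactor b ρ K c r M η * A₀ ^ r * rate d b n β ^ r := by
    rw [mul_assoc, ← Real.mul_rpow hA₀ hrate0]
    have := (stdBound_pos d b hn ks).le
    gcongr
  have hflat_event : (2 * M) ^ r * (n ^ 2 * (C₁ * Real.exp (-(c₁ * Real.log n ^ 2))))
      ≤ rate d b n β ^ r :=
    calc (2 * M) ^ r * (n ^ 2 * (C₁ * Real.exp (-(c₁ * Real.log n ^ 2))))
        = n ^ 2 * ((2 * M) ^ r * C₁ * Real.exp (-(c₁ * Real.log n ^ 2))) := by ring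
      _ ≤ n ^ 2 * (1 / (n : ℝ)) ^ (r + 2) := by gcongr
      _ = (1 / (n : ℝ)) ^ r := by
          rw [Real.rpow_add (by positivity), Real.rpow_two]
          field_simp
      _ ≤ rate d b n β ^ r := by gcongr
  refine iSup₂_le fun f hf => ?_
  obtain ⟨t, ht⟩ := exists_isOracleApprox hK hβ hβb hL hM hf hx₀ hn hlarge.kernelFits hbias
  refine (lintegral_adaptiveEstimator_le hd hb hK hρ hg hc hM hη hr hθ hlarge
    (le_kLast hd hn hlog hks) ht).trans ?_
  rw [add_one_mul, ENNReal.ofReal_add (by positivity) (by positivity)]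
  refine add_le_add (ENNReal.ofReal_le_ofReal hstochastic) ((mul_le_mul_right
    (measure_flatEvent_le hK hc hC₁.le hc₁.le (hflat n x₀) hlarge ht) _).trans ?_)
  rw [← ENNReal.ofReal_mul (by positivity)]
  exact ENNReal.ofReal_le_ofReal hflat_event

theorem limsup_inv_mul_lt_top {R : ℕ → ℝ≥0∞} {φ : ℕ → ℝ} {A : ℝ} (hA : 0 ≤ A)
    (hφ : ∀ᶠ n in atTop, 0 < φ n) (hR : ∀ᶠ n in atTop, R n ≤ ENNReal.ofReal (A * φ n)) :
    limsup (fun n => (ENNReal.ofReal (φ n))⁻¹ * R n) atTop < ⊤ := by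
  refine (limsup_le_of_le (a := ENNReal.ofReal A) (by isBoundedDefault) ?_).trans_lt
    ENNReal.ofReal_lt_top
  filter_upwards [hφ, hR] with n hφn hRn
  refine (mul_le_mul_right hRn _).trans_eq ?_
  rw [ENNReal.ofReal_mul hA, mul_comm (ENNReal.ofReal A), ← mul_assoc,
    ENNReal.inv_mul_cancel (ENNReal.ofReal_pos.2 hφn).ne' ENNReal.ofReal_ne_top, one_mul]

end Risk

end RhoLPA

end

theorem theorem2_general (d b : ℕ) (hd : 0 < d) (M : ℝ) (hM : 0 ≤ M) (c : ℝ) (hc : 0 < c)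
    (x₀ : Fin d → ℝ) (hx₀ : x₀ ∈ RhoLPA.cube d)
    (K : (Fin d → ℝ) → ℝ) (hK : RhoLPA.IsKernel K) (hKx₀ : RhoLPA.KernelInward K x₀)
    (ρ : ℝ → ℝ) (g : ℕ → ℝ → ℝ) (hρ : RhoLPA.IsContrast ρ g)
    (hg : ∀ i, RhoLPA.IsSymmDensity (g i))
    (hcurv : ∀ i, c ≤ ∫ z, deriv (deriv ρ) z * g i z)
    (θ : (n : ℕ) → ℝ → RhoLPA.Sample d n → RhoLPA.multiIdx d b → ℝ)
    (hθ : ∀ (n : ℕ) (h : ℝ), 0 < h → h ≤ 1 → RhoLPA.IsLPAMinimizer ρ K x₀ M h (θ n h))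
    (r : ℝ) (hr : 0 < r) :
    ∀ β ∈ Set.Ioc (0 : ℝ) b, ∀ L ≥ (0 : ℝ),
      limsup (fun n : ℕ =>
        (ENNReal.ofReal (RhoLPA.rate d b n β ^ r))⁻¹ *
          RhoLPA.maxRisk g r x₀
            (RhoLPA.adaptiveEstimator (n := n) (RhoLPA.thresholdConst b ρ K c r) θ)
            (RhoLPA.holderClass d β L M)) atTop < ⊤ := by
  rintro β ⟨hβ, hβb⟩ L hL
  obtain ⟨A, hA, hrisk⟩ :=
    RhoLPA.exists_maxRisk_le hd hM hc hx₀ hK hKx₀ hρ hg hcurv hθ hr hβ hβb hL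
  refine RhoLPA.limsup_inv_mul_lt_top hA ?_ hrisk
  filter_upwards [eventually_gt_atTop 0] with n hn
  exact Real.rpow_pos_of_pos (RhoLPA.rate_pos d hn hβ.le hβb) r

theorem theorem2 (d b : ℕ) (hd : 0 < d) (hb : 0 < b) (M : ℝ) (hM : 0 < M) (c : ℝ) (hc : 0 < c)
    (x₀ : Fin d → ℝ) (hx₀ : x₀ ∈ RhoLPA.cube d)
    (K : (Fin d → ℝ) → ℝ) (hK : RhoLPA.IsKernel K) (hKx₀ : RhoLPA.KernelInward K x₀)
    (ρ : ℝ → ℝ) (g : ℕ → ℝ → ℝ) (hρ : RhoLPA.IsContrast ρ g) (hg : g ∈ RhoLPA.noiseClass ρ c)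
    (θ : (n : ℕ) → ℝ → RhoLPA.Sample d n → RhoLPA.multiIdx d b → ℝ)
    (hθ : ∀ (n : ℕ) (h : ℝ), 0 < h → h ≤ 1 → RhoLPA.IsLPAMinimizer ρ K x₀ M h (θ n h))
    (r : ℝ) (hr : 1 ≤ r) :
    ∀ β ∈ Set.Ioc (0 : ℝ) b, ∀ L > (0 : ℝ),
      limsup (fun n : ℕ =>
        (ENNReal.ofReal (RhoLPA.rate d b n β ^ r))⁻¹ *
          RhoLPA.maxRisk g r x₀
            (RhoLPA.adaptiveEstimator (n := n) (RhoLPA.thresholdConst b ρ K c r) θ)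
            (RhoLPA.holderClass d β L M)) atTop < ⊤ :=
  fun β hβ L hL => theorem2_general d b hd M hM.le c hc x₀ hx₀ K hK hKx₀ ρ g hρ
    (fun i => (hg.1 i).isSymmDensity) hg.2 θ hθ r (one_pos.trans_le hr) β hβ L hL.le
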